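/- **Setting.** Let $T>0$, let $\mathbb S^m$ be the symmetric $m\times m$ matrices, and let $A:[0,T]\times\mathbb R^n\to\mathbb R^n$, $B:[0,T]\times\mathbb R^n\to\mathbb R^{n\times m}$, $Q:[0,T]\times\mathbb R^n\to\mathbb R$, $S:[0,T]\times\mathbb R^n\to\mathbb R^m$, $R:[0,T]\times\mathbb R^n\to\mathbb S^m$, $G:\mathbb R^n\to\mathbb R$. Matrix norms are operator norms for the Euclidean norm. Assume: (H1) $A,B$ are continuous and there are $L_A,L_B,\tilde L_B>0$ with $|A(s,x)-A(s,\bar x)|\le L_A|x-\bar x|$, $|B(s,x)-B(s,\bar x)|\le\tilde L_B|x-\bar x|$ and $\langle[B(s,x)-B(s,\bar x)]^T(x-\bar x),u\rangle\le L_B|x-\bar x|^2$ for all $s\in[0,T]$, $u\in\mathbb R^m$, $x,\bar x\in\mathbb R^n$. (H2) $Q,S,R,G$ are continuous, and there are $L,Q_0,G_0,S_0,\rho_0>0$, $\varepsilon_0\in(0,1)$ and a continuous $\rho:\mathbb R^n\to[\rho_0,\infty)$ such that for all $(s,x)\in[0,T]\times\mathbb R^n$ (arguments $(s,x)$ omitted):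 $R\ge\rho(x)I$; $(1-\varepsilon_0)Q-\frac12S^TR^{-1}S\ge-L$; $G(x)\ge-L$; $Q\le Q_0(1+|x|^2)$; $G(x)\le G_0(1+|x|^2)$; $|S|\le S_0(1+|x|)$; $|A+BR^{-1}S|\le L(1+|x|)$; $|BR^{-1}B^T|\le L$. (H3) $A,B,Q,S,R$ are twice continuously differentiable on $[0,T]\times\mathbb R^n$, and $G$ is twice continuously differentiable on $\mathbb R^n$. Fix $t\in[0,T]$, $x\in\mathbb R^n$ and $u\in\mathcal U:=L^2(t,T;\mathbb R^m)$. For a control $u$ let $X=X(\cdot;t,x,u)$ be the (absolutely continuous) solution on $[t,T]$ of $$\dot X(s)=A(s,X(s))+B(s,X(s))u(s),\qquad X(t)=x,$$ and let $$J(t,x;u)=\int_t^T\Big[Q(s,X(s))+\langle S(s,X(s)),u(s)\rangle+\tfrac12\langle R(s,X(s))u(s),u(s)\rangle\Big]ds+G(X(T)).$$ $D_uJ(t,x;u)\in\mathcal U$ denotes the gradient of $J(t,x;\cdot)$ on the Hilbert space $\mathcal U$ at $u$ (for the Fréchet derivative), and $D_{uu}J(t,x;u):\mathcal U\to\mathcal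 U$ the Fréchet derivative of $D_uJ(t,x;\cdot)$ at $u$. Write $B^j$ for the $j$-th column of $B$, $\tilde B^i$ for the $i$-th column of $B^T$, $R^j$ for the $j$-th column of $R$. With all coefficients and their derivatives in the state evaluated at $(s,X(s))$, put $$\mathbf A(s)=A_x+\sum_j u^j(s)B^j_x,$$ let $Y$ be the solution on $[t,T]$ of $$\dot Y(s)=-\mathbf A(s)^TY(s)-Q_x^T-S_x^Tu(s)-\tfrac12\sum_{j,k}u^j(s)u^k(s)(R^{jk}_x)^T,\qquad Y(T)=G_x(X(T))^T,$$ and put $$\mathbf A_1(s)=\sum_iY^i(s)A^i_{xx}+Q_{xx}+\tfrac12\sum_{j,k}u^j(s)u^k(s)R^{jk}_{xx}+\sum_ju^j(s)\Big[\sum_iY^i(s)B^{ij}_{xx}+S^j_{xx}\Big],$$ $$\mathbf C(s)=\sum_ju^j(s)R^j_x+S_x+\sum_iY^i(s)\tilde B^i_x.$$ Let $\Phi(s,\tau)$, $t\le\tau\le s\le T$, be the fundamental matrix of $\mathbf A$: $\frac{d}{ds}\Phi(s,\tau)=\mathbf A(s)\Phi(s,\tau)$ on $[\tau,T]$, $\Phi(\tau,\tau)=I$.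 For $s,r\in[t,T]$ let $$\begin{aligned}\mathbf F(s,r)={}&B(s,X(s))^T\Phi(T,s)^TG_{xx}(X(T))\Phi(T,r)B(r,X(r))\\&+\int_{s\vee r}^TB(s,X(s))^T\Phi(q,s)^T\mathbf A_1(q)\Phi(q,r)B(r,X(r))\,dq\\&+\mathbf C(s)\Phi(s,r)B(r,X(r))I_{[t,s]}(r)+B(s,X(s))^T\Phi(r,s)^T\mathbf C(r)^TI_{[s,T]}(r).\end{aligned}$$ **Proposition 5.1.** Under (H1)–(H3), $X$, $Y$ and $\Phi$ exist, $J(t,x;\cdot)$ is Fréchet differentiable on $\mathcal U$ and its gradient is Fréchet differentiable at $u$. For these $X,Y,\Phi$, the operator $D_{uu}J(t,x;u)$ has a bounded inverse on $\mathcal U$ if and only if the second kind Fredholm integral equation $$w(s)=R(s,X(s))v(s)+\int_t^T\mathbf F(s,r)v(r)\,dr,\qquad\text{a.e. }s\in[t,T],$$ is well-posed, that is, for every $w\in\mathcal U$ it has exactly one solution $v\in\mathcal U$, and $v$ depends continuously on $w$ in $\mathcal U$. Both hold if, for some $\alpha<\frac1T$, $$|R(s,X(s))^{-1}\mathbf F(s,r)|\le\alpha\qquad\text{for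 almost every }s\in[t,T]\text{ and almost every }r\in[t,T].$$ -/

import Mathlib

open MeasureTheory Set
open scoped InnerProduct

/-- Euclidean space of dimension `k`, with the Euclidean norm. -/
abbrev Euc (k : ℕ) : Type := EuclideanSpace ℝ (Fin k)

/-- The Hilbert space `L²(t, T; ℝᵐ)` of admissible controls on `[t, T]` (control set `U = ℝᵐ`). -/
abbrev Control (m : ℕ) (t T : ℝ) : Type :=
  Lp (Euc m) 2 ((volume : Measure ℝ).restrict (Icc t T))

/-- The Hessian of a real function on a real Hilbert space: the Fréchet derivative of its gradient
(the gradient being the Riesz representative of the Fréchet derivative). -/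
noncomputable def hess {H : Type*} [NormedAddCommGroup H] [InnerProductSpace ℝ H] [CompleteSpace H]
    (f : H → ℝ) (x : H) : H →L[ℝ] H :=
  fderiv ℝ (gradient f) x

/-- `Z` is the (absolutely continuous) solution on `[a, b]` of `Z' = f(s, Z)` with value `z` at the
point `c ∈ [a, b]`, in integrated form. -/
structure SolvesODE {E : Type*} [NormedAddCommGroup E] [NormedSpace ℝ E]
    (f : ℝ → E → E) (a b c : ℝ) (z : E) (Z : ℝ → E) : Prop where
  continuousOn : ContinuousOn Z (Icc a b)
  integrable : IntervalIntegrable (fun r => f r (Z r)) volume a b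
  eq_integral : ∀ s ∈ Icc a b, Z s = z + ∫ r in c..s, f r (Z r)

/-- The data of an affine-quadratic control problem with state space `ℝⁿ` and control space `ℝᵐ`
on the time horizon `[0, T]`. Matrices are written as linear maps between Euclidean spaces.
Only the values at times in `[0, T]` are used. -/
structure AQProblem (n m : ℕ) where
  T : ℝ
  A : ℝ → Euc n → Euc n
  B : ℝ → Euc n → (Euc m →L[ℝ] Euc n)
  Q : ℝ → Euc n → ℝ
  S : ℝ → Euc n → Euc m
  R : ℝ → Euc n → (Euc m →L[ℝ] Euc m)
  G : Euc n → ℝ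

namespace AQProblem

variable {n m : ℕ} (P : AQProblem n m)

/-- The domain `[0, T] × ℝⁿ`. -/
def dom : Set (ℝ × Euc n) := Icc 0 P.T ×ˢ univ

/-- Standing assumption on the dynamics, for the control set `U = ℝᵐ`. -/
structure H1 : Prop where
  contA : ContinuousOn (Function.uncurry P.A) P.dom
  contB : ContinuousOn (Function.uncurry P.B) P.dom
  lipA : ∃ LA > 0, ∀ s ∈ Icc 0 P.T, ∀ x y, ‖P.A s x - P.A s y‖ ≤ LA * ‖x - y‖
  lipB : ∃ LB' > 0, ∀ s ∈ Icc 0 P.T, ∀ x y, ‖P.B s x - P.B s y‖ ≤ LB' * ‖x - y‖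
  monoB : ∃ LB > 0, ∀ s ∈ Icc 0 P.T, ∀ (u : Euc m) (x y : Euc n),
    inner ℝ (((P.B s x - P.B s y)†) (x - y)) u ≤ LB * ‖x - y‖ ^ 2

/-- Standing assumption on the cost coefficients (operator norms, `R⁻¹` being a true inverse by
the lower bound on `R`). -/
structure H2 : Prop where
  contQ : ContinuousOn (Function.uncurry P.Q) P.dom
  contS : ContinuousOn (Function.uncurry P.S) P.dom
  contR : ContinuousOn (Function.uncurry P.R) P.dom
  contG : Continuous P.G
  symmR : ∀ s ∈ Icc 0 P.T, ∀ x, IsSelfAdjoint (P.R s x)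
  bounds : ∃ L > 0, ∃ Q₀ > 0, ∃ G₀ > 0, ∃ S₀ > 0, ∃ ε₀ ∈ Ioo (0 : ℝ) 1, ∃ ρ₀ > 0,
    ∃ ρ : Euc n → ℝ, Continuous ρ ∧ (∀ x, ρ₀ ≤ ρ x) ∧
    ∀ s ∈ Icc 0 P.T, ∀ x,
      (∀ u : Euc m, ρ x * ‖u‖ ^ 2 ≤ inner ℝ (P.R s x u) u) ∧
      -L ≤ (1 - ε₀) * P.Q s x - 1 / 2 * inner ℝ ((P.R s x).inverse (P.S s x)) (P.S s x) ∧
      -L ≤ P.G x ∧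
      P.Q s x ≤ Q₀ * (1 + ‖x‖ ^ 2) ∧
      P.G x ≤ G₀ * (1 + ‖x‖ ^ 2) ∧
      ‖P.S s x‖ ≤ S₀ * (1 + ‖x‖) ∧
      ‖P.A s x + P.B s x ((P.R s x).inverse (P.S s x))‖ ≤ L * (1 + ‖x‖) ∧
      ‖P.B s x ∘L (P.R s x).inverse ∘L (P.B s x)†‖ ≤ L

/-- Smoothness assumption: all coefficients are twice continuously differentiable, jointly in time and
state, up to the end points of `[0, T]`. -/
structure H3 : Prop where
  smoothA : ContDiffOn ℝ 2 (Function.uncurry P.A) P.dom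
  smoothB : ContDiffOn ℝ 2 (Function.uncurry P.B) P.dom
  smoothQ : ContDiffOn ℝ 2 (Function.uncurry P.Q) P.dom
  smoothS : ContDiffOn ℝ 2 (Function.uncurry P.S) P.dom
  smoothR : ContDiffOn ℝ 2 (Function.uncurry P.R) P.dom
  smoothG : ContDiff ℝ 2 P.G

/-- `X` is the state trajectory: `X' = A(s, X) + B(s, X) u(s)` on `[t, T]`, `X(t) = x`. -/
def IsState (t : ℝ) (x : Euc n) (u : Control m t P.T) (X : ℝ → Euc n) : Prop :=
  SolvesODE (fun s z => P.A s z + P.B s z (u s)) t P.T t x X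

/-- The state trajectory `X(· ; t, x, u)` (chosen; it is unique on `[t, T]`). -/
noncomputable def state (t : ℝ) (x : Euc n) (u : Control m t P.T) : ℝ → Euc n :=
  Classical.epsilon (P.IsState t x u)

/-- The cost functional `J(t, x; u)`. -/
noncomputable def cost (t : ℝ) (x : Euc n) (u : Control m t P.T) : ℝ :=
  (∫ s in t..P.T,
    (P.Q s (P.state t x u s) + inner ℝ (P.S s (P.state t x u s)) (u s)
      + 1 / 2 * inner ℝ (P.R s (P.state t x u s) (u s)) (u s)))
    + P.G (P.state t x u P.T)

/-- `𝐀(s) = A_x(s, X(s)) + ∑ⱼ uʲ(s) Bʲ_x(s, X(s))`; the sum is the derivative at `X(s)` of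
`y ↦ B(s, y) u(s)`. -/
noncomputable def bA (u : ℝ → Euc m) (X : ℝ → Euc n) (s : ℝ) : Euc n →L[ℝ] Euc n :=
  fderiv ℝ (P.A s) (X s) + fderiv ℝ (fun y => P.B s y (u s)) (X s)

/-- `Y` is the adjoint trajectory along `(X, u)`: on `[t, T]`,
`Y' = - 𝐀(s)ᵀ Y - Q_xᵀ - S_xᵀ u - ½ ∑ uʲ uᵏ (R_xʲᵏ)ᵀ` and `Y(T) = G_x(X(T))ᵀ`. -/
def IsAdjointState (t : ℝ) (u : Control m t P.T) (X Y : ℝ → Euc n) : Prop :=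
  SolvesODE
    (fun s p => -(((P.bA u X s)†) p) - gradient (P.Q s) (X s)
      - ((fderiv ℝ (P.S s) (X s))†) (u s)
      - (1 / 2 : ℝ) • gradient (fun y => inner ℝ (P.R s y (u s)) (u s)) (X s))
    t P.T P.T (gradient P.G (X P.T)) Y

/-- `𝐀₁(s) = ∑ᵢ Yⁱ Aⁱ_xx + Q_xx + ½ ∑ uʲ uᵏ Rʲᵏ_xx + ∑ⱼ uʲ [∑ᵢ Yⁱ Bⁱʲ_xx + Sʲ_xx]` at `(s, X(s))`,
each sum being the Hessian of the corresponding contracted scalar function of the state. -/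
noncomputable def bA₁ (u : ℝ → Euc m) (X Y : ℝ → Euc n) (s : ℝ) : Euc n →L[ℝ] Euc n :=
  hess (fun y => inner ℝ (Y s) (P.A s y)) (X s)
    + hess (P.Q s) (X s)
    + (1 / 2 : ℝ) • hess (fun y => inner ℝ (P.R s y (u s)) (u s)) (X s)
    + hess (fun y => inner ℝ (Y s) (P.B s y (u s))) (X s)
    + hess (fun y => inner ℝ (P.S s y) (u s)) (X s)

/-- `𝐂(s) = ∑ⱼ uʲ Rʲ_x + S_x + ∑ᵢ Yⁱ B̃ⁱ_x` at `(s, X(s))`, where `Rʲ` are the columns of `R` and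
`B̃ⁱ` the columns of `Bᵀ`. -/
noncomputable def bC (u : ℝ → Euc m) (X Y : ℝ → Euc n) (s : ℝ) : Euc n →L[ℝ] Euc m :=
  fderiv ℝ (fun y => P.R s y (u s)) (X s)
    + fderiv ℝ (P.S s) (X s)
    + fderiv ℝ (fun y => ((P.B s y)†) (Y s)) (X s)

/-- `Φ(s, τ)`, `t ≤ τ ≤ s ≤ T`, is the fundamental matrix of `𝐀`:
`d/ds Φ(s, τ) = 𝐀(s) Φ(s, τ)` on `[τ, T]`, `Φ(τ, τ) = I`. -/
def IsFundamental (t : ℝ) (u : Control m t P.T) (X : ℝ → Euc n)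
    (Φ : ℝ → ℝ → (Euc n →L[ℝ] Euc n)) : Prop :=
  ∀ τ ∈ Icc t P.T,
    SolvesODE (fun s M => P.bA u X s ∘L M) τ P.T τ (ContinuousLinearMap.id ℝ (Euc n))
      (fun s => Φ s τ)

/-- The kernel `𝐅(s, r)`. -/
noncomputable def bF (t : ℝ) (u : Control m t P.T) (X Y : ℝ → Euc n)
    (Φ : ℝ → ℝ → (Euc n →L[ℝ] Euc n)) (s r : ℝ) : Euc m →L[ℝ] Euc m :=
  (P.B s (X s))† ∘L (Φ P.T s)† ∘L hess P.G (X P.T) ∘L Φ P.T r ∘L P.B r (X r)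
    + (∫ q in (max s r)..P.T,
        (P.B s (X s))† ∘L (Φ q s)† ∘L P.bA₁ u X Y q ∘L Φ q r ∘L P.B r (X r))
    + (Icc t s).indicator (fun r' => P.bC u X Y s ∘L Φ s r' ∘L P.B r' (X r')) r
    + (Icc s P.T).indicator (fun r' => (P.B s (X s))† ∘L (Φ r' s)† ∘L (P.bC u X Y r')†) r

/-- `v` solves the second kind Fredholm equation
`w(s) = R(s, X(s)) v(s) + ∫_t^T 𝐅(s, r) v(r) dr` for almost every `s ∈ [t, T]`. -/
def SolvesFredholm (t : ℝ) (u : Control m t P.T) (X Y : ℝ → Euc n)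
    (Φ : ℝ → ℝ → (Euc n →L[ℝ] Euc n)) (w v : Control m t P.T) : Prop :=
  ∀ᵐ s ∂((volume : Measure ℝ).restrict (Icc t P.T)),
    IntervalIntegrable (fun r => P.bF t u X Y Φ s r (v r)) volume t P.T ∧
    w s = P.R s (X s) (v s) + ∫ r in t..P.T, P.bF t u X Y Φ s r (v r)

/-- Well-posedness (in the sense of Hadamard) of the Fredholm equation: for every right-hand side
there is exactly one solution in `L²`, and it depends continuously on the right-hand side. -/
def FredholmWellPosed (t : ℝ) (u : Control m t P.T) (X Y : ℝ → Euc n)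
    (Φ : ℝ → ℝ → (Euc n →L[ℝ] Euc n)) : Prop :=
  ∃ sol : Control m t P.T → Control m t P.T, Continuous sol ∧
    ∀ w v, P.SolvesFredholm t u X Y Φ w v ↔ v = sol w

end AQProblem

/-!
The state equation depends affinely on the control, so by Picard iteration it has a unique solution
on `[t, T]`. The superposition operators of the coefficients are twice continuously differentiable
on `C([t, T]; ℝⁿ)`, and the derivative of the state equation in the state is invertible, so by the
implicit function theorem the state is a `C²` function of the control; hence so is the cost.

The adjoint state is the Lagrange multiplier of the state equation: it makes the cost stationary in
the state. Therefore the gradient of the cost at `u` is `S + R u + Bᵀ Y`, and the second derivative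
of the state drops out of its derivative, which becomes `D_uu J v = R v + 𝐂 ζ + Bᵀ l`, with the
linearised state `ζ` and a linearised adjoint state `l`. Variation of constants writes both of them
through the fundamental matrix, and exchanging the order of integration turns the right-hand side
into `R v + ∫ 𝐅(·, r) v(r) dr`. So the Fredholm equation is `D_uu J v = w`; by the open mapping
theorem it is well-posed if and only if `D_uu J` is invertible. If `|R⁻¹ 𝐅| ≤ α` with
`α (T - t) < 1`, then `R⁻¹ D_uu J` differs from the identity by an operator of norm less than one.
-/

/-! ### Carathéodory differential equations -/

section CauchySchwarz

variable {α : Type*} [MeasurableSpace α] {μ : Measure α} {f g : α → ℝ}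

theorem sq_integral_mul_le_of_memLp_two (hf : MemLp f 2 μ) (hg : MemLp g 2 μ) :
    (∫ r, f r * g r ∂μ) ^ 2 ≤ (∫ r, f r ^ 2 ∂μ) * ∫ r, g r ^ 2 ∂μ := by
  have inner_toLp : ∀ {f g : α → ℝ} (hf : MemLp f 2 μ) (hg : MemLp g 2 μ),
      inner ℝ (hf.toLp f) (hg.toLp g) = ∫ r, f r * g r ∂μ := by
    intro f g hf hg
    rw [L2.inner_def]
    refine integral_congr_ae ?_
    filter_upwards [hf.coeFn_toLp, hg.coeFn_toLp] with r hr hr'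
    rw [hr, hr', real_inner_eq_re_inner, RCLike.inner_apply, mul_comm]
    rfl
  have h := real_inner_mul_inner_self_le (hf.toLp f) (hg.toLp g)
  rw [inner_toLp, inner_toLp, inner_toLp] at h
  simpa only [sq] using h

theorem sq_norm_integral_le_of_norm_le_mul {E : Type*} [NormedAddCommGroup E] [NormedSpace ℝ E]
    {h : α → E} (hf : MemLp f 2 μ) (hg : MemLp g 2 μ) (hfg : ∀ᵐ r ∂μ, ‖h r‖ ≤ f r * g r) :
    ‖∫ r, h r ∂μ‖ ^ 2 ≤ (∫ r, f r ^ 2 ∂μ) * ∫ r, g r ^ 2 ∂μ :=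
  calc ‖∫ r, h r ∂μ‖ ^ 2 ≤ (∫ r, f r * g r ∂μ) ^ 2 := by
        gcongr
        exact norm_integral_le_of_norm_le (hf.integrable_mul hg) hfg
    _ ≤ _ := sq_integral_mul_le_of_memLp_two hf hg

end CauchySchwarz

section Icc

variable {E : Type*} [NormedAddCommGroup E] {a b c x y : ℝ}

theorem memLp_Icc_of_continuousOn {f : ℝ → E} (hf : ContinuousOn f (Icc a b)) (p : ENNReal) :
    MemLp f p (volume.restrict (Icc a b)) := by
  obtain ⟨C, hC⟩ := isCompact_Icc.exists_bound_of_continuousOn hf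
  exact MemLp.of_bound (hf.aestronglyMeasurable measurableSet_Icc) C
    ((ae_restrict_iff' measurableSet_Icc).2 (.of_forall hC))

theorem intervalIntegrable_of_mem_Icc {f : ℝ → E} (hf : IntervalIntegrable f volume a b)
    (hx : x ∈ Icc a b) (hy : y ∈ Icc a b) : IntervalIntegrable f volume x y :=
  hf.mono_set (by rw [uIcc_of_le (hx.1.trans hx.2)]; exact uIcc_subset_Icc hx hy)

variable [NormedSpace ℝ E]

theorem intervalIntegral_congr_ae_Icc {f g : ℝ → E} (hx : x ∈ Icc a b) (hy : y ∈ Icc a b)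
    (h : f =ᵐ[volume.restrict (Icc a b)] g) : ∫ r in x..y, f r = ∫ r in x..y, g r := by
  apply intervalIntegral.integral_congr_ae
  rw [Filter.EventuallyEq, ae_restrict_iff' measurableSet_Icc] at h
  filter_upwards [h] with r hr hr'
  exact hr (uIcc_subset_Icc hx hy (uIoc_subset_uIcc hr'))

theorem continuousOn_Icc_intervalIntegral {g : ℝ → E} (hc : c ∈ Icc a b)
    (hg : IntervalIntegrable g volume a b) :
    ContinuousOn (fun s => ∫ r in c..s, g r) (Icc a b) := by
  have hab : a ≤ b := hc.1.trans hc.2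
  rw [← uIcc_of_le hab] at hc ⊢
  exact intervalIntegral.continuousOn_primitive_interval' hg hc

end Icc

section Volterra

variable {E : Type*} [NormedAddCommGroup E] {a b : ℝ}

theorem sq_norm_iterate_sub_le_of_volterra (hab : a ≤ b) (c : Icc a b)
    (Γ : C(Icc a b, E) → C(Icc a b, E)) {M : ℝ} (hM : 0 ≤ M)
    (hΓ : ∀ X Y s, ‖Γ X s - Γ Y s‖ ^ 2 ≤
      M * ∫ r in uIoc (c : ℝ) s, ‖X (projIcc a b hab r) - Y (projIcc a b hab r)‖ ^ 2)
    (X Y : C(Icc a b, E)) (k : ℕ) (s : Icc a b) :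
    ‖Γ^[k] X s - Γ^[k] Y s‖ ^ 2 ≤ (M * |(s : ℝ) - c|) ^ k / k.factorial * dist X Y ^ 2 := by
  induction k generalizing s with
  | zero =>
    rw [pow_zero, Nat.factorial_zero, Nat.cast_one, div_one, one_mul, ← dist_eq_norm]
    gcongr
    exact ContinuousMap.dist_apply_le_dist s
  | succ k ih =>
    rw [Function.iterate_succ_apply', Function.iterate_succ_apply']
    calc ‖Γ (Γ^[k] X) s - Γ (Γ^[k] Y) s‖ ^ 2
        ≤ M * ∫ r in uIoc (c : ℝ) s,
            ‖Γ^[k] X (projIcc a b hab r) - Γ^[k] Y (projIcc a b hab r)‖ ^ 2 := hΓ _ _ s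
      _ ≤ M * ∫ r in uIoc (c : ℝ) s, M ^ k / k.factorial * dist X Y ^ 2 * |r - c| ^ k := by
          refine mul_le_mul_of_nonneg_left (setIntegral_mono_on
            (Continuous.integrableOn_uIoc (by fun_prop))
            (Continuous.integrableOn_uIoc (by fun_prop)) measurableSet_uIoc fun r hr => ?_) hM
          have hr' : r ∈ Icc a b := uIcc_subset_Icc c.2 s.2 (uIoc_subset_uIcc hr)
          refine (ih _).trans_eq ?_
          rw [projIcc_of_mem hab hr', mul_pow]
          ring
      _ = (M * |(s : ℝ) - c|) ^ (k + 1) / (k + 1).factorial * dist X Y ^ 2 := by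
          rw [integral_const_mul, integral_pow_abs_sub_uIoc, Nat.factorial_succ, mul_pow]
          push_cast
          field_simp
          ring

theorem existsUnique_fixedPoint_of_volterra [CompleteSpace E] (hab : a ≤ b) (c : Icc a b)
    (Γ : C(Icc a b, E) → C(Icc a b, E)) {M : ℝ} (hM : 0 ≤ M)
    (hΓ : ∀ X Y s, ‖Γ X s - Γ Y s‖ ^ 2 ≤
      M * ∫ r in uIoc (c : ℝ) s, ‖X (projIcc a b hab r) - Y (projIcc a b hab r)‖ ^ 2) :
    ∃! X, Γ X = X := by
  obtain ⟨k, hk⟩ := (FloorSemiring.tendsto_pow_div_factorial_atTop (M * (b - a))).eventually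
    (gt_mem_nhds zero_lt_one) |>.exists
  have hK : 0 ≤ (M * (b - a)) ^ k / k.factorial :=
    div_nonneg (pow_nonneg (mul_nonneg hM (sub_nonneg.2 hab)) k) (Nat.cast_nonneg _)
  have hcontr : ContractingWith (√((M * (b - a)) ^ k / k.factorial)).toNNReal Γ^[k] := by
    refine ⟨?_, LipschitzWith.of_dist_le_mul fun X Y => ?_⟩
    · rwa [Real.toNNReal_lt_one, Real.sqrt_lt' one_pos, one_pow]
    rw [Real.coe_toNNReal _ (Real.sqrt_nonneg _), ContinuousMap.dist_le (by positivity)]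
    intro s
    have hs : |(s : ℝ) - c| ≤ b - a := abs_sub_le_iff.2
      ⟨by linarith [s.2.2, c.2.1], by linarith [s.2.1, c.2.2]⟩
    rw [dist_eq_norm]
    refine (sq_le_sq₀ (norm_nonneg _) (by positivity)).1 ?_
    rw [mul_pow √_, Real.sq_sqrt hK]
    exact (sq_norm_iterate_sub_le_of_volterra hab c Γ hM hΓ X Y k s).trans (by gcongr)
  exact ⟨_, hcontr.isFixedPt_fixedPoint_iterate, fun _ hY =>
    hcontr.fixedPoint_unique (Function.IsFixedPt.iterate hY k)⟩

end Volterra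

section ODE

variable {E : Type*} [NormedAddCommGroup E] [NormedSpace ℝ E] {a b c : ℝ} {f : ℝ → E → E}
  {ℓ : ℝ → ℝ}

/-- Carathéodory vector fields on `[a, b]` which are Lipschitz in the state with a square integrable
Lipschitz bound `ℓ`. Measurability in time is only asked for along continuous curves. -/
structure LipschitzField (f : ℝ → E → E) (a b : ℝ) (ℓ : ℝ → ℝ) : Prop where
  memLp : MemLp ℓ 2 (volume.restrict (Icc a b))
  lip : ∀ r ∈ Icc a b, ∀ z z', ‖f r z - f r z'‖ ≤ ℓ r * ‖z - z'‖
  integrable : ∀ Z : ℝ → E, ContinuousOn Z (Icc a b) →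
    IntervalIntegrable (fun r => f r (Z r)) volume a b

namespace LipschitzField

/-- The Picard operator `X ↦ z + ∫ f(r, X(r)) dr` of a vector field, with base point `c`. -/
noncomputable def picardMap (hf : LipschitzField f a b ℓ) (hab : a ≤ b) (hc : c ∈ Icc a b) (z : E)
    (X : C(Icc a b, E)) : C(Icc a b, E) where
  toFun s := z + ∫ r in c..s, f r (X (projIcc a b hab r))
  continuous_toFun := continuous_const.add <| continuousOn_iff_continuous_domRestrict.1 <|
    continuousOn_Icc_intervalIntegral hc <|
      hf.integrable (fun r => X (projIcc a b hab r)) (by fun_prop)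

theorem sq_norm_picardMap_sub_le (hf : LipschitzField f a b ℓ) (hab : a ≤ b) (hc : c ∈ Icc a b)
    (z : E) (X Y : C(Icc a b, E)) (s : Icc a b) :
    ‖hf.picardMap hab hc z X s - hf.picardMap hab hc z Y s‖ ^ 2 ≤
      (∫ r in Icc a b, ℓ r ^ 2) *
        ∫ r in uIoc c s, ‖X (projIcc a b hab r) - Y (projIcc a b hab r)‖ ^ 2 := by
  have hsub : uIoc c s ⊆ Icc a b := uIoc_subset_uIcc.trans (uIcc_subset_Icc hc s.2)
  have hle : volume.restrict (uIoc c s) ≤ volume.restrict (Icc a b) :=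
    Measure.restrict_mono hsub le_rfl
  have hi : ∀ X : C(Icc a b, E),
      IntervalIntegrable (fun r => f r (X (projIcc a b hab r))) volume c s := fun X =>
    intervalIntegrable_of_mem_Icc
      (hf.integrable (fun r => X (projIcc a b hab r)) (by fun_prop)) hc s.2
  have hXY : MemLp (fun r => ‖X (projIcc a b hab r) - Y (projIcc a b hab r)‖) 2
      (volume.restrict (uIoc c s)) :=
    (memLp_Icc_of_continuousOn (by fun_prop) 2).mono_measure hle
  simp only [picardMap, ContinuousMap.coe_mk, add_sub_add_left_eq_sub]
  rw [← intervalIntegral.integral_sub (hi X) (hi Y), intervalIntegral.norm_intervalIntegral_eq]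
  refine (sq_norm_integral_le_of_norm_le_mul (hf.memLp.mono_measure hle) hXY ?_).trans ?_
  · filter_upwards [ae_restrict_mem measurableSet_uIoc] with r hr
    exact hf.lip r (hsub hr) _ _
  · gcongr
    · exact .of_forall fun r => sq_nonneg _
    · exact hf.memLp.integrable_sq

theorem picardMap_domRestrict (hf : LipschitzField f a b ℓ) (hab : a ≤ b) (hc : c ∈ Icc a b)
    {z : E} {Z : ℝ → E} (hZ : SolvesODE f a b c z Z) :
    hf.picardMap hab hc z ⟨_, hZ.continuousOn.domRestrict⟩ =
      ⟨_, hZ.continuousOn.domRestrict⟩ := by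
  ext s
  simp only [picardMap, ContinuousMap.coe_mk, domRestrict_apply]
  rw [hZ.eq_integral s s.2]
  congr 1
  refine intervalIntegral.integral_congr fun r hr => ?_
  simp only [projIcc_of_mem hab (uIcc_subset_Icc hc s.2 hr)]

theorem solvesODE_of_picardMap_eq (hf : LipschitzField f a b ℓ) (hab : a ≤ b) (hc : c ∈ Icc a b)
    {z : E} {X : C(Icc a b, E)} (hX : hf.picardMap hab hc z X = X) :
    SolvesODE f a b c z (fun r => X (projIcc a b hab r)) where
  continuousOn := by fun_prop
  integrable := hf.integrable _ (by fun_prop)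
  eq_integral s hs := by
    simp only [projIcc_of_mem hab hs]
    exact (DFunLike.congr_fun hX ⟨s, hs⟩).symm

variable [CompleteSpace E]

theorem existsUnique_picardMap_eq (hf : LipschitzField f a b ℓ) (hab : a ≤ b) (hc : c ∈ Icc a b)
    (z : E) : ∃! X, hf.picardMap hab hc z X = X :=
  existsUnique_fixedPoint_of_volterra hab ⟨c, hc⟩ _
    (integral_nonneg fun _ => sq_nonneg _) (hf.sq_norm_picardMap_sub_le hab hc z)

theorem exists_solvesODE (hf : LipschitzField f a b ℓ) (hc : c ∈ Icc a b) (z : E) :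
    ∃ Z, SolvesODE f a b c z Z :=
  have hab := hc.1.trans hc.2
  let ⟨_, hX, _⟩ := hf.existsUnique_picardMap_eq hab hc z
  ⟨_, hf.solvesODE_of_picardMap_eq hab hc hX⟩

theorem eqOn_of_solvesODE (hf : LipschitzField f a b ℓ) (hc : c ∈ Icc a b) {z : E} {Z W : ℝ → E}
    (hZ : SolvesODE f a b c z Z) (hW : SolvesODE f a b c z W) : EqOn Z W (Icc a b) := fun s hs =>
  have hab := hc.1.trans hc.2
  DFunLike.congr_fun ((hf.existsUnique_picardMap_eq hab hc z).unique
    (hf.picardMap_domRestrict hab hc hZ) (hf.picardMap_domRestrict hab hc hW)) ⟨s, hs⟩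

end LipschitzField

end ODE

section AbsolutelyContinuous

open AbsolutelyContinuousOnInterval Filter Topology

variable {a b : ℝ}

theorem absolutelyContinuousOnInterval_of_dist_le {X Y Z : Type*} [PseudoMetricSpace X]
    [PseudoMetricSpace Y] [PseudoMetricSpace Z] {F : ℝ → X} {G : ℝ → Y} {h : ℝ → Z} {C : ℝ}
    (hF : AbsolutelyContinuousOnInterval F a b) (hG : AbsolutelyContinuousOnInterval G a b)
    (hh : ∀ x ∈ uIcc a b, ∀ y ∈ uIcc a b,
      dist (h x) (h y) ≤ C * (dist (F x) (F y) + dist (G x) (G y))) :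
    AbsolutelyContinuousOnInterval h a b := by
  have hlim := (Filter.Tendsto.add hF hG).const_mul C
  rw [add_zero, mul_zero] at hlim
  refine squeeze_zero' (.of_forall fun _ => Finset.sum_nonneg fun _ _ => dist_nonneg) ?_ hlim
  have hmem : ∀ᶠ I : ℕ × (ℕ → ℝ × ℝ) in totalLengthFilter ⊓ 𝓟 (disjWithin a b),
      I ∈ disjWithin a b := mem_inf_of_right (mem_principal_self _)
  filter_upwards [hmem] with I hI
  rw [← Finset.sum_add_distrib, Finset.mul_sum]
  exact Finset.sum_le_sum fun i hi => hh _ (hI.1 i hi).1 _ (hI.1 i hi).2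

variable {E F G : Type*} [NormedAddCommGroup E] [NormedSpace ℝ E]
  [NormedAddCommGroup F] [NormedSpace ℝ F] [NormedAddCommGroup G] [NormedSpace ℝ G]

theorem absolutelyContinuousOnInterval_bilin (L : E →L[ℝ] F →L[ℝ] G) {φ : ℝ → E} {ψ : ℝ → F}
    (hφ : AbsolutelyContinuousOnInterval φ a b) (hψ : AbsolutelyContinuousOnInterval ψ a b) :
    AbsolutelyContinuousOnInterval (fun s => L (φ s) (ψ s)) a b := by
  obtain ⟨C₁, hC₁⟩ := hφ.exists_bound
  obtain ⟨C₂, hC₂⟩ := hψ.exists_bound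
  refine absolutelyContinuousOnInterval_of_dist_le hφ hψ (C := ‖L‖ * max C₁ C₂)
    fun x hx y hy => ?_
  have hψx : ‖ψ x‖ ≤ max C₁ C₂ := (hC₂ x hx).trans (le_max_right _ _)
  have hφy : ‖φ y‖ ≤ max C₁ C₂ := (hC₁ y hy).trans (le_max_left _ _)
  rw [dist_eq_norm, dist_eq_norm, dist_eq_norm]
  calc ‖L (φ x) (ψ x) - L (φ y) (ψ y)‖ = ‖L (φ x - φ y) (ψ x) + L (φ y) (ψ x - ψ y)‖ := by simp
    _ ≤ ‖L‖ * ‖φ x - φ y‖ * ‖ψ x‖ + ‖L‖ * ‖φ y‖ * ‖ψ x - ψ y‖ :=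
        norm_add_le_of_le (L.le_opNorm₂ _ _) (L.le_opNorm₂ _ _)
    _ ≤ ‖L‖ * ‖φ x - φ y‖ * max C₁ C₂ + ‖L‖ * max C₁ C₂ * ‖ψ x - ψ y‖ := by gcongr
    _ = ‖L‖ * max C₁ C₂ * (‖φ x - φ y‖ + ‖ψ x - ψ y‖) := by ring

theorem absolutelyContinuousOnInterval_intervalIntegral {f : ℝ → E}
    (hf : IntervalIntegrable f volume a b) :
    AbsolutelyContinuousOnInterval (fun x => ∫ r in a..x, f r) a b := by
  have hnorm := hf.norm.absolutelyContinuousOnInterval_intervalIntegral (c := a) left_mem_uIcc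
  refine absolutelyContinuousOnInterval_of_dist_le (C := 1) hnorm hnorm fun x hx y hy => ?_
  have hi : ∀ x ∈ uIcc a b, IntervalIntegrable f volume a x := fun x hx =>
    hf.mono_set (uIcc_subset_uIcc left_mem_uIcc hx)
  rw [dist_comm, dist_comm (∫ v in a..x, ‖f v‖), dist_eq_norm, dist_eq_norm,
    intervalIntegral.integral_interval_sub_left (hi y hy) (hi x hx),
    intervalIntegral.integral_interval_sub_left (hi y hy).norm (hi x hx).norm, Real.norm_eq_abs]
  linarith [intervalIntegral.norm_integral_le_abs_integral_norm (f := f) (a := x) (b := y)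
    (μ := volume), abs_nonneg (∫ v in x..y, ‖f v‖)]

end AbsolutelyContinuous

section Primitive

variable {E F G : Type*} [NormedAddCommGroup E] [NormedSpace ℝ E]
  [NormedAddCommGroup F] [NormedSpace ℝ F] [NormedAddCommGroup G] [NormedSpace ℝ G]
  {a b c : ℝ}

theorem intervalIntegrable_bilin_left (L : E →L[ℝ] F →L[ℝ] G) {f : ℝ → E} {g : ℝ → F} (hab : a ≤ b)
    (hf : IntervalIntegrable f volume a b) (hg : ContinuousOn g (Icc a b)) :
    IntervalIntegrable (fun r => L (f r) (g r)) volume a b := by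
  obtain ⟨C, hC⟩ := isCompact_Icc.exists_bound_of_continuousOn hg
  rw [intervalIntegrable_iff_integrableOn_Icc_of_le hab] at hf ⊢
  exact L.integrable_of_bilin_of_bdd_right C hf (hg.aestronglyMeasurable measurableSet_Icc)
    ((ae_restrict_iff' measurableSet_Icc).2 (.of_forall hC))

/-- `φ` is absolutely continuous on `[a, b]` with integrable derivative `φ'`, in integrated
form. -/
structure IsPrimitive (a b : ℝ) (φ φ' : ℝ → E) : Prop where
  integrable : IntervalIntegrable φ' volume a b
  eq_integral : ∀ s ∈ Icc a b, φ s = φ a + ∫ r in a..s, φ' r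

namespace IsPrimitive

variable {φ φ' χ χ' : ℝ → E} {ψ ψ' : ℝ → F}

theorem sub_eq (h : IsPrimitive a b φ φ') {x y : ℝ} (hx : x ∈ Icc a b) (hy : y ∈ Icc a b) :
    φ y - φ x = ∫ r in x..y, φ' r := by
  have ha : a ∈ Icc a b := left_mem_Icc.2 (hx.1.trans hx.2)
  rw [h.eq_integral x hx, h.eq_integral y hy, add_sub_add_left_eq_sub,
    intervalIntegral.integral_interval_sub_left (intervalIntegrable_of_mem_Icc h.integrable ha hy)
      (intervalIntegrable_of_mem_Icc h.integrable ha hx)]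

theorem eq_add (h : IsPrimitive a b φ φ') {x y : ℝ} (hx : x ∈ Icc a b) (hy : y ∈ Icc a b) :
    φ y = φ x + ∫ r in x..y, φ' r := by
  rw [← h.sub_eq hx hy, add_sub_cancel]

theorem mono (h : IsPrimitive a b φ φ') {x y : ℝ} (hx : x ∈ Icc a b) (hy : y ∈ Icc a b) :
    IsPrimitive x y φ φ' where
  integrable := intervalIntegrable_of_mem_Icc h.integrable hx hy
  eq_integral _ hs := h.eq_add hx ⟨hx.1.trans hs.1, hs.2.trans hy.2⟩

theorem congr (h : IsPrimitive a b φ φ') (hab : a ≤ b) (hφ : EqOn χ φ (Icc a b))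
    (hφ' : χ' =ᵐ[volume.restrict (Icc a b)] φ') : IsPrimitive a b χ χ' where
  integrable := by
    have hi := h.integrable
    rw [intervalIntegrable_iff_integrableOn_Icc_of_le hab] at hi ⊢
    exact Integrable.congr hi hφ'.symm
  eq_integral s hs := by
    have ha := left_mem_Icc.2 hab
    rw [hφ hs, hφ ha, h.eq_integral s hs, intervalIntegral_congr_ae_Icc ha hs hφ']

theorem intervalIntegral {g : ℝ → E} (hg : IntervalIntegrable g volume a b) (hc : c ∈ Icc a b) :
    IsPrimitive a b (fun s => ∫ r in c..s, g r) g where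
  integrable := hg
  eq_integral s hs := by
    have ha : a ∈ Icc a b := left_mem_Icc.2 (hc.1.trans hc.2)
    rw [intervalIntegral.integral_add_adjacent_intervals (intervalIntegrable_of_mem_Icc hg hc ha)
      (intervalIntegrable_of_mem_Icc hg ha hs)]

theorem const (x : E) : IsPrimitive a b (fun _ => x) (fun _ => (0 : E)) where
  integrable := intervalIntegrable_const
  eq_integral s _ := by rw [intervalIntegral.integral_zero, add_zero]

theorem add (h : IsPrimitive a b φ φ') (h' : IsPrimitive a b χ χ') :
    IsPrimitive a b (fun s => φ s + χ s) (fun s => φ' s + χ' s) where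
  integrable := h.integrable.add h'.integrable
  eq_integral s hs := by
    have ha : a ∈ Icc a b := left_mem_Icc.2 (hs.1.trans hs.2)
    rw [intervalIntegral.integral_add (intervalIntegrable_of_mem_Icc h.integrable ha hs)
      (intervalIntegrable_of_mem_Icc h'.integrable ha hs), h.eq_integral s hs,
      h'.eq_integral s hs]
    abel

theorem neg (h : IsPrimitive a b φ φ') :
    IsPrimitive a b (fun s => - φ s) (fun s => - φ' s) where
  integrable := h.integrable.neg
  eq_integral s hs := by
    rw [intervalIntegral.integral_neg, h.eq_integral s hs, neg_add]

theorem clm [CompleteSpace E] [CompleteSpace F] (L : E →L[ℝ] F) (h : IsPrimitive a b φ φ') :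
    IsPrimitive a b (fun s => L (φ s)) (fun s => L (φ' s)) where
  integrable := ⟨L.integrable_comp h.integrable.1, L.integrable_comp h.integrable.2⟩
  eq_integral s hs := by
    have ha : a ∈ Icc a b := left_mem_Icc.2 (hs.1.trans hs.2)
    rw [L.intervalIntegral_comp_comm (intervalIntegrable_of_mem_Icc h.integrable ha hs), ← map_add,
      ← h.eq_integral s hs]

theorem absolutelyContinuousOnInterval (h : IsPrimitive a b φ φ') (hab : a ≤ b) :
    AbsolutelyContinuousOnInterval φ a b := by
  have hint := absolutelyContinuousOnInterval_intervalIntegral h.integrable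
  refine absolutelyContinuousOnInterval_of_dist_le (C := 1) hint hint fun x hx y hy => ?_
  rw [uIcc_of_le hab] at hx hy
  rw [h.eq_integral x hx, h.eq_integral y hy, dist_add_left]
  linarith [dist_nonneg (x := ∫ r in a..x, φ' r) (y := ∫ r in a..y, φ' r)]

theorem continuousOn (h : IsPrimitive a b φ φ') : ContinuousOn φ (Icc a b) := by
  rcases le_or_gt a b with hab | hab
  · exact uIcc_of_le hab ▸ (h.absolutelyContinuousOnInterval hab).continuousOn
  · simp [Icc_eq_empty hab.not_ge]

theorem ae_hasDerivAt [CompleteSpace E] (h : IsPrimitive a b φ φ') (hab : a ≤ b) :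
    ∀ᵐ s, s ∈ uIcc a b → HasDerivAt φ (φ' s) s := by
  filter_upwards [h.integrable.ae_hasDerivAt_integral, Measure.ae_ne volume a,
    Measure.ae_ne volume b] with s hs hsa hsb hmem
  have hderiv := (hs hmem a left_mem_uIcc).const_add (φ a)
  rw [uIcc_of_le hab] at hmem
  refine hderiv.congr_of_eventuallyEq ?_
  filter_upwards [Icc_mem_nhds (hmem.1.lt_of_ne' hsa) (hmem.2.lt_of_ne hsb)] with x hx
  exact h.eq_integral x hx

theorem of_ae_hasDerivAt [CompleteSpace E] (hab : a ≤ b)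
    (hac : AbsolutelyContinuousOnInterval φ a b) (hint : IntervalIntegrable φ' volume a b)
    (hderiv : ∀ᵐ s, s ∈ uIcc a b → HasDerivAt φ (φ' s) s) : IsPrimitive a b φ φ' := by
  obtain ⟨C, hC⟩ := (hac.sub
    (absolutelyContinuousOnInterval_intervalIntegral hint)).const_of_ae_hasDerivAt_zero (by
      filter_upwards [hderiv, hint.ae_hasDerivAt_integral] with s hφ hI hs
      simpa only [sub_self] using (hφ hs).sub (hI hs a left_mem_uIcc))
  refine ⟨hint, fun s hs => ?_⟩
  have hs' := hC s (uIcc_of_le hab ▸ hs)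
  have ha' := hC a left_mem_uIcc
  simp only [Pi.sub_apply, intervalIntegral.integral_same, sub_zero] at hs' ha'
  rw [← sub_eq_iff_eq_add, hs', ha']

theorem bilin [CompleteSpace E] [CompleteSpace F] [CompleteSpace G]
    (L : E →L[ℝ] F →L[ℝ] G) (hφ : IsPrimitive a b φ φ') (hψ : IsPrimitive a b ψ ψ')
    (hab : a ≤ b) :
    IsPrimitive a b (fun s => L (φ s) (ψ s)) (fun s => L (φ' s) (ψ s) + L (φ s) (ψ' s)) := by
  refine of_ae_hasDerivAt hab (absolutelyContinuousOnInterval_bilin L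
    (hφ.absolutelyContinuousOnInterval hab) (hψ.absolutelyContinuousOnInterval hab))
    ((intervalIntegrable_bilin_left L hab hφ.integrable hψ.continuousOn).add
      (intervalIntegrable_bilin_left L.flip hab hψ.integrable hφ.continuousOn)) ?_
  filter_upwards [hφ.ae_hasDerivAt hab, hψ.ae_hasDerivAt hab] with s hφs hψs hs
  exact (L.hasFDerivAt.comp_hasDerivAt s (hφs hs)).clm_apply (hψs hs)

theorem inner {E : Type*} [NormedAddCommGroup E] [InnerProductSpace ℝ E] [CompleteSpace E]
    {φ φ' ψ ψ' : ℝ → E} (hφ : IsPrimitive a b φ φ') (hψ : IsPrimitive a b ψ ψ') (hab : a ≤ b) :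
    IsPrimitive a b (fun s => inner ℝ (φ s) (ψ s))
      (fun s => inner ℝ (φ' s) (ψ s) + inner ℝ (φ s) (ψ' s)) :=
  hφ.bilin (innerSL ℝ) hψ hab

theorem solvesODE (h : IsPrimitive a b φ φ') {f : ℝ → E → E} (hc : c ∈ Icc a b)
    (hf : ∀ᵐ r ∂volume.restrict (Icc a b), f r (φ r) = φ' r) :
    SolvesODE f a b c (φ c) φ := by
  have h' := h.congr (χ' := fun r => f r (φ r)) (hc.1.trans hc.2) (fun _ _ => rfl) hf
  exact ⟨h.continuousOn, h'.integrable, fun s hs => h'.eq_add hc hs⟩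

end IsPrimitive

namespace SolvesODE

variable {f f' : ℝ → E → E} {z : E} {φ : ℝ → E}

theorem initial (h : SolvesODE f a b c z φ) (hc : c ∈ Icc a b) : φ c = z := by
  rw [h.eq_integral c hc, intervalIntegral.integral_same, add_zero]

theorem isPrimitive (h : SolvesODE f a b c z φ) (hc : c ∈ Icc a b) :
    IsPrimitive a b φ (fun r => f r (φ r)) :=
  ((IsPrimitive.const z).add (IsPrimitive.intervalIntegral h.integrable hc)).congr
    (hc.1.trans hc.2) h.eq_integral (.of_forall fun r => (zero_add (f r (φ r))).symm)

theorem congr (h : SolvesODE f a b c z φ) (hc : c ∈ Icc a b) {ψ : ℝ → E}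
    (hψ : EqOn ψ φ (Icc a b)) (hf : ∀ r ∈ Icc a b, f' r (ψ r) = f r (φ r)) :
    SolvesODE f' a b c z ψ :=
  have hψ' := (h.isPrimitive hc).congr (hc.1.trans hc.2) hψ (ae_eq_refl _)
  h.initial hc ▸ hψ hc ▸
    hψ'.solvesODE hc ((ae_restrict_iff' measurableSet_Icc).2 (.of_forall hf))

theorem comp_projIcc (h : SolvesODE f a b c z φ) (hc : c ∈ Icc a b) (hab : a ≤ b) :
    SolvesODE f a b c z (fun r => φ (projIcc a b hab r)) :=
  h.congr hc (fun r hr => by rw [projIcc_of_mem hab hr])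
    fun r hr => by rw [projIcc_of_mem hab hr]

end SolvesODE

end Primitive

/-! ### Functions on a compact interval -/

/-- Continuous maps into a normed space `V` with its norm topology. For `V = E →L[ℝ] F` this
topology agrees with the one Mathlib finds by default, but not reducibly so. -/
abbrev CMap (K V : Type*) [TopologicalSpace K] [NormedAddCommGroup V] : Type _ := C(K, V)

/-- The space `L²(a, b; V)`. -/
abbrev L2Icc (a b : ℝ) (V : Type*) [NormedAddCommGroup V] : Type _ :=
  Lp V 2 ((volume : Measure ℝ).restrict (Icc a b))

section PointwiseApplication

variable {K : Type*} [TopologicalSpace K] [CompactSpace K]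
  {E F : Type*} [NormedAddCommGroup E] [NormedSpace ℝ E] [NormedAddCommGroup F] [NormedSpace ℝ F]

/-- Pointwise application `(M, X) ↦ (s ↦ M(s) X(s))`, as a bounded bilinear map on spaces of
continuous functions. -/
noncomputable def applyL : CMap K (E →L[ℝ] F) →L[ℝ] C(K, E) →L[ℝ] C(K, F) :=
  LinearMap.mkContinuous₂
    (LinearMap.mk₂ ℝ (fun (M : CMap K (E →L[ℝ] F)) (X : C(K, E)) =>
      (⟨fun s => M s (X s), by fun_prop⟩ : C(K, F)))
      (fun _ _ _ => by ext; simp) (fun _ _ _ => by ext; simp)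
      (fun _ _ _ => by ext; simp) (fun _ _ _ => by ext; simp)) 1
    (fun M X => by
      rw [one_mul, ContinuousMap.norm_le _ (by positivity)]
      exact fun s => ((M s).le_opNorm _).trans (mul_le_mul (M.norm_coe_le_norm s)
        (X.norm_coe_le_norm s) (norm_nonneg _)
        ((norm_nonneg _).trans (M.norm_coe_le_norm s))))

@[simp]
theorem applyL_apply (M : CMap K (E →L[ℝ] F)) (X : C(K, E)) (s : K) :
    applyL M X s = M s (X s) := rfl

end PointwiseApplication

section Lp

theorem integral_sq_norm_Lp_two {α E : Type*} [MeasurableSpace α] {μ : Measure α}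
    [NormedAddCommGroup E] (v : Lp E 2 μ) : ∫ r, ‖v r‖ ^ 2 ∂μ = ‖v‖ ^ 2 := by
  rw [Lp.norm_def, (Lp.memLp v).eLpNorm_eq_integral_rpow_norm two_ne_zero ENNReal.ofNat_ne_top,
    ENNReal.toReal_ofReal (by positivity)]
  simp only [ENNReal.toReal_ofNat, Real.rpow_ofNat]
  rw [← Real.rpow_natCast, ← Real.rpow_mul (by positivity)]
  norm_num

variable {E F : Type*} [NormedAddCommGroup E] [NormedAddCommGroup F] {a b : ℝ}

theorem intervalIntegrable_of_memLp_two {v : ℝ → E} (hab : a ≤ b)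
    (hv : MemLp v 2 (volume.restrict (Icc a b))) : IntervalIntegrable v volume a b :=
  (intervalIntegrable_iff_integrableOn_Icc_of_le hab).2 (hv.integrable one_le_two)

theorem intervalIntegrable_coeFn_Lp (hab : a ≤ b) (v : L2Icc a b E) :
    IntervalIntegrable v volume a b :=
  intervalIntegrable_of_memLp_two hab (Lp.memLp v)

theorem integral_norm_Lp_two_le (hab : a ≤ b) (v : L2Icc a b E) :
    ∫ r in Icc a b, ‖v r‖ ≤ √(b - a) * ‖v‖ := by
  have h := sq_integral_mul_le_of_memLp_two
    (memLp_const (μ := volume.restrict (Icc a b)) (1 : ℝ)) (Lp.memLp v).norm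
  simp only [one_mul, one_pow, integral_const, smul_eq_mul, mul_one, measureReal_restrict_apply,
    MeasurableSet.univ, univ_inter, Real.volume_real_Icc_of_le hab, integral_sq_norm_Lp_two] at h
  refine le_of_sq_le_sq ?_ (by positivity)
  rwa [mul_pow, Real.sq_sqrt (sub_nonneg.2 hab)]

variable [NormedSpace ℝ E] [NormedSpace ℝ F]

/-- The embedding of the continuous functions on `[a, b]` into `Lᵖ(a, b)`. -/
noncomputable def toLpIcc (hab : a ≤ b) (p : ENNReal) [Fact (1 ≤ p)] :
    C(Icc a b, E) →L[ℝ] Lp E p (volume.restrict (Icc a b)) :=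
  (BoundedContinuousFunction.toLp p (volume.restrict (Icc a b)) ℝ) ∘L
    (BoundedContinuousFunction.compContinuousCLM E ℝ
      (⟨projIcc a b hab, continuous_projIcc⟩ : C(ℝ, Icc a b))) ∘L
    (ContinuousMap.linearIsometryBoundedOfCompact (Icc a b) E
      ℝ).toContinuousLinearEquiv.toContinuousLinearMap

theorem coeFn_toLpIcc (hab : a ≤ b) (p : ENNReal) [Fact (1 ≤ p)] (X : C(Icc a b, E)) :
    toLpIcc hab p X =ᵐ[volume.restrict (Icc a b)] fun r => X (projIcc a b hab r) :=
  BoundedContinuousFunction.coeFn_toLp _ _ _ _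

/-- Multiplication of a square integrable function by a continuous operator valued one. -/
noncomputable def mulLp (hab : a ≤ b) : CMap (Icc a b) (E →L[ℝ] F) →L[ℝ]
    L2Icc a b E →L[ℝ] L2Icc a b F :=
  (ContinuousLinearMap.id ℝ (E →L[ℝ] F)).holderL (volume.restrict (Icc a b)) ⊤ 2 2 ∘L
    toLpIcc hab ⊤

theorem coeFn_mulLp (hab : a ≤ b) (M : CMap (Icc a b) (E →L[ℝ] F))
    (v : L2Icc a b E) :
    mulLp hab M v =ᵐ[volume.restrict (Icc a b)] fun r => M (projIcc a b hab r) (v r) := by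
  filter_upwards [(ContinuousLinearMap.id ℝ (E →L[ℝ] F)).coeFn_holder (r := 2) (toLpIcc hab ⊤ M) v,
    coeFn_toLpIcc hab ⊤ M] with r h_holder hM
  refine h_holder.trans ?_
  rw [hM, ContinuousLinearMap.id_apply]

/-- The operator which sends a square integrable function to its primitive vanishing at `a`. -/
noncomputable def primL (hab : a ≤ b) :
    L2Icc a b E →L[ℝ] C(Icc a b, E) :=
  LinearMap.mkContinuous
    { toFun := fun v => ⟨fun s => ∫ r in a..s, v r, continuousOn_iff_continuous_domRestrict.1
        (continuousOn_Icc_intervalIntegral (left_mem_Icc.2 hab)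
          (intervalIntegrable_coeFn_Lp hab v))⟩
      map_add' := fun v w => by
        ext s
        have ha := left_mem_Icc.2 hab
        have hint (v : L2Icc a b E) : IntervalIntegrable v volume a s :=
          intervalIntegrable_of_mem_Icc (intervalIntegrable_coeFn_Lp hab v) ha s.2
        exact (intervalIntegral_congr_ae_Icc ha s.2 (Lp.coeFn_add v w)).trans
          (intervalIntegral.integral_add (hint v) (hint w))
      map_smul' := fun c v => by
        ext s
        exact (intervalIntegral_congr_ae_Icc (left_mem_Icc.2 hab) s.2 (Lp.coeFn_smul c v)).trans
          (intervalIntegral.integral_smul c _) } √(b - a)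
    (fun v => by
      rw [ContinuousMap.norm_le _ (by positivity)]
      refine fun s => le_trans ?_ (integral_norm_Lp_two_le hab v)
      refine (intervalIntegral.norm_integral_le_integral_norm s.2.1).trans ?_
      rw [intervalIntegral.integral_of_le s.2.1]
      exact setIntegral_mono_set ((Lp.memLp v).integrable one_le_two).norm
        (.of_forall fun _ => norm_nonneg _)
        (Ioc_subset_Icc_self.trans (Icc_subset_Icc_right s.2.2)).eventuallyLE)

@[simp]
theorem primL_apply (hab : a ≤ b) (v : L2Icc a b E) (s : Icc a b) :
    primL hab v s = ∫ r in a..s, v r := rfl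

/-- Integration over `[a, b]`, as a functional on the continuous functions. -/
noncomputable def integralL (hab : a ≤ b) : C(Icc a b, E) →L[ℝ] E :=
  ContinuousMap.evalCLM ℝ (⟨b, right_mem_Icc.2 hab⟩ : Icc a b) ∘L primL hab ∘L toLpIcc hab 2

theorem integralL_apply (hab : a ≤ b) (X : C(Icc a b, E)) :
    integralL hab X = ∫ r in a..b, X (projIcc a b hab r) :=
  intervalIntegral_congr_ae_Icc (left_mem_Icc.2 hab) (right_mem_Icc.2 hab) (coeFn_toLpIcc hab 2 X)

end Lp

section Superposition

variable {K E F : Type*} [TopologicalSpace K]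

/-- The superposition (Nemytskii) operator `X ↦ f(·, X(·))`. -/
def superpose [TopologicalSpace E] [TopologicalSpace F] (f : C(K × E, F)) (X : C(K, E)) : C(K, F) :=
  f.comp ((ContinuousMap.id K).prodMk X)

@[simp]
theorem superpose_apply [TopologicalSpace E] [TopologicalSpace F] (f : C(K × E, F)) (X : C(K, E))
    (s : K) : superpose f X s = f (s, X s) := rfl

theorem continuous_superpose [LocallyCompactSpace K] [TopologicalSpace E] [TopologicalSpace F]
    (f : C(K × E, F)) : Continuous (superpose f) :=
  f.continuous_postcomp.comp (ContinuousMap.continuous_of_continuous_uncurry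
    (fun X : C(K, E) => (ContinuousMap.id K).prodMk X)
    (continuous_snd.prodMk (ContinuousEval.continuous_eval :
      Continuous fun p : C(K, E) × K => p.1 p.2)))

variable [NormedAddCommGroup E] [NormedSpace ℝ E] [NormedAddCommGroup F] [NormedSpace ℝ F]
  {f : C(K × E, F)} {f' : CMap (K × E) (E →L[ℝ] F)} [CompactSpace K] [LocallyCompactSpace K]

theorem hasFDerivAt_superpose (h : ∀ s y, HasFDerivAt (fun y => f (s, y)) (f' (s, y)) y)
    (X : C(K, E)) : HasFDerivAt (superpose f) (applyL (superpose f' X)) X := by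
  rw [hasFDerivAt_iff_isLittleO, Asymptotics.isLittleO_iff]
  intro c hc
  obtain ⟨δ, hδ, hdist⟩ :=
    Metric.continuousAt_iff.1 ((continuous_superpose f').continuousAt (x := X)) c hc
  filter_upwards [Metric.ball_mem_nhds X hδ] with Z hZ
  rw [Metric.mem_ball, dist_eq_norm] at hZ
  rw [ContinuousMap.norm_le _ (by positivity)]
  intro s
  have hf' : ∀ y ∈ segment ℝ (X s) (Z s), ‖f' (s, y) - f' (s, X s)‖ ≤ c := by
    intro y hy
    rw [segment_eq_image'] at hy
    obtain ⟨θ, hθ, rfl⟩ := hy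
    have hθZ : dist (X + θ • (Z - X)) X < δ := by
      rw [dist_eq_norm, add_sub_cancel_left, norm_smul, Real.norm_of_nonneg hθ.1]
      exact (mul_le_of_le_one_left (norm_nonneg _) hθ.2).trans_lt hZ
    rw [← dist_eq_norm]
    exact (ContinuousMap.dist_apply_le_dist (f := superpose f' (X + θ • (Z - X)))
      (g := superpose f' X) s).trans (hdist hθZ).le
  calc ‖f (s, Z s) - f (s, X s) - f' (s, X s) (Z s - X s)‖ ≤ c * ‖Z s - X s‖ :=
        (convex_segment (X s) (Z s)).norm_image_sub_le_of_norm_hasFDerivWithin_le'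
          (fun y _ => (h s y).hasFDerivWithinAt) hf'
          (left_mem_segment ℝ _ _) (right_mem_segment ℝ _ _)
    _ ≤ c * ‖Z - X‖ := by
        gcongr
        exact (Z - X).norm_coe_le_norm s

theorem contDiff_one_superpose (h : ∀ s y, HasFDerivAt (fun y => f (s, y)) (f' (s, y)) y) :
    ContDiff ℝ 1 (superpose f) := by
  refine contDiff_one_iff_fderiv.2 ⟨fun X => (hasFDerivAt_superpose h X).differentiableAt, ?_⟩
  rw [show fderiv ℝ (superpose f) = fun X => applyL (superpose f' X) from
    funext fun X => (hasFDerivAt_superpose h X).fderiv]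
  exact applyL.continuous.comp (continuous_superpose f')

end Superposition

/-- A continuous function of a parameter `s` and a state `y`, together with its first and second
derivatives in `y`, which are continuous in `(s, y)`. -/
structure SmoothCoeff (K E F : Type*) [TopologicalSpace K] [NormedAddCommGroup E] [NormedSpace ℝ E]
    [NormedAddCommGroup F] [NormedSpace ℝ F] where
  fn : C(K × E, F)
  deriv : CMap (K × E) (E →L[ℝ] F)
  deriv₂ : CMap (K × E) (E →L[ℝ] E →L[ℝ] F)
  hasFDerivAt_fn : ∀ s y, HasFDerivAt (fun y => fn (s, y)) (deriv (s, y)) y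
  hasFDerivAt_deriv : ∀ s y, HasFDerivAt (fun y => deriv (s, y)) (deriv₂ (s, y)) y

namespace SmoothCoeff

variable {K E F : Type*} [TopologicalSpace K] [CompactSpace K] [LocallyCompactSpace K]
  [NormedAddCommGroup E] [NormedSpace ℝ E] [NormedAddCommGroup F] [NormedSpace ℝ F]

theorem contDiff_superpose (f : SmoothCoeff K E F) : ContDiff ℝ 2 (superpose f.fn) := by
  refine contDiff_succ_iff_fderiv (n := 1) |>.2
    ⟨fun X => (hasFDerivAt_superpose f.hasFDerivAt_fn X).differentiableAt, by simp, ?_⟩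
  rw [show fderiv ℝ (superpose f.fn) = fun X => applyL (superpose f.deriv X) from
    funext fun X => (hasFDerivAt_superpose f.hasFDerivAt_fn X).fderiv]
  exact applyL.contDiff.comp (contDiff_one_superpose f.hasFDerivAt_deriv)

theorem hasDerivAt_superpose_line (f : SmoothCoeff K E F) (X Y : C(K, E)) :
    HasDerivAt (fun ε : ℝ => superpose f.fn (X + ε • Y)) (applyL (superpose f.deriv X) Y) 0 :=
  (hasFDerivAt_superpose f.hasFDerivAt_fn X).hasLineDerivAt Y

theorem hasDerivAt_superpose_deriv_line (f : SmoothCoeff K E F) (X Y η : C(K, E)) :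
    HasDerivAt (fun ε : ℝ => applyL (superpose f.deriv (X + ε • Y)) η)
      (applyL (applyL (superpose f.deriv₂ X) Y) η) 0 :=
  (((applyL (K := K) (E := E) (F := F)).flip η).hasFDerivAt.comp X
    (hasFDerivAt_superpose f.hasFDerivAt_deriv X)).hasLineDerivAt Y

end SmoothCoeff

section Hessian

variable {H : Type*} [NormedAddCommGroup H] [InnerProductSpace ℝ H] [CompleteSpace H] {f : H → ℝ}
  {x : H}

/-- The Riesz representation of a real Hilbert space, as a bounded linear map over `ℝ` (in Mathlib
it is conjugate linear). -/
noncomputable def rieszL (H : Type*) [NormedAddCommGroup H] [InnerProductSpace ℝ H]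
    [CompleteSpace H] : (H →L[ℝ] ℝ) →L[ℝ] H :=
  LinearMap.mkContinuous
    { toFun := fun φ => (InnerProductSpace.toDual ℝ H).symm φ
      map_add' := fun φ χ => map_add _ φ χ
      map_smul' := fun c φ => by simp } 1 (fun φ => by simp)

theorem inner_rieszL (φ : H →L[ℝ] ℝ) (v : H) : inner ℝ (rieszL H φ) v = φ v :=
  InnerProductSpace.toDual_symm_apply

theorem gradient_eq_rieszL_fderiv (f : H → ℝ) : gradient f = fun x => rieszL H (fderiv ℝ f x) :=
  rfl

theorem inner_gradient (f : H → ℝ) (x v : H) : inner ℝ (gradient f x) v = fderiv ℝ f x v :=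
  inner_rieszL _ _

theorem hasFDerivAt_gradient (h : DifferentiableAt ℝ (fderiv ℝ f) x) :
    HasFDerivAt (gradient f) (rieszL H ∘L fderiv ℝ (fderiv ℝ f) x) x :=
  (rieszL H).hasFDerivAt.comp x h.hasFDerivAt

theorem inner_hess (h : DifferentiableAt ℝ (fderiv ℝ f) x) (v w : H) :
    inner ℝ (hess f x v) w = fderiv ℝ (fderiv ℝ f) x v w := by
  rw [hess, (hasFDerivAt_gradient h).fderiv]
  exact inner_rieszL _ _

end Hessian

section SecondDerivative

variable {V W G : Type*} [NormedAddCommGroup V] [NormedSpace ℝ V]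
  [NormedAddCommGroup W] [NormedSpace ℝ W] [NormedAddCommGroup G] [NormedSpace ℝ G]

theorem differentiable_of_contDiff_two {f : V → W} (hf : ContDiff ℝ 2 f) : Differentiable ℝ f :=
  hf.differentiable two_ne_zero

theorem differentiable_fderiv_of_contDiff_two {f : V → W} (hf : ContDiff ℝ 2 f) :
    Differentiable ℝ (fderiv ℝ f) :=
  (hf.fderiv_right (m := 1) (by norm_num)).differentiable one_ne_zero

theorem hasDerivAt_line (p q : V) : HasDerivAt (fun ε : ℝ => p + ε • q) q 0 :=
  (hasFDerivAt_id p).hasLineDerivAt q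

theorem fderiv_apply_eq_of_hasDerivAt {f : V → G} {p q : V} {d : G}
    (hf : DifferentiableAt ℝ f p) (h : HasDerivAt (fun ε : ℝ => f (p + ε • q)) d 0) :
    fderiv ℝ f p q = d :=
  (hf.hasFDerivAt.hasLineDerivAt q).unique h

theorem fderiv_fderiv_apply {f : V → W} {p : V} (hf : DifferentiableAt ℝ (fderiv ℝ f) p)
    (q q' : V) : fderiv ℝ (fderiv ℝ f) p q q' = fderiv ℝ (fun x => fderiv ℝ f x q') p q := by
  simp [fderiv_clm_apply hf (differentiableAt_const q')]

theorem fderiv_comp_prodMk_apply {L : V × W → G} {Z : V → W} {u : V}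
    (hL : DifferentiableAt ℝ L (u, Z u)) (hZ : DifferentiableAt ℝ Z u) (w : V) :
    fderiv ℝ (fun u => L (u, Z u)) u w = fderiv ℝ L (u, Z u) (w, fderiv ℝ Z u w) :=
  DFunLike.congr_fun (hL.hasFDerivAt.comp u ((hasFDerivAt_id u).prodMk hZ.hasFDerivAt)).fderiv w

theorem fderiv_fderiv_comp_prodMk_of_stationary {L : V × W → G} {Z : V → W} (hL : ContDiff ℝ 2 L)
    (hZ : ContDiff ℝ 2 Z) {u : V} (hstat : ∀ η, fderiv ℝ L (u, Z u) (0, η) = 0) (v w : V) :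
    fderiv ℝ (fderiv ℝ fun u => L (u, Z u)) u v w =
      fderiv ℝ (fderiv ℝ L) (u, Z u) (v, fderiv ℝ Z u v) (w, fderiv ℝ Z u w) := by
  have hLd := differentiable_of_contDiff_two hL
  have hZd := differentiable_of_contDiff_two hZ
  have hL' := differentiable_fderiv_of_contDiff_two hL (u, Z u)
  have hZ' := differentiable_fderiv_of_contDiff_two hZ u
  have hLu : HasFDerivAt (fun u => fderiv ℝ L (u, Z u))
      (fderiv ℝ (fderiv ℝ L) (u, Z u) ∘L (ContinuousLinearMap.id ℝ V).prod (fderiv ℝ Z u)) u :=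
    hL'.hasFDerivAt.comp u ((hasFDerivAt_id u).prodMk (hZd u).hasFDerivAt)
  have hw : HasFDerivAt (fun u => (w, fderiv ℝ Z u w))
      ((0 : V →L[ℝ] V).prod ((fderiv ℝ (fderiv ℝ Z) u).flip w)) u :=
    (hasFDerivAt_const w u).prodMk (by
      simpa using hZ'.hasFDerivAt.clm_apply (hasFDerivAt_const w u))
  have hLZ : ContDiff ℝ 2 fun u => L (u, Z u) := hL.comp (contDiff_id.prodMk hZ)
  rw [fderiv_fderiv_apply (differentiable_fderiv_of_contDiff_two hLZ u)]
  simp_rw [fderiv_comp_prodMk_apply (hLd _) (hZd _)]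
  simp [(hLu.clm_apply hw).fderiv, hstat]

/-- The Lagrange multiplier rule of second order: the multiplier makes `L` minus its linearisation
in the constrained variable stationary in that variable, and removing a linear term does not change
second derivatives. -/
theorem fderiv_fderiv_eq_of_lagrangian {J : V → G} {L : V × W → G} {Z : V → W} {c : G}
    (hL : ContDiff ℝ 2 L) (hZ : ContDiff ℝ 2 Z) {u : V}
    (hJ : ∀ u', J u' = L (u', Z u') - fderiv ℝ L (u, Z u) (0, Z u') + c) (v w : V) :
    fderiv ℝ (fderiv ℝ J) u v w =
      fderiv ℝ (fderiv ℝ L) (u, Z u) (v, fderiv ℝ Z u v) (w, fderiv ℝ Z u w) := by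
  set ℓ : V × W →L[ℝ] G := fderiv ℝ L (u, Z u) ∘L .inr ℝ V W ∘L .snd ℝ V W
  have hLd := differentiable_of_contDiff_two hL
  have hfderiv : fderiv ℝ (fun p => L p - ℓ p) = fun p => fderiv ℝ L p - ℓ := by
    ext1 p
    exact ((hLd p).hasFDerivAt.sub ℓ.hasFDerivAt).fderiv
  have hJ' : fderiv ℝ J = fderiv ℝ fun u' => L (u', Z u') - ℓ (u', Z u') := by
    rw [funext hJ]
    exact funext fun u' => fderiv_add_const c
  rw [hJ', fderiv_fderiv_comp_prodMk_of_stationary (hL.sub ℓ.contDiff) hZ (fun η => by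
      rw [hfderiv]; simp [ℓ]),
    hfderiv, fderiv_sub_const]

end SecondDerivative

/-! ### Integrals quadratic in the control -/

section QuadraticIntegral

variable {a b : ℝ} {U V W : Type*} [NormedAddCommGroup U] [InnerProductSpace ℝ U]
  [NormedAddCommGroup V] [NormedSpace ℝ V] [NormedAddCommGroup W] [NormedSpace ℝ W]

theorem isBoundedBilinearMap_mulLp (hab : a ≤ b) : IsBoundedBilinearMap ℝ
    fun p : CMap (Icc a b) (U →L[ℝ] V) × L2Icc a b U => mulLp hab p.1 p.2 :=
  ContinuousLinearMap.isBoundedBilinearMap (E := CMap (Icc a b) (U →L[ℝ] V)) (mulLp hab)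

theorem contDiff_mulLp_apply (hab : a ≤ b) {n : WithTop ℕ∞}
    {ψ : W → CMap (Icc a b) (U →L[ℝ] V)} {u : W → L2Icc a b U}
    (hψ : ContDiff ℝ n ψ) (hu : ContDiff ℝ n u) : ContDiff ℝ n fun x => mulLp hab (ψ x) (u x) := by
  have hmul : ContDiff ℝ n (mulLp (E := U) (F := V) hab) :=
    ContinuousLinearMap.contDiff (E := CMap (Icc a b) (U →L[ℝ] V))
      (F := L2Icc a b U →L[ℝ] L2Icc a b V) _
  exact (hmul.comp hψ).clm_apply hu

theorem hasDerivAt_mulLp_apply (hab : a ≤ b) {ψ : ℝ → CMap (Icc a b) (U →L[ℝ] V)}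
    {u : ℝ → L2Icc a b U} {ψ' u'} {t : ℝ} (hψ : HasDerivAt ψ ψ' t) (hu : HasDerivAt u u' t) :
    HasDerivAt (fun ε => mulLp hab (ψ ε) (u ε)) (mulLp hab ψ' (u t) + mulLp hab (ψ t) u') t := by
  rw [add_comm]
  exact ((isBoundedBilinearMap_mulLp hab).hasFDerivAt (ψ t, u t)).comp_hasDerivAt t
    (hψ.prodMk hu)

/-- The square integrable function `φ + ψu`, where `u` is a control and `φ` and `ψ` are
continuous. -/
noncomputable def affineLp (hab : a ≤ b) (φ : C(Icc a b, V)) (ψ : CMap (Icc a b) (U →L[ℝ] V))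
    (u : L2Icc a b U) : L2Icc a b V :=
  toLpIcc hab 2 φ + mulLp hab ψ u

theorem coeFn_affineLp (hab : a ≤ b) (φ : C(Icc a b, V)) (ψ : CMap (Icc a b) (U →L[ℝ] V))
    (u : L2Icc a b U) : affineLp hab φ ψ u =ᵐ[volume.restrict (Icc a b)] fun r =>
      φ (projIcc a b hab r) + ψ (projIcc a b hab r) (u r) := by
  filter_upwards [Lp.coeFn_add (toLpIcc hab 2 φ) (mulLp hab ψ u), coeFn_toLpIcc hab 2 φ,
    coeFn_mulLp hab ψ u] with r hadd hφ hψ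
  rw [affineLp, hadd, Pi.add_apply, hφ, hψ]

theorem contDiff_affineLp (hab : a ≤ b) {n : WithTop ℕ∞} {φ : W → C(Icc a b, V)}
    {ψ : W → CMap (Icc a b) (U →L[ℝ] V)} {u : W → L2Icc a b U} (hφ : ContDiff ℝ n φ)
    (hψ : ContDiff ℝ n ψ) (hu : ContDiff ℝ n u) :
    ContDiff ℝ n fun x => affineLp hab (φ x) (ψ x) (u x) :=
  ((toLpIcc (E := V) hab 2).contDiff.comp hφ).add (contDiff_mulLp_apply hab hψ hu)

theorem hasDerivAt_affineLp (hab : a ≤ b) {φ : ℝ → C(Icc a b, V)}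
    {ψ : ℝ → CMap (Icc a b) (U →L[ℝ] V)} {u : ℝ → L2Icc a b U} {φ' ψ' u'} {t : ℝ}
    (hφ : HasDerivAt φ φ' t) (hψ : HasDerivAt ψ ψ' t) (hu : HasDerivAt u u' t) :
    HasDerivAt (fun ε => affineLp hab (φ ε) (ψ ε) (u ε))
      (affineLp hab φ' ψ' (u t) + mulLp hab (ψ t) u') t := by
  rw [affineLp, add_assoc]
  exact ((toLpIcc hab 2).hasFDerivAt.comp_hasDerivAt t hφ).add (hasDerivAt_mulLp_apply hab hψ hu)

/-- The integral over `[a, b]` of `φ₀ + ⟪φ₁, u⟫ + ½⟪φ₂u, u⟫`, where `u` is a control. -/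
noncomputable def quadIntegral (hab : a ≤ b) (φ₀ : C(Icc a b, ℝ)) (φ₁ : C(Icc a b, U))
    (φ₂ : CMap (Icc a b) (U →L[ℝ] U)) (u : L2Icc a b U) : ℝ :=
  integralL hab φ₀ + inner ℝ (toLpIcc hab 2 φ₁) u + 1 / 2 * inner ℝ (mulLp hab φ₂ u) u

theorem contDiff_quadIntegral (hab : a ≤ b) {n : WithTop ℕ∞} {φ₀ : W → C(Icc a b, ℝ)}
    {φ₁ : W → C(Icc a b, U)} {φ₂ : W → CMap (Icc a b) (U →L[ℝ] U)} {u : W → L2Icc a b U}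
    (h₀ : ContDiff ℝ n φ₀) (h₁ : ContDiff ℝ n φ₁) (h₂ : ContDiff ℝ n φ₂) (hu : ContDiff ℝ n u) :
    ContDiff ℝ n fun x => quadIntegral hab (φ₀ x) (φ₁ x) (φ₂ x) (u x) :=
  (((integralL hab).contDiff.comp h₀).add (((toLpIcc hab 2).contDiff.comp h₁).inner ℝ hu)).add
    (contDiff_const.mul
      ((contDiff_mulLp_apply hab h₂ hu).inner ℝ hu))

theorem inner_mulLp_comm (hab : a ≤ b) {ψ : CMap (Icc a b) (U →L[ℝ] U)}
    (hψ : ∀ s v w, inner ℝ (ψ s v) w = inner ℝ v (ψ s w)) (v w : L2Icc a b U) :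
    inner ℝ (mulLp hab ψ v) w = inner ℝ v (mulLp hab ψ w) := by
  rw [L2.inner_def, L2.inner_def]
  refine integral_congr_ae ?_
  filter_upwards [coeFn_mulLp hab ψ v, coeFn_mulLp hab ψ w] with r hv hw
  rw [hv, hw, hψ]

theorem hasDerivAt_quadIntegral (hab : a ≤ b) {φ₀ : ℝ → C(Icc a b, ℝ)} {φ₁ : ℝ → C(Icc a b, U)}
    {φ₂ : ℝ → CMap (Icc a b) (U →L[ℝ] U)} {u : ℝ → L2Icc a b U} {φ₀' φ₁' φ₂' u'} {t : ℝ}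
    (h₀ : HasDerivAt φ₀ φ₀' t) (h₁ : HasDerivAt φ₁ φ₁' t) (h₂ : HasDerivAt φ₂ φ₂' t)
    (hu : HasDerivAt u u' t) (hsymm : ∀ s v w, inner ℝ (φ₂ t s v) w = inner ℝ v (φ₂ t s w)) :
    HasDerivAt (fun ε => quadIntegral hab (φ₀ ε) (φ₁ ε) (φ₂ ε) (u ε))
      (quadIntegral hab φ₀' φ₁' φ₂' (u t) + inner ℝ (affineLp hab (φ₁ t) (φ₂ t) (u t)) u') t := by
  refine HasDerivAt.congr_deriv ((((integralL hab).hasFDerivAt.comp_hasDerivAt t h₀).add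
    (((toLpIcc hab 2).hasFDerivAt.comp_hasDerivAt t h₁).inner ℝ hu)).add
    (((hasDerivAt_mulLp_apply hab h₂ hu).inner ℝ hu).const_mul (1 / 2 : ℝ))) ?_
  simp only [quadIntegral, affineLp, inner_add_left, Function.comp_apply,
    inner_mulLp_comm hab hsymm u', real_inner_comm _ u']
  ring

end QuadraticIntegral

section IntervalIntegral

/-- The function `φ` is integrable on `[a, b]` with integral `c`. -/
structure HasIntervalIntegral (a b : ℝ) (φ : ℝ → ℝ) (c : ℝ) : Prop where
  integrable : IntervalIntegrable φ volume a b
  integral_eq : ∫ r in a..b, φ r = c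

namespace HasIntervalIntegral

variable {a b : ℝ} {φ ψ : ℝ → ℝ} {c d : ℝ}

theorem add (h : HasIntervalIntegral a b φ c) (h' : HasIntervalIntegral a b ψ d) :
    HasIntervalIntegral a b (fun r => φ r + ψ r) (c + d) :=
  ⟨h.integrable.add h'.integrable, by
    rw [intervalIntegral.integral_add h.integrable h'.integrable, h.integral_eq, h'.integral_eq]⟩

theorem const_mul (k : ℝ) (h : HasIntervalIntegral a b φ c) :
    HasIntervalIntegral a b (fun r => k * φ r) (k * c) :=
  ⟨h.integrable.const_mul k, by rw [intervalIntegral.integral_const_mul, h.integral_eq]⟩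

theorem congr (hab : a ≤ b) (h : HasIntervalIntegral a b φ c)
    (hφ : ψ =ᵐ[volume.restrict (Icc a b)] φ) : HasIntervalIntegral a b ψ c where
  integrable := by
    have hi := h.integrable
    rw [intervalIntegrable_iff_integrableOn_Icc_of_le hab] at hi ⊢
    exact Integrable.congr hi hφ.symm
  integral_eq := (intervalIntegral_congr_ae_Icc (left_mem_Icc.2 hab) (right_mem_Icc.2 hab) hφ).trans
    h.integral_eq

theorem unique (h : HasIntervalIntegral a b φ c) (h' : HasIntervalIntegral a b φ d) : c = d :=
  h.integral_eq.symm.trans h'.integral_eq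

end HasIntervalIntegral

variable {a b : ℝ} {U V : Type*} [NormedAddCommGroup U] [InnerProductSpace ℝ U]
  [NormedAddCommGroup V] [InnerProductSpace ℝ V]

theorem hasIntervalIntegral_integralL (hab : a ≤ b) (φ : C(Icc a b, ℝ)) :
    HasIntervalIntegral a b (fun r => φ (projIcc a b hab r)) (integralL hab φ) :=
  ⟨(φ.continuous.comp continuous_projIcc).intervalIntegrable _ _, (integralL_apply hab φ).symm⟩

theorem hasIntervalIntegral_inner (hab : a ≤ b) (v w : L2Icc a b U) :
    HasIntervalIntegral a b (fun r => inner ℝ (v r) (w r)) (inner ℝ v w) where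
  integrable := by
    rw [intervalIntegrable_iff_integrableOn_Icc_of_le hab]
    exact L2.integrable_inner v w
  integral_eq := by
    rw [L2.inner_def, intervalIntegral.integral_of_le hab, integral_Icc_eq_integral_Ioc]

theorem hasIntervalIntegral_inner_affineLp (hab : a ≤ b) (φ : C(Icc a b, V))
    (ψ : CMap (Icc a b) (U →L[ℝ] V)) (u : L2Icc a b U) (w : L2Icc a b V) :
    HasIntervalIntegral a b
      (fun r => inner ℝ (φ (projIcc a b hab r) + ψ (projIcc a b hab r) (u r)) (w r))
      (inner ℝ (affineLp hab φ ψ u) w) :=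
  (hasIntervalIntegral_inner hab _ w).congr hab (by
    filter_upwards [coeFn_affineLp hab φ ψ u] with r hr
    rw [hr])

theorem hasIntervalIntegral_quadIntegral (hab : a ≤ b) (φ₀ : C(Icc a b, ℝ)) (φ₁ : C(Icc a b, U))
    (φ₂ : CMap (Icc a b) (U →L[ℝ] U)) (u : L2Icc a b U) :
    HasIntervalIntegral a b (fun r => φ₀ (projIcc a b hab r)
        + inner ℝ (φ₁ (projIcc a b hab r)) (u r)
        + 1 / 2 * inner ℝ (φ₂ (projIcc a b hab r) (u r)) (u r))
      (quadIntegral hab φ₀ φ₁ φ₂ u) := by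
  refine (((hasIntervalIntegral_integralL hab φ₀).add (hasIntervalIntegral_inner hab _ u)).add
    ((hasIntervalIntegral_inner hab _ u).const_mul (1 / 2))).congr hab ?_
  filter_upwards [coeFn_toLpIcc hab 2 φ₁, coeFn_mulLp hab φ₂ u] with r h₁ h₂
  rw [h₁, h₂]

end IntervalIntegral

/-- A smooth coefficient with values in the bounded linear maps. -/
abbrev OpCoeff (K E F G : Type*) [TopologicalSpace K] [NormedAddCommGroup E] [NormedSpace ℝ E]
    [NormedAddCommGroup F] [NormedSpace ℝ F] [NormedAddCommGroup G] [NormedSpace ℝ G] : Type _ :=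
  SmoothCoeff K E (F →L[ℝ] G)

/-- A smooth function `(s, y, u) ↦ base(s, y) + slope(s, y) u` of a parameter `s`, a state `y` and a
control `u`, affine in the control. -/
structure ControlAffine (K E U F : Type*) [TopologicalSpace K] [NormedAddCommGroup E]
    [NormedSpace ℝ E] [NormedAddCommGroup U] [NormedSpace ℝ U] [NormedAddCommGroup F]
    [NormedSpace ℝ F] where
  base : SmoothCoeff K E F
  slope : OpCoeff K E U F

/-- The bounded bilinear maps, named so that the topology on spaces of linear maps between them is
found through the norm. -/
abbrev BilinMap (V W G : Type*) [NormedAddCommGroup V] [NormedSpace ℝ V] [NormedAddCommGroup W]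
    [NormedSpace ℝ W] [NormedAddCommGroup G] [NormedSpace ℝ G] : Type _ :=
  V →L[ℝ] W →L[ℝ] G

/-- `(M, w) ↦ (e ↦ M e w)`, as a bounded bilinear map. -/
noncomputable def flipL (E F G : Type*) [NormedAddCommGroup E] [NormedSpace ℝ E]
    [NormedAddCommGroup F] [NormedSpace ℝ F] [NormedAddCommGroup G] [NormedSpace ℝ G] :
    BilinMap (E →L[ℝ] F →L[ℝ] G) F (E →L[ℝ] G) :=
  (ContinuousLinearMap.flipₗᵢ ℝ E F G).toContinuousLinearEquiv.toContinuousLinearMap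

/-- The point over the time `r` of the graph of a trajectory, which is extended to all times as a
constant on either side of `[a, b]`. -/
noncomputable abbrev graphPt {a b : ℝ} {E : Type*} [TopologicalSpace E] (hab : a ≤ b)
    (X : C(Icc a b, E)) (r : ℝ) : Icc a b × E :=
  (projIcc a b hab r, X (projIcc a b hab r))

namespace ControlAffine

variable {a b : ℝ} {E U F : Type*} [NormedAddCommGroup E] [NormedSpace ℝ E]
  [NormedAddCommGroup U] [InnerProductSpace ℝ U] [NormedAddCommGroup F] [NormedSpace ℝ F]
  (hab : a ≤ b) (f : ControlAffine (Icc a b) E U F) (p q : L2Icc a b U × C(Icc a b, E))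

/-- The superposition operator `(u, X) ↦ f(·, X(·), u(·))`. -/
noncomputable def superposeLp : L2Icc a b F :=
  affineLp hab (superpose f.base.fn p.2) (superpose f.slope.fn p.2) p.1

/-- The derivative of `superposeLp` at `p` in the direction `q`. -/
noncomputable def superposeLpDeriv : L2Icc a b F :=
  affineLp hab (applyL (superpose f.base.deriv p.2) q.2) (applyL (superpose f.slope.deriv p.2) q.2)
    p.1 + mulLp hab (superpose f.slope.fn p.2) q.1

/-- The derivative of `f` in the state along the pair `p` of a control and a trajectory. -/
noncomputable def jacobian (r : ℝ) : E →L[ℝ] F :=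
  f.base.deriv (graphPt hab p.2 r)
    + flipL E U F (f.slope.deriv (graphPt hab p.2 r)) (p.1 r)

@[simp]
theorem jacobian_apply (r : ℝ) (e : E) : f.jacobian hab p r e =
    f.base.deriv (graphPt hab p.2 r) e
      + f.slope.deriv (graphPt hab p.2 r) e (p.1 r) := rfl

theorem contDiff_superposeLp : ContDiff ℝ 2 (f.superposeLp hab) :=
  contDiff_affineLp hab (f.base.contDiff_superpose.comp contDiff_snd)
    (f.slope.contDiff_superpose.comp contDiff_snd) contDiff_fst

theorem hasDerivAt_superposeLp :
    HasDerivAt (fun ε : ℝ => f.superposeLp hab (p + ε • q)) (f.superposeLpDeriv hab p q) 0 := by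
  have h := hasDerivAt_affineLp hab (f.base.hasDerivAt_superpose_line p.2 q.2)
    (f.slope.hasDerivAt_superpose_line p.2 q.2) (hasDerivAt_line p.1 q.1)
  simp only [zero_smul, add_zero] at h
  exact h

theorem coeFn_superposeLpDeriv : f.superposeLpDeriv hab p q =ᵐ[volume.restrict (Icc a b)] fun r =>
    f.jacobian hab p r (q.2 (projIcc a b hab r))
      + f.slope.fn (graphPt hab p.2 r) (q.1 r) := by
  rw [superposeLpDeriv]
  filter_upwards [Lp.coeFn_add (affineLp hab (applyL (superpose f.base.deriv p.2) q.2)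
      (applyL (superpose f.slope.deriv p.2) q.2) p.1) (mulLp hab (superpose f.slope.fn p.2) q.1),
    coeFn_affineLp hab (applyL (superpose f.base.deriv p.2) q.2)
      (applyL (superpose f.slope.deriv p.2) q.2) p.1,
    coeFn_mulLp hab (superpose f.slope.fn p.2) q.1] with r hadd haff hmul
  rw [hadd, Pi.add_apply, haff, hmul]
  rfl

end ControlAffine

section BilinearMaps

/-- `(φ, M) ↦ (e ↦ e' ↦ φ (M e e'))`, as a bounded bilinear map. -/
noncomputable def postL (E W : Type*) [NormedAddCommGroup E] [NormedSpace ℝ E]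
    [NormedAddCommGroup W] [NormedSpace ℝ W] :
    BilinMap (W →L[ℝ] ℝ) (BilinMap E E W) (BilinMap E E ℝ) :=
  ContinuousLinearMap.compL ℝ E (E →L[ℝ] W) (E →L[ℝ] ℝ) ∘L ContinuousLinearMap.compL ℝ E W ℝ

@[simp]
theorem postL_apply {E W : Type*} [NormedAddCommGroup E] [NormedSpace ℝ E]
    [NormedAddCommGroup W] [NormedSpace ℝ W] (φ : W →L[ℝ] ℝ) (M : E →L[ℝ] E →L[ℝ] W) (e e' : E) :
    postL E W φ M e e' = φ (M e e') := rfl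

/-- `(u, u') ↦ (M ↦ ⟪u', M u⟫)`, as a bounded bilinear map. -/
noncomputable def innerApplyL (U : Type*) [NormedAddCommGroup U] [InnerProductSpace ℝ U] :
    BilinMap U U ((U →L[ℝ] U) →L[ℝ] ℝ) :=
  (ContinuousLinearMap.compL ℝ (U →L[ℝ] U) U ℝ).flip.bilinearComp
    (ContinuousLinearMap.apply ℝ U) (innerSL ℝ)

@[simp]
theorem innerApplyL_apply {U : Type*} [NormedAddCommGroup U] [InnerProductSpace ℝ U] (u u' : U)
    (M : U →L[ℝ] U) : innerApplyL U u u' M = inner ℝ u' (M u) := rfl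

end BilinearMaps

/-- A smooth function `(s, y, u) ↦ base(s, y) + ⟪S(s, y), u⟫ + ½⟪R(s, y)u, u⟫` with `R` symmetric.
It is given by its part free of the control and by its gradient `S + Ru` in the control. -/
structure RunningCost (K E U : Type*) [TopologicalSpace K] [NormedAddCommGroup E]
    [NormedSpace ℝ E] [NormedAddCommGroup U] [InnerProductSpace ℝ U] where
  base : SmoothCoeff K E ℝ
  grad : ControlAffine K E U U
  inner_slope_comm : ∀ p v w, inner ℝ (grad.slope.fn p v) w = inner ℝ v (grad.slope.fn p w)

namespace RunningCost

theorem inner_deriv_slope_comm {K E U : Type*} [TopologicalSpace K] [NormedAddCommGroup E]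
    [NormedSpace ℝ E] [NormedAddCommGroup U] [InnerProductSpace ℝ U] (f : RunningCost K E U)
    (p : K × E) (e : E) (v w : U) :
    inner ℝ (f.grad.slope.deriv p e v) w = inner ℝ v (f.grad.slope.deriv p e w) := by
  have hline (v : U) : HasDerivAt (fun ε : ℝ => f.grad.slope.fn (p.1, p.2 + ε • e) v)
      (f.grad.slope.deriv p e v) 0 := by
    simpa using ((f.grad.slope.hasFDerivAt_fn p.1 p.2).hasLineDerivAt e).clm_apply
      (hasDerivAt_const (0 : ℝ) v)
  have hv := (hline v).inner ℝ (hasDerivAt_const (0 : ℝ) w)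
  have hw := (hasDerivAt_const (0 : ℝ) v).inner ℝ (hline w)
  simp only [inner_zero_left, inner_zero_right, zero_add, add_zero] at hv hw
  exact hv.unique (by simpa only [f.inner_slope_comm] using hw)

variable {a b : ℝ} {E U : Type*} [NormedAddCommGroup E] [NormedSpace ℝ E]
  [NormedAddCommGroup U] [InnerProductSpace ℝ U] (hab : a ≤ b) (f : RunningCost (Icc a b) E U)
  {g : E → ℝ} (p q q' : L2Icc a b U × C(Icc a b, E))

/-- The Bolza functional with running cost `f` and terminal cost `g`, on pairs of a control and a
trajectory that need not solve the state equation. -/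
noncomputable def bolza (g : E → ℝ) : ℝ :=
  quadIntegral hab (superpose f.base.fn p.2) (superpose f.grad.base.fn p.2)
    (superpose f.grad.slope.fn p.2) p.1 + g (p.2 ⟨b, right_mem_Icc.2 hab⟩)

/-- The derivative of `f` in the state along the pair `p` of a control and a trajectory. -/
noncomputable def stateDeriv (r : ℝ) : E →L[ℝ] ℝ :=
  f.base.deriv (graphPt hab p.2 r) + innerSL ℝ (p.1 r) ∘L f.grad.base.deriv (graphPt hab p.2 r)
    + ((1 / 2 : ℝ) • innerApplyL U (p.1 r) (p.1 r)) ∘L f.grad.slope.deriv (graphPt hab p.2 r)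

/-- The second derivative of `f` in the state along the pair `p` of a control and a trajectory. -/
noncomputable def stateHess (r : ℝ) : E →L[ℝ] E →L[ℝ] ℝ :=
  f.base.deriv₂ (graphPt hab p.2 r)
    + postL E U (innerSL ℝ (p.1 r)) (f.grad.base.deriv₂ (graphPt hab p.2 r))
    + postL E (U →L[ℝ] U) ((1 / 2 : ℝ) • innerApplyL U (p.1 r) (p.1 r))
      (f.grad.slope.deriv₂ (graphPt hab p.2 r))

variable {f hab}

theorem contDiff_bolza (hg : ContDiff ℝ 2 g) : ContDiff ℝ 2 fun p => f.bolza hab p g :=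
  have heval : ContDiff ℝ 2 fun p : L2Icc a b U × C(Icc a b, E) => p.2 ⟨b, right_mem_Icc.2 hab⟩ :=
    (ContinuousMap.evalCLM (M := E) ℝ (⟨b, right_mem_Icc.2 hab⟩ : Icc a b)).contDiff.comp
      contDiff_snd
  (contDiff_quadIntegral hab (f.base.contDiff_superpose.comp contDiff_snd)
    (f.grad.base.contDiff_superpose.comp contDiff_snd)
    (f.grad.slope.contDiff_superpose.comp contDiff_snd) contDiff_fst).add
    (hg.comp heval)

theorem fderiv_bolza (hg : ContDiff ℝ 2 g) :
    fderiv ℝ (fun p => f.bolza hab p g) p q =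
      quadIntegral hab (applyL (superpose f.base.deriv p.2) q.2)
        (applyL (superpose f.grad.base.deriv p.2) q.2)
        (applyL (superpose f.grad.slope.deriv p.2) q.2) p.1
      + inner ℝ (f.grad.superposeLp hab p) q.1
      + fderiv ℝ g (p.2 ⟨b, right_mem_Icc.2 hab⟩) (q.2 ⟨b, right_mem_Icc.2 hab⟩) := by
  refine fderiv_apply_eq_of_hasDerivAt (differentiable_of_contDiff_two (contDiff_bolza hg) p) ?_
  have hquad := hasDerivAt_quadIntegral hab (f.base.hasDerivAt_superpose_line p.2 q.2)
    (f.grad.base.hasDerivAt_superpose_line p.2 q.2)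
    (f.grad.slope.hasDerivAt_superpose_line p.2 q.2) (hasDerivAt_line p.1 q.1)
    (fun s => f.inner_slope_comm _)
  have hterm := ((differentiable_of_contDiff_two hg
    (p.2 ⟨b, right_mem_Icc.2 hab⟩)).hasFDerivAt).hasLineDerivAt (q.2 ⟨b, right_mem_Icc.2 hab⟩)
  simp only [zero_smul, add_zero] at hquad
  exact hquad.add hterm

theorem fderiv_fderiv_bolza (hg : ContDiff ℝ 2 g) :
    fderiv ℝ (fderiv ℝ fun p => f.bolza hab p g) p q q' =
      quadIntegral hab (applyL (applyL (superpose f.base.deriv₂ p.2) q.2) q'.2)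
        (applyL (applyL (superpose f.grad.base.deriv₂ p.2) q.2) q'.2)
        (applyL (applyL (superpose f.grad.slope.deriv₂ p.2) q.2) q'.2) p.1
      + inner ℝ (affineLp hab (applyL (superpose f.grad.base.deriv p.2) q'.2)
        (applyL (superpose f.grad.slope.deriv p.2) q'.2) p.1) q.1
      + inner ℝ (f.grad.superposeLpDeriv hab p q) q'.1
      + fderiv ℝ (fderiv ℝ g) (p.2 ⟨b, right_mem_Icc.2 hab⟩) (q.2 ⟨b, right_mem_Icc.2 hab⟩)
        (q'.2 ⟨b, right_mem_Icc.2 hab⟩) := by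
  have hd := differentiable_fderiv_of_contDiff_two (contDiff_bolza (f := f) (hab := hab) hg) p
  rw [fderiv_fderiv_apply hd]
  refine fderiv_apply_eq_of_hasDerivAt (hd.clm_apply (differentiableAt_const _)) ?_
  simp only [fderiv_bolza _ _ hg]
  have hquad := hasDerivAt_quadIntegral hab (f.base.hasDerivAt_superpose_deriv_line p.2 q.2 q'.2)
    (f.grad.base.hasDerivAt_superpose_deriv_line p.2 q.2 q'.2)
    (f.grad.slope.hasDerivAt_superpose_deriv_line p.2 q.2 q'.2) (hasDerivAt_line p.1 q.1)
    (fun s v w => by simpa using f.inner_deriv_slope_comm _ _ _ _)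
  have hgrad := (f.grad.hasDerivAt_superposeLp hab p q).inner ℝ (hasDerivAt_const (0 : ℝ) q'.1)
  have hterm := ((differentiable_fderiv_of_contDiff_two hg
    (p.2 ⟨b, right_mem_Icc.2 hab⟩)).hasFDerivAt.hasLineDerivAt
    (q.2 ⟨b, right_mem_Icc.2 hab⟩)).clm_apply
    (hasDerivAt_const (0 : ℝ) (q'.2 ⟨b, right_mem_Icc.2 hab⟩))
  simp only [zero_smul, add_zero, inner_zero_right, zero_add, map_zero] at hquad hgrad hterm
  exact (hquad.add hgrad).add hterm

theorem hasIntervalIntegral_bolza :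
    HasIntervalIntegral a b (fun r => f.base.fn (graphPt hab p.2 r)
        + inner ℝ (f.grad.base.fn (graphPt hab p.2 r)) (p.1 r)
        + 1 / 2 * inner ℝ (f.grad.slope.fn (graphPt hab p.2 r) (p.1 r)) (p.1 r))
      (f.bolza hab p g - g (p.2 ⟨b, right_mem_Icc.2 hab⟩)) := by
  rw [bolza, add_sub_cancel_right]
  exact hasIntervalIntegral_quadIntegral hab (superpose f.base.fn p.2)
    (superpose f.grad.base.fn p.2) (superpose f.grad.slope.fn p.2) p.1

theorem hasIntervalIntegral_stateDeriv (hg : ContDiff ℝ 2 g) (ζ : C(Icc a b, E)) :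
    HasIntervalIntegral a b (fun r => f.stateDeriv hab p r (ζ (projIcc a b hab r)))
      (fderiv ℝ (fun p => f.bolza hab p g) p (0, ζ)
        - fderiv ℝ g (p.2 ⟨b, right_mem_Icc.2 hab⟩) (ζ ⟨b, right_mem_Icc.2 hab⟩)) := by
  rw [fderiv_bolza _ _ hg, inner_zero_right, add_zero, add_sub_cancel_right]
  refine (hasIntervalIntegral_quadIntegral hab (applyL (superpose f.base.deriv p.2) ζ)
    (applyL (superpose f.grad.base.deriv p.2) ζ) (applyL (superpose f.grad.slope.deriv p.2) ζ)
    p.1).congr hab (.of_forall fun r => ?_)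
  simp only [stateDeriv, add_apply, ContinuousLinearMap.comp_apply, innerSL_apply_apply, smul_apply,
    innerApplyL_apply, smul_eq_mul, applyL_apply, superpose_apply, real_inner_comm (p.1 r)]

theorem hasIntervalIntegral_stateHess (hg : ContDiff ℝ 2 g) :
    HasIntervalIntegral a b (fun r =>
        f.stateHess hab p r (q.2 (projIcc a b hab r)) (q'.2 (projIcc a b hab r))
        + inner ℝ (f.grad.jacobian hab p r (q'.2 (projIcc a b hab r))) (q.1 r)
        + inner ℝ (f.grad.jacobian hab p r (q.2 (projIcc a b hab r))
          + f.grad.slope.fn (graphPt hab p.2 r) (q.1 r)) (q'.1 r))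
      (fderiv ℝ (fderiv ℝ fun p => f.bolza hab p g) p q q'
        - fderiv ℝ (fderiv ℝ g) (p.2 ⟨b, right_mem_Icc.2 hab⟩) (q.2 ⟨b, right_mem_Icc.2 hab⟩)
          (q'.2 ⟨b, right_mem_Icc.2 hab⟩)) := by
  rw [fderiv_fderiv_bolza _ _ _ hg, add_sub_cancel_right]
  refine (((hasIntervalIntegral_quadIntegral hab _ _ _ _).add
    (hasIntervalIntegral_inner_affineLp hab _ _ _ _)).add
    (hasIntervalIntegral_inner hab _ _)).congr hab ?_
  filter_upwards [f.grad.coeFn_superposeLpDeriv hab p q] with r hr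
  simp only [hr, stateHess, add_apply, postL_apply, innerSL_apply_apply, smul_apply,
    innerApplyL_apply, smul_eq_mul, ControlAffine.jacobian_apply, applyL_apply, superpose_apply,
    real_inner_comm (p.1 r)]

end RunningCost

/-! ### The state as a function of the control -/

section StateEquation

theorem LipschitzField.of_linear {E : Type*} [NormedAddCommGroup E] [NormedSpace ℝ E] {a b : ℝ}
    {A : ℝ → E →L[ℝ] E} {g : ℝ → E} (hab : a ≤ b) (hA : MemLp A 2 (volume.restrict (Icc a b)))
    (hg : IntervalIntegrable g volume a b) :
    LipschitzField (fun r z => A r z + g r) a b (fun r => ‖A r‖) where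
  memLp := hA.norm
  lip r _ z z' := by
    rw [add_sub_add_right_eq_sub, ← map_sub]
    exact (A r).le_opNorm _
  integrable Z hZ := (intervalIntegrable_bilin_left (ContinuousLinearMap.id ℝ (E →L[ℝ] E)) hab
    (intervalIntegrable_of_memLp_two hab hA) hZ).add hg

theorem memLp_projIcc {E : Type*} [NormedAddCommGroup E] {a b : ℝ} (hab : a ≤ b)
    (X : C(Icc a b, E)) (p : ENNReal) :
    MemLp (fun r => X (projIcc a b hab r)) p (volume.restrict (Icc a b)) :=
  memLp_Icc_of_continuousOn (X.continuous.comp continuous_projIcc).continuousOn p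

theorem memLp_add_bilin_projIcc {E F G : Type*} [NormedAddCommGroup E] [NormedSpace ℝ E]
    [NormedAddCommGroup F] [NormedSpace ℝ F] [NormedAddCommGroup G] [NormedSpace ℝ G] {a b : ℝ}
    (L : BilinMap E F G) (hab : a ≤ b) (X : C(Icc a b, E)) {v : ℝ → F} {g : ℝ → G} {p : ENNReal}
    (hg : MemLp g p (volume.restrict (Icc a b))) (hv : MemLp v p (volume.restrict (Icc a b))) :
    MemLp (fun r => g r + L (X (projIcc a b hab r)) (v r)) p (volume.restrict (Icc a b)) :=
  hg.add (L.memLp_of_bilin p (memLp_projIcc hab X ⊤) hv)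

namespace ControlAffine

variable {a b : ℝ} {E U F : Type*} [NormedAddCommGroup E] [NormedSpace ℝ E]
  [NormedAddCommGroup U] [InnerProductSpace ℝ U] [NormedAddCommGroup F] [NormedSpace ℝ F]

theorem memLp_jacobian (hab : a ≤ b) (f : ControlAffine (Icc a b) E U F)
    (p : L2Icc a b U × C(Icc a b, E)) :
    MemLp (f.jacobian hab p) 2 (volume.restrict (Icc a b)) :=
  memLp_add_bilin_projIcc (E := E →L[ℝ] U →L[ℝ] F) (F := U) (G := E →L[ℝ] F) (flipL E U F) hab
    (superpose f.slope.deriv p.2) (memLp_projIcc hab (superpose f.base.deriv p.2) 2) (Lp.memLp p.1)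

variable (hab : a ≤ b) (f : ControlAffine (Icc a b) E U E) (x : E) (u v : L2Icc a b U)
  (X : C(Icc a b, E)) (p q : L2Icc a b U × C(Icc a b, E))

/-- The vector field of the state equation `X'(r) = f(r, X(r), u(r))`. -/
noncomputable def stateField (r : ℝ) (z : E) : E :=
  f.base.fn (projIcc a b hab r, z) + f.slope.fn (projIcc a b hab r, z) (u r)

theorem lipschitzField_stateField {LA LB : ℝ}
    (hbase : ∀ s y z, ‖f.base.fn (s, y) - f.base.fn (s, z)‖ ≤ LA * ‖y - z‖)
    (hslope : ∀ s y z, ‖f.slope.fn (s, y) - f.slope.fn (s, z)‖ ≤ LB * ‖y - z‖) :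
    LipschitzField (f.stateField hab u) a b (fun r => LA + LB * ‖u r‖) where
  memLp := (memLp_const LA).add ((Lp.memLp u).norm.const_mul LB)
  lip r _ z z' := by
    rw [stateField, stateField, add_sub_add_comm, ← sub_apply, add_mul]
    refine norm_add_le_of_le (hbase _ _ _) ((ContinuousLinearMap.le_opNorm _ _).trans ?_)
    rw [mul_right_comm]
    gcongr
    exact hslope _ _ _
  integrable Z hZ :=
    have hgraph : ContinuousOn (fun r => (projIcc a b hab r, Z r)) (Icc a b) :=
      continuous_projIcc.continuousOn.prodMk hZ
    ((f.base.fn.continuous.comp_continuousOn hgraph).intervalIntegrable_of_Icc hab).add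
    (intervalIntegrable_bilin_left (ContinuousLinearMap.id ℝ (U →L[ℝ] E)).flip hab
      (intervalIntegrable_coeFn_Lp hab u) (f.slope.fn.continuous.comp_continuousOn hgraph))

/-- The defect of a pair of a control and a trajectory in the integrated state equation. -/
noncomputable def stateDefect : C(Icc a b, E) :=
  p.2 - ContinuousMap.const _ x - primL hab (f.superposeLp hab p)

theorem contDiff_stateDefect : ContDiff ℝ 2 (f.stateDefect hab x) :=
  (contDiff_snd.sub contDiff_const).sub
    ((primL (E := E) hab).contDiff.comp (f.contDiff_superposeLp hab))

theorem fderiv_stateDefect :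
    fderiv ℝ (f.stateDefect hab x) p q = q.2 - primL hab (f.superposeLpDeriv hab p q) :=
  fderiv_apply_eq_of_hasDerivAt
    (differentiable_of_contDiff_two (f.contDiff_stateDefect hab x) p)
    (((hasDerivAt_line p.2 q.2).sub_const _).sub
      ((primL (E := E) hab).hasFDerivAt.comp_hasDerivAt 0 (f.hasDerivAt_superposeLp hab p q)))

theorem stateDefect_eq_zero_iff_solvesODE : f.stateDefect hab x (u, X) = 0 ↔
    SolvesODE (f.stateField hab u) a b a x (fun r => X (projIcc a b hab r)) := by
  have ha := left_mem_Icc.2 hab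
  have hvel : ∀ s ∈ Icc a b, ∫ r in a..s, f.superposeLp hab (u, X) r =
      ∫ r in a..s, f.stateField hab u r (X (projIcc a b hab r)) := fun s hs =>
    intervalIntegral_congr_ae_Icc ha hs (coeFn_affineLp hab _ _ _)
  have hint : IntervalIntegrable (fun r => f.stateField hab u r (X (projIcc a b hab r)))
      volume a b := by
    have hLp := intervalIntegrable_coeFn_Lp hab (f.superposeLp hab (u, X))
    rw [intervalIntegrable_iff_integrableOn_Icc_of_le hab] at hLp ⊢
    exact Integrable.congr hLp (coeFn_affineLp hab _ _ _)
  constructor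
  · refine fun h => ⟨by fun_prop, hint, fun s hs => ?_⟩
    rw [stateDefect, sub_sub, sub_eq_zero] at h
    simpa only [projIcc_of_mem hab hs, ContinuousMap.add_apply, ContinuousMap.const_apply,
      primL_apply, hvel s hs] using DFunLike.congr_fun h ⟨s, hs⟩
  · refine fun h => ContinuousMap.ext fun s => ?_
    have hs := h.eq_integral s s.2
    rw [projIcc_val] at hs
    simp only [stateDefect, ContinuousMap.sub_apply, ContinuousMap.const_apply, primL_apply,
      hvel s s.2, hs, ContinuousMap.zero_apply]
    abel

/-- The map `Z` sends every control to the unique trajectory which it steers out of `x`. -/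
def IsSolutionMap (Z : L2Icc a b U → C(Icc a b, E)) : Prop :=
  ∀ u X, SolvesODE (f.stateField hab u) a b a x (fun r => X (projIcc a b hab r)) ↔ X = Z u

variable {Z : L2Icc a b U → C(Icc a b, E)}

variable {hab f x} in
theorem IsSolutionMap.solvesODE (hZ : f.IsSolutionMap hab x Z) :
    SolvesODE (f.stateField hab u) a b a x (fun r => Z u (projIcc a b hab r)) :=
  (hZ u _).2 rfl

variable {hab f x u} in
theorem IsSolutionMap.eq_of_solvesODE (hZ : f.IsSolutionMap hab x Z) {X : ℝ → E}
    (hX : SolvesODE (f.stateField hab u) a b a x X) (s : Icc a b) : X s = Z u s :=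
  DFunLike.congr_fun
    ((hZ u ⟨_, hX.continuousOn.domRestrict⟩).1 (hX.comp_projIcc (left_mem_Icc.2 hab) hab)) s

variable {hab f x} in
theorem IsSolutionMap.stateDefect_eq_zero_iff (hZ : f.IsSolutionMap hab x Z) :
    f.stateDefect hab x (u, X) = 0 ↔ X = Z u :=
  (f.stateDefect_eq_zero_iff_solvesODE hab x u X).trans (hZ u X)

variable [CompleteSpace E]

theorem bijective_linearizedState : Function.Bijective fun ζ : C(Icc a b, E) =>
    ζ - primL hab (f.superposeLpDeriv hab p (0, ζ)) := by
  rw [Function.bijective_iff_existsUnique]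
  intro g
  -- Subtracting the inhomogeneity `g` leaves a linear equation `X' = Df · (X + g)`, `X(a) = 0`.
  have hg : IntervalIntegrable (fun r => f.jacobian hab p r (g (projIcc a b hab r))) volume a b :=
    intervalIntegrable_bilin_left (ContinuousLinearMap.id ℝ (E →L[ℝ] E)) hab
      (intervalIntegrable_of_memLp_two hab (f.memLp_jacobian hab p)) (by fun_prop)
  have hlin := LipschitzField.of_linear hab (f.memLp_jacobian hab p) hg
  have hpicard (X : C(Icc a b, E)) : hlin.picardMap hab (left_mem_Icc.2 hab) 0 X =
      primL hab (f.superposeLpDeriv hab p (0, X + g)) := by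
    ext s
    rw [LipschitzField.picardMap, ContinuousMap.coe_mk, zero_add, primL_apply]
    refine intervalIntegral_congr_ae_Icc (left_mem_Icc.2 hab) s.2 ?_
    filter_upwards [f.coeFn_superposeLpDeriv hab p (0, X + g),
      Lp.coeFn_zero U 2 (volume.restrict (Icc a b))] with r hderiv hzero
    rw [hderiv, hzero, Pi.zero_apply, map_zero, add_zero, ContinuousMap.add_apply, map_add]
  obtain ⟨X, hX, hX'⟩ := hlin.existsUnique_picardMap_eq hab (left_mem_Icc.2 hab) 0
  simp only [hpicard] at hX hX'
  refine ⟨X + g, by simp only [hX, add_sub_cancel_left], fun ζ hζ => ?_⟩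
  have hshift := hX' (ζ - g) (by rw [sub_add_cancel, ← hζ, sub_sub_cancel])
  rw [← hshift, sub_add_cancel]

theorem isInvertible_fderiv_stateDefect_inr :
    (fderiv ℝ (f.stateDefect hab x) p ∘L .inr ℝ (L2Icc a b U) C(Icc a b, E)).IsInvertible := by
  have hb : Function.Bijective
      (fderiv ℝ (f.stateDefect hab x) p ∘L .inr ℝ (L2Icc a b U) C(Icc a b, E)) := by
    convert f.bijective_linearizedState hab p using 2 with ζ
    exact f.fderiv_stateDefect hab x p (0, ζ)
  exact ⟨ContinuousLinearEquiv.ofBijective _ (LinearMap.ker_eq_bot.2 hb.1)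
    (LinearMap.range_eq_top.2 hb.2), rfl⟩

theorem exists_isSolutionMap {LA LB : ℝ}
    (hbase : ∀ s y z, ‖f.base.fn (s, y) - f.base.fn (s, z)‖ ≤ LA * ‖y - z‖)
    (hslope : ∀ s y z, ‖f.slope.fn (s, y) - f.slope.fn (s, z)‖ ≤ LB * ‖y - z‖) :
    ∃ Z, f.IsSolutionMap hab x Z := by
  have ha := left_mem_Icc.2 hab
  have hlip u := f.lipschitzField_stateField hab u hbase hslope
  choose Z hZ hZ' using fun u => (hlip u).existsUnique_picardMap_eq hab ha x
  refine ⟨Z, fun u X => ⟨fun h => hZ' u X ?_, ?_⟩⟩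
  · have hX := (hlip u).picardMap_domRestrict hab ha h
    rwa [show (⟨_, h.continuousOn.domRestrict⟩ : C(Icc a b, E)) = X from
      ContinuousMap.ext fun s => congrArg X (projIcc_val hab s)] at hX
  · rintro rfl
    exact (hlip u).solvesODE_of_picardMap_eq hab ha (hZ u)

variable [CompleteSpace U] {hab f x}

theorem IsSolutionMap.contDiff (hZ : f.IsSolutionMap hab x Z) : ContDiff ℝ 2 Z := by
  refine contDiff_iff_contDiffAt.2 fun u => ?_
  have hdefect : ContDiffAt ℝ 2 (f.stateDefect hab x) (u, Z u) :=
    (f.contDiff_stateDefect hab x).contDiffAt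
  have hinv := f.isInvertible_fderiv_stateDefect_inr hab x (u, Z u)
  refine (hdefect.contDiffAt_implicitFunction two_ne_zero hinv).congr_of_eventuallyEq ?_
  filter_upwards [hdefect.eventually_apply_implicitFunction two_ne_zero hinv] with v hv
  rw [(hZ.stateDefect_eq_zero_iff _ _).2 rfl] at hv
  exact ((hZ.stateDefect_eq_zero_iff _ _).1 hv).symm

theorem IsSolutionMap.fderiv_eq (hZ : f.IsSolutionMap hab x Z) :
    fderiv ℝ Z u v = primL hab (f.superposeLpDeriv hab (u, Z u) (v, fderiv ℝ Z u v)) := by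
  have hchain := fderiv_comp_prodMk_apply
    (differentiable_of_contDiff_two (f.contDiff_stateDefect hab x) (u, Z u))
    (differentiable_of_contDiff_two hZ.contDiff u) v
  rw [show (fun u => f.stateDefect hab x (u, Z u)) = fun _ => 0 from
    funext fun u => (hZ.stateDefect_eq_zero_iff _ _).2 rfl, fderiv_fun_const, f.fderiv_stateDefect]
    at hchain
  exact (sub_eq_zero.1 hchain.symm)

end ControlAffine

end StateEquation

/-! ### The costate -/

section Operations

variable {K : Type*} [TopologicalSpace K] {E F G : Type*} [NormedAddCommGroup E] [NormedSpace ℝ E]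
  [NormedAddCommGroup F] [NormedSpace ℝ F] [NormedAddCommGroup G] [NormedSpace ℝ G]

/-- The sum of two smooth coefficients. -/
noncomputable def SmoothCoeff.add (f g : SmoothCoeff K E F) : SmoothCoeff K E F where
  fn := f.fn + g.fn
  deriv := f.deriv + g.deriv
  deriv₂ := f.deriv₂ + g.deriv₂
  hasFDerivAt_fn s y := (f.hasFDerivAt_fn s y).add (g.hasFDerivAt_fn s y)
  hasFDerivAt_deriv s y := (f.hasFDerivAt_deriv s y).add (g.hasFDerivAt_deriv s y)

/-- The smooth coefficient `(s, y) ↦ L(s) f(s, y)` with `L(s)` linear. -/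
noncomputable def SmoothCoeff.timeComp (L : CMap K (F →L[ℝ] G)) (f : SmoothCoeff K E F) :
    SmoothCoeff K E G where
  fn := ⟨fun p => L p.1 (f.fn p), by fun_prop⟩
  deriv := ⟨fun p => L p.1 ∘L f.deriv p,
    (L.continuous.comp continuous_fst).clm_comp f.deriv.continuous⟩
  deriv₂ := ⟨fun p => ContinuousLinearMap.compL ℝ E F G (L p.1) ∘L f.deriv₂ p,
    ((ContinuousLinearMap.compL ℝ E F G).continuous.comp
      (L.continuous.comp continuous_fst)).clm_comp f.deriv₂.continuous⟩
  hasFDerivAt_fn s y := (L s).hasFDerivAt.comp y (f.hasFDerivAt_fn s y)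
  hasFDerivAt_deriv s y :=
    (ContinuousLinearMap.compL ℝ E F G (L s)).hasFDerivAt.comp y (f.hasFDerivAt_deriv s y)

/-- `(y, M) ↦ M† y`, as a bounded bilinear map. -/
noncomputable def adjointApplyL (U E : Type*) [NormedAddCommGroup E] [InnerProductSpace ℝ E]
    [NormedAddCommGroup U] [InnerProductSpace ℝ U] [CompleteSpace U] :
    BilinMap E (U →L[ℝ] E) U :=
  ContinuousLinearMap.compL ℝ (U →L[ℝ] E) (U →L[ℝ] ℝ) U (rieszL U)
    ∘L ContinuousLinearMap.compL ℝ U E ℝ ∘L innerSL ℝ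

@[simp]
theorem adjointApplyL_apply {U E : Type*} [NormedAddCommGroup E] [InnerProductSpace ℝ E]
    [CompleteSpace E] [NormedAddCommGroup U] [InnerProductSpace ℝ U] [CompleteSpace U]
    (y : E) (M : U →L[ℝ] E) : adjointApplyL U E y M = (M†) y :=
  ext_inner_right ℝ fun u =>
    (inner_rieszL (innerSL ℝ y ∘L M) u).trans (ContinuousLinearMap.adjoint_inner_left M u y).symm

end Operations

section Costate

variable {a b : ℝ} {E U : Type*} [NormedAddCommGroup E] [InnerProductSpace ℝ E] [CompleteSpace E]
  [NormedAddCommGroup U] [InnerProductSpace ℝ U]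

theorem IsPrimitive.hasIntervalIntegral {φ φ' : ℝ → ℝ} (h : IsPrimitive a b φ φ') (hab : a ≤ b) :
    HasIntervalIntegral a b φ' (φ b - φ a) :=
  ⟨h.integrable, (h.sub_eq (left_mem_Icc.2 hab) (right_mem_Icc.2 hab)).symm⟩

theorem ControlAffine.IsSolutionMap.isPrimitive_fderiv [CompleteSpace U] {hab : a ≤ b}
    {f : ControlAffine (Icc a b) E U E} {x : E} {Z : L2Icc a b U → C(Icc a b, E)}
    (hZ : f.IsSolutionMap hab x Z) (u v : L2Icc a b U) :
    IsPrimitive a b (fun r => fderiv ℝ Z u v (projIcc a b hab r)) (fun r =>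
      f.jacobian hab (u, Z u) r (fderiv ℝ Z u v (projIcc a b hab r))
        + f.slope.fn (graphPt hab (Z u) r) (v r)) := by
  refine (IsPrimitive.intervalIntegral (intervalIntegrable_coeFn_Lp hab _)
    (left_mem_Icc.2 hab)).congr hab (fun s hs => ?_)
    (f.coeFn_superposeLpDeriv hab (u, Z u) (v, fderiv ℝ Z u v)).symm
  dsimp only
  conv_lhs => rw [hZ.fderiv_eq, primL_apply, projIcc_of_mem hab hs]

theorem ControlAffine.IsSolutionMap.fderiv_left [CompleteSpace U] {hab : a ≤ b}
    {f : ControlAffine (Icc a b) E U E} {x : E} {Z : L2Icc a b U → C(Icc a b, E)}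
    (hZ : f.IsSolutionMap hab x Z) (u v : L2Icc a b U) :
    fderiv ℝ Z u v ⟨a, left_mem_Icc.2 hab⟩ = 0 := by
  rw [hZ.fderiv_eq, primL_apply, intervalIntegral.integral_same]

namespace RunningCost

variable [CompleteSpace U] (hab : a ≤ b) (f : RunningCost (Icc a b) E U)
  (σ : ControlAffine (Icc a b) E U E) (g : E → ℝ) (p q : L2Icc a b U × C(Icc a b, E))

/-- The Hamiltonian `f + ⟪Y, σ⟫` of a control problem with running cost `f` and dynamics `σ`, along
a given costate trajectory `Y`. -/
noncomputable def hamiltonian (Y : C(Icc a b, E)) : RunningCost (Icc a b) E U where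
  base := f.base.add (σ.base.timeComp
    ⟨fun s => innerSL ℝ (Y s), (innerSL ℝ).continuous.comp Y.continuous⟩)
  grad :=
    { base := f.grad.base.add (SmoothCoeff.timeComp (F := U →L[ℝ] E)
        ⟨fun s => adjointApplyL U E (Y s), (adjointApplyL U E).continuous.comp Y.continuous⟩
        σ.slope)
      slope := f.grad.slope }
  inner_slope_comm := f.inner_slope_comm

/-- `Y`, with derivative `Y'`, solves the adjoint equation along the pair `p` of a control and a
trajectory, and ends in the gradient of the terminal cost `g`. -/
structure IsCostate (Y : C(Icc a b, E)) (Y' : ℝ → E) : Prop where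
  isPrimitive : IsPrimitive a b (fun s => Y (projIcc a b hab s)) Y'
  inner_deriv : ∀ᵐ r ∂volume.restrict (Icc a b), ∀ e,
    inner ℝ (Y' r) e = -(f.hamiltonian σ Y).stateDeriv hab p r e
  inner_right : ∀ e, inner ℝ (Y ⟨b, right_mem_Icc.2 hab⟩) e =
    fderiv ℝ g (p.2 ⟨b, right_mem_Icc.2 hab⟩) e

/-- `l`, with derivative `l'`, is the first variation of the costate along the variation `q` of the
pair `p` of a control and a trajectory. Here `f` stands for the Hamiltonian. -/
structure IsCostateVariation (l l' : ℝ → E) : Prop where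
  isPrimitive : IsPrimitive a b l l'
  inner_deriv : ∀ᵐ r ∂volume.restrict (Icc a b), ∀ e, inner ℝ (l' r) e =
    -(inner ℝ (l r) (σ.jacobian hab p r e) + f.stateHess hab p r (q.2 (projIcc a b hab r)) e
      + inner ℝ (q.1 r) (f.grad.jacobian hab p r e))
  inner_right : ∀ e, inner ℝ (l b) e =
    fderiv ℝ (fderiv ℝ g) (p.2 ⟨b, right_mem_Icc.2 hab⟩) (q.2 ⟨b, right_mem_Icc.2 hab⟩) e

variable {hab f σ g} {x : E} {Z : L2Icc a b U → C(Icc a b, E)} {u : L2Icc a b U}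
  {Y : C(Icc a b, E)} {Y' : ℝ → E}

theorem bolza_eq_hamiltonian_bolza (hZ : σ.IsSolutionMap hab x Z) (hg : ContDiff ℝ 2 g)
    (hY : f.IsCostate hab σ g (u, Z u) Y Y') (u' : L2Icc a b U) :
    f.bolza hab (u', Z u') g = (f.hamiltonian σ Y).bolza hab (u', Z u') g
      - fderiv ℝ (fun p => (f.hamiltonian σ Y).bolza hab p g) (u, Z u) (0, Z u')
      + inner ℝ (Y ⟨a, left_mem_Icc.2 hab⟩) x := by
  have ha := left_mem_Icc.2 hab
  have hb := right_mem_Icc.2 hab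
  have hZu' := hZ.solvesODE u'
  have hparts := (hY.isPrimitive.inner (hZu'.isPrimitive ha) hab).hasIntervalIntegral hab
  rw [hZu'.initial ha, projIcc_of_mem hab ha, projIcc_of_mem hab hb, hY.inner_right] at hparts
  have hsplit := (hasIntervalIntegral_bolza (hab := hab) (f := f) (g := g) (u', Z u')).add hparts
  have hham := (hasIntervalIntegral_bolza (hab := hab) (f := f.hamiltonian σ Y) (g := g)
    (u', Z u')).add
    ((hasIntervalIntegral_stateDeriv (hab := hab) (f := f.hamiltonian σ Y) (u, Z u) hg
      (Z u')).const_mul (-1))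
  have heq := hsplit.unique (hham.congr hab (by
    filter_upwards [hY.inner_deriv] with r hr
    simp only [hr, hamiltonian, SmoothCoeff.add, SmoothCoeff.timeComp, ContinuousMap.add_apply,
      ContinuousMap.coe_mk, ControlAffine.stateField, inner_add_left, inner_add_right,
      innerSL_apply_apply, adjointApplyL_apply, ContinuousLinearMap.adjoint_inner_left]
    ring))
  linear_combination heq

theorem contDiff_bolza_comp (hZ : σ.IsSolutionMap hab x Z) (hg : ContDiff ℝ 2 g) :
    ContDiff ℝ 2 fun u => f.bolza hab (u, Z u) g :=
  (contDiff_bolza hg).comp (contDiff_id.prodMk hZ.contDiff)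

theorem inner_hess_bolza (hZ : σ.IsSolutionMap hab x Z) (hg : ContDiff ℝ 2 g)
    (hY : f.IsCostate hab σ g (u, Z u) Y Y') (v w : L2Icc a b U) :
    inner ℝ (hess (fun u => f.bolza hab (u, Z u) g) u v) w =
      fderiv ℝ (fderiv ℝ fun p => (f.hamiltonian σ Y).bolza hab p g) (u, Z u)
        (v, fderiv ℝ Z u v) (w, fderiv ℝ Z u w) := by
  rw [inner_hess (differentiable_fderiv_of_contDiff_two (contDiff_bolza_comp hZ hg) u)]
  exact fderiv_fderiv_eq_of_lagrangian (contDiff_bolza hg) hZ.contDiff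
    (bolza_eq_hamiltonian_bolza hZ hg hY) v w

theorem inner_hess_bolza_of_costateVariation (hZ : σ.IsSolutionMap hab x Z) (hg : ContDiff ℝ 2 g)
    (hY : f.IsCostate hab σ g (u, Z u) Y Y') {v : L2Icc a b U} {l l' : ℝ → E}
    (hl : (f.hamiltonian σ Y).IsCostateVariation hab σ g (u, Z u) (v, fderiv ℝ Z u v) l l')
    (w : L2Icc a b U) :
    HasIntervalIntegral a b (fun r => inner ℝ (f.grad.slope.fn (graphPt hab (Z u) r) (v r)
        + ((f.hamiltonian σ Y).grad.jacobian hab (u, Z u) r (fderiv ℝ Z u v (projIcc a b hab r))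
          + (σ.slope.fn (graphPt hab (Z u) r)†) (l r))) (w r))
      (inner ℝ (hess (fun u => f.bolza hab (u, Z u) g) u v) w) := by
  have hb := right_mem_Icc.2 hab
  have hparts := (hl.isPrimitive.inner (hZ.isPrimitive_fderiv u w) hab).hasIntervalIntegral hab
  rw [projIcc_of_mem hab hb, projIcc_of_mem hab (left_mem_Icc.2 hab), hZ.fderiv_left,
    inner_zero_right, sub_zero, hl.inner_right] at hparts
  have hess := (hasIntervalIntegral_stateHess (hab := hab) (f := f.hamiltonian σ Y) (u, Z u)
    (v, fderiv ℝ Z u v) (w, fderiv ℝ Z u w) hg).add hparts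
  rw [sub_add_cancel, ← inner_hess_bolza hZ hg hY] at hess
  refine hess.congr hab ?_
  filter_upwards [hl.inner_deriv] with r hr
  simp only [hr, inner_add_left, inner_add_right, ContinuousLinearMap.adjoint_inner_left]
  simp only [hamiltonian, real_inner_comm (v r)]
  ring

end RunningCost

end Costate

/-! ### The fundamental matrix and the Fredholm kernel -/

section FundamentalMatrix

variable {a b : ℝ} {E : Type*} [NormedAddCommGroup E] [InnerProductSpace ℝ E]
  {A : ℝ → E →L[ℝ] E}

theorem lipschitzField_bilin {V W : Type*} [NormedAddCommGroup V] [NormedSpace ℝ V]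
    [NormedAddCommGroup W] [NormedSpace ℝ W] (L : BilinMap V W W) {A : ℝ → V} (hab : a ≤ b)
    (hA : MemLp A 2 (volume.restrict (Icc a b))) :
    LipschitzField (fun r z => L (A r) z) a b (fun r => ‖L (A r)‖) := by
  simpa only [add_zero, Function.comp_apply] using
    LipschitzField.of_linear (g := fun _ => 0) hab (L.comp_memLp' hA) intervalIntegrable_const

theorem lipschitzField_comp (hab : a ≤ b) (hA : MemLp A 2 (volume.restrict (Icc a b))) :
    LipschitzField (fun r (M : E →L[ℝ] E) => A r ∘L M) a b
      (fun r => ‖ContinuousLinearMap.compL ℝ E E E (A r)‖) :=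
  lipschitzField_bilin (ContinuousLinearMap.compL ℝ E E E) hab hA

theorem lipschitzField_neg_comp (hab : a ≤ b) (hA : MemLp A 2 (volume.restrict (Icc a b))) :
    LipschitzField (fun r (M : E →L[ℝ] E) => -(M ∘L A r)) a b
      (fun r => ‖(-(ContinuousLinearMap.compL ℝ E E E).flip) (A r)‖) :=
  lipschitzField_bilin (-(ContinuousLinearMap.compL ℝ E E E).flip) hab hA

/-- `Ψ` is a fundamental matrix of `A` on `[a, b]`, with inverse `Ξ`. -/
structure FundamentalPair (A : ℝ → E →L[ℝ] E) (a b : ℝ) (Ψ Ξ : ℝ → E →L[ℝ] E) : Prop where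
  isPrimitive : IsPrimitive a b Ψ (fun s => A s ∘L Ψ s)
  isPrimitive_inv : IsPrimitive a b Ξ (fun s => -(Ξ s ∘L A s))
  comp_inv : ∀ s ∈ Icc a b, Ψ s ∘L Ξ s = ContinuousLinearMap.id ℝ E

variable [CompleteSpace E]

theorem exists_fundamentalPair [FiniteDimensional ℝ E] (hab : a ≤ b)
    (hA : MemLp A 2 (volume.restrict (Icc a b))) : ∃ Ψ Ξ, FundamentalPair A a b Ψ Ξ := by
  have ha := left_mem_Icc.2 hab
  obtain ⟨Ψ, hΨ⟩ := (lipschitzField_comp hab hA).exists_solvesODE ha (ContinuousLinearMap.id ℝ E)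
  obtain ⟨Ξ, hΞ⟩ :=
    (lipschitzField_neg_comp hab hA).exists_solvesODE ha (ContinuousLinearMap.id ℝ E)
  have hΨ' := hΨ.isPrimitive ha
  have hΞ' := hΞ.isPrimitive ha
  have hprod := hΞ'.bilin (ContinuousLinearMap.compL ℝ E E E) hΨ' hab
  have inv_comp : ∀ s ∈ Icc a b, Ξ s ∘L Ψ s = ContinuousLinearMap.id ℝ E := fun s hs => by
    have h := hprod.eq_integral s hs
    have hzero : ∀ r, (-(Ξ r ∘L A r)) ∘L Ψ r + Ξ r ∘L A r ∘L Ψ r = 0 := fun r => by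
      rw [ContinuousLinearMap.neg_comp, ContinuousLinearMap.comp_assoc, neg_add_cancel]
    simpa only [ContinuousLinearMap.compL_apply, hzero, intervalIntegral.integral_zero, add_zero,
      hΨ.initial ha, hΞ.initial ha, ContinuousLinearMap.comp_id] using h
  refine ⟨Ψ, Ξ, hΨ', hΞ', fun s hs => ?_⟩
  have hmul : (Ξ s : E →ₗ[ℝ] E) * (Ψ s : E →ₗ[ℝ] E) = 1 :=
    congrArg (ContinuousLinearMap.toLinearMap) (inv_comp s hs)
  exact ContinuousLinearMap.coe_injective (mul_eq_one_comm.1 hmul)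

namespace FundamentalPair

variable {Ψ Ξ : ℝ → E →L[ℝ] E} (h : FundamentalPair A a b Ψ Ξ) {s τ : ℝ}
include h

theorem adjoint_comp_inv_apply (hs : s ∈ Icc a b) (e : E) : (Ξ s†) ((Ψ s†) e) = e := by
  rw [← ContinuousLinearMap.comp_apply, ← ContinuousLinearMap.adjoint_comp, h.comp_inv s hs,
    ContinuousLinearMap.adjoint_id, ContinuousLinearMap.id_apply]

theorem eq_of_solvesODE (hA : MemLp A 2 (volume.restrict (Icc a b))) (hτ : τ ∈ Icc a b)
    {M : ℝ → E →L[ℝ] E}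
    (hM : SolvesODE (fun s M => A s ∘L M) τ b τ (ContinuousLinearMap.id ℝ E) M)
    (hs : s ∈ Icc τ b) : M s = Ψ s ∘L Ξ τ := by
  have hA' : MemLp A 2 (volume.restrict (Icc τ b)) :=
    hA.mono_measure (Measure.restrict_mono (Icc_subset_Icc_left hτ.1) le_rfl)
  have hΨΞ : IsPrimitive τ b (fun s => Ψ s ∘L Ξ τ) (fun s => (A s ∘L Ψ s) ∘L Ξ τ) :=
    (h.isPrimitive.mono hτ (right_mem_Icc.2 (hτ.1.trans hτ.2))).clm
      ((ContinuousLinearMap.compL ℝ E E E).flip (Ξ τ))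
  have hτ' : τ ∈ Icc τ b := left_mem_Icc.2 hτ.2
  have hsol := hΨΞ.solvesODE (f := fun s M => A s ∘L M) hτ' (.of_forall fun r => rfl)
  rw [h.comp_inv τ hτ] at hsol
  exact (lipschitzField_comp hτ.2 hA').eqOn_of_solvesODE hτ' hM hsol hs

theorem isPrimitive_inv_apply (hab : a ≤ b) {ζ g : ℝ → E}
    (hζ : IsPrimitive a b ζ (fun r => A r (ζ r) + g r)) :
    IsPrimitive a b (fun s => Ξ s (ζ s)) (fun s => Ξ s (g s)) := by
  refine (h.isPrimitive_inv.bilin (ContinuousLinearMap.id ℝ (E →L[ℝ] E)) hζ hab).congr hab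
    (fun _ _ => rfl) (.of_forall fun s => ?_)
  simp only [ContinuousLinearMap.id_apply, neg_apply, ContinuousLinearMap.comp_apply, map_add]
  abel

theorem intervalIntegrable_adjoint_apply (hab : a ≤ b) {f : ℝ → E}
    (hf : IntervalIntegrable f volume a b) :
    IntervalIntegrable (fun r => (Ψ r†) (f r)) volume a b := by
  simpa only [adjointApplyL_apply] using
    intervalIntegrable_bilin_left (adjointApplyL E E) hab hf h.isPrimitive.continuousOn

end FundamentalPair

/-- The solution of the adjoint equation `l' = -A† l - h`, `l(b) = e`, by variation of constants,
where `Ψ` is a fundamental matrix of `A` and `Ξ` is its inverse. -/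
noncomputable def adjointSolution (b : ℝ) (Ψ Ξ : ℝ → E →L[ℝ] E) (e : E) (h : ℝ → E) (s : ℝ) : E :=
  (Ξ s†) ((Ψ b†) e + ∫ r in s..b, (Ψ r†) (h r))

namespace FundamentalPair

variable {Ψ Ξ : ℝ → E →L[ℝ] E} (hΨ : FundamentalPair A a b Ψ Ξ) (hab : a ≤ b) {e : E} {h : ℝ → E}
include hΨ hab

theorem adjointSolution_right : adjointSolution b Ψ Ξ e h b = e := by
  rw [adjointSolution, intervalIntegral.integral_same, add_zero,
    hΨ.adjoint_comp_inv_apply (right_mem_Icc.2 hab)]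

theorem isPrimitive_adjointSolution (hh : IntervalIntegrable h volume a b) :
    IsPrimitive a b (adjointSolution b Ψ Ξ e h)
      (fun s => -((A s†) (adjointSolution b Ψ Ξ e h s)) - h s) := by
  have hκ : IsPrimitive a b (fun s => (Ψ b†) e + ∫ r in s..b, (Ψ r†) (h r))
      (fun s => 0 + -((Ψ s†) (h s))) :=
    ((IsPrimitive.const ((Ψ b†) e)).add (IsPrimitive.intervalIntegral
      (hΨ.intervalIntegrable_adjoint_apply hab hh) (right_mem_Icc.2 hab)).neg).congr hab
      (fun s _ => by rw [intervalIntegral.integral_symm]) (.of_forall fun _ => rfl)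
  refine (hκ.bilin (adjointApplyL E E) hΨ.isPrimitive_inv hab).congr hab
    (fun s _ => (adjointApplyL_apply _ (Ξ s)).symm) ?_
  filter_upwards [ae_restrict_mem measurableSet_Icc] with s hs
  rw [adjointApplyL_apply, adjointApplyL_apply, zero_add, map_neg,
    hΨ.adjoint_comp_inv_apply hs, map_neg, ContinuousLinearMap.adjoint_comp, adjointSolution]
  simp only [neg_apply, ContinuousLinearMap.comp_apply]
  abel

end FundamentalPair

end FundamentalMatrix

section Kernel

variable {a b : ℝ} {E U : Type*} [NormedAddCommGroup E] [InnerProductSpace ℝ E] [CompleteSpace E]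
  [NormedAddCommGroup U] [InnerProductSpace ℝ U] [CompleteSpace U]

/-- The kernel of the Fredholm equation of a linear-quadratic problem, with running weight `H`,
mixed weight `C`, terminal weight `G`, control operator `B` and fundamental matrix `Φ`. -/
noncomputable def fredholmKernel (a b : ℝ) (B : ℝ → U →L[ℝ] E) (H : ℝ → E →L[ℝ] E)
    (C : ℝ → E →L[ℝ] U) (G : E →L[ℝ] E) (Φ : ℝ → ℝ → (E →L[ℝ] E)) (s r : ℝ) : U →L[ℝ] U :=
  (B s)† ∘L (Φ b s)† ∘L G ∘L Φ b r ∘L B r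
    + (∫ q in (max s r)..b, (B s)† ∘L (Φ q s)† ∘L H q ∘L Φ q r ∘L B r)
    + (Icc a s).indicator (fun r' => C s ∘L Φ s r' ∘L B r') r
    + (Icc s b).indicator (fun r' => (B s)† ∘L (Φ r' s)† ∘L (C r')†) r

/-- The observability Gramian of the weights `H` and `G` on `[s, b]`, transported to the initial
time by the fundamental matrix `Ψ`. -/
noncomputable def gramian (b : ℝ) (Ψ H : ℝ → E →L[ℝ] E) (G : E →L[ℝ] E) (s : ℝ) : E →L[ℝ] E :=
  (Ψ b)† ∘L G ∘L Ψ b + ∫ q in s..b, (Ψ q)† ∘L H q ∘L Ψ q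

variable {A H Ψ Ξ : ℝ → E →L[ℝ] E} {B : ℝ → U →L[ℝ] E} {C : ℝ → E →L[ℝ] U} {G : E →L[ℝ] E}
  {Φ : ℝ → ℝ → (E →L[ℝ] E)} {s r : ℝ} {v : ℝ → U} {ζ : ℝ → E}

theorem fredholmKernel_congr {B' : ℝ → U →L[ℝ] E} {H' : ℝ → E →L[ℝ] E} {C' : ℝ → E →L[ℝ] U}
    (hB : EqOn B B' (Icc a b)) (hH : EqOn H H' (Icc a b)) (hC : EqOn C C' (Icc a b))
    (hs : s ∈ Icc a b) (hr : r ∈ Icc a b) :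
    fredholmKernel a b B H C G Φ s r = fredholmKernel a b B' H' C' G Φ s r := by
  have hint : (∫ q in (max s r)..b, (B s)† ∘L (Φ q s)† ∘L H q ∘L Φ q r ∘L B r) =
      ∫ q in (max s r)..b, (B s)† ∘L (Φ q s)† ∘L H' q ∘L Φ q r ∘L B r :=
    intervalIntegral.integral_congr fun q hq => by
      rw [uIcc_of_le (max_le hs.2 hr.2)] at hq
      rw [hH ⟨hs.1.trans ((le_max_left s r).trans hq.1), hq.2⟩]
  rw [fredholmKernel, fredholmKernel, hint, hB hs, hB hr, hC hs]
  simp only [indicator, hB hr, hC hr]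

theorem gramian_right_apply (e : E) : gramian b Ψ H G b e = (Ψ b†) (G (Ψ b e)) := by
  rw [gramian, intervalIntegral.integral_same, add_zero]
  rfl

theorem intervalIntegrable_adjoint_comp_comp (hab : a ≤ b) (hΨ : ContinuousOn Ψ (Icc a b))
    (hH : IntervalIntegrable H volume a b) :
    IntervalIntegrable (fun q => (Ψ q)† ∘L H q ∘L Ψ q) volume a b := by
  have hadj : ContinuousOn (fun q => (Ψ q)†) (Icc a b) :=
    (LinearIsometryEquiv.continuous _).comp_continuousOn hΨ
  exact intervalIntegrable_bilin_left (ContinuousLinearMap.compL ℝ E E E).flip hab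
    (intervalIntegrable_bilin_left (ContinuousLinearMap.compL ℝ E E E) hab hH hΨ) hadj

theorem isPrimitive_gramian (hab : a ≤ b) (hΨ : ContinuousOn Ψ (Icc a b))
    (hH : IntervalIntegrable H volume a b) :
    IsPrimitive a b (gramian b Ψ H G) (fun q => -((Ψ q)† ∘L H q ∘L Ψ q)) :=
  ((IsPrimitive.const _).add (IsPrimitive.intervalIntegral
    (intervalIntegrable_adjoint_comp_comp hab hΨ hH) (right_mem_Icc.2 hab)).neg).congr hab
      (fun s _ => by rw [gramian, intervalIntegral.integral_symm])
      (.of_forall fun _ => (zero_add _).symm)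

theorem fredholmKernel_smooth_part (hΨ : ContinuousOn Ψ (Icc a b))
    (hH : IntervalIntegrable H volume a b)
    (hΦ : ∀ τ ∈ Icc a b, ∀ s ∈ Icc τ b, Φ s τ = Ψ s ∘L Ξ τ) (hs : s ∈ Icc a b) (hr : r ∈ Icc a b) :
    (B s)† ∘L (Φ b s)† ∘L G ∘L Φ b r ∘L B r
        + (∫ q in (max s r)..b, (B s)† ∘L (Φ q s)† ∘L H q ∘L Φ q r ∘L B r) =
      (B s)† ∘L (Ξ s)† ∘L gramian b Ψ H G (max s r) ∘L Ξ r ∘L B r := by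
  have hab : a ≤ b := hs.1.trans hs.2
  have hm : max s r ∈ Icc a b := ⟨le_max_of_le_left hs.1, max_le hs.2 hr.2⟩
  have hfactor : ∀ q ∈ Icc (max s r) b, ∀ M : E →L[ℝ] E,
      (B s)† ∘L (Φ q s)† ∘L M ∘L Φ q r ∘L B r =
        ((B s)† ∘L (Ξ s)†) ∘L ((Ψ q)† ∘L M ∘L Ψ q) ∘L (Ξ r ∘L B r) := fun q hq M => by
    rw [hΦ s hs q ⟨(le_max_left s r).trans hq.1, hq.2⟩,
      hΦ r hr q ⟨(le_max_right s r).trans hq.1, hq.2⟩, ContinuousLinearMap.adjoint_comp]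
    rfl
  let sandwich : (E →L[ℝ] E) →L[ℝ] (U →L[ℝ] U) :=
    ContinuousLinearMap.compL ℝ U E U ((B s)† ∘L (Ξ s)†)
      ∘L (ContinuousLinearMap.compL ℝ U E E).flip (Ξ r ∘L B r)
  have hint := sandwich.intervalIntegral_comp_comm (intervalIntegrable_of_mem_Icc
    (intervalIntegrable_adjoint_comp_comp hab hΨ hH) hm (right_mem_Icc.2 hab))
  rw [hfactor b (right_mem_Icc.2 hm.2), intervalIntegral.integral_congr fun q hq =>
    hfactor q (by rwa [uIcc_of_le hm.2] at hq) (H q)]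
  exact (congrArg _ hint).trans (map_add sandwich _ _).symm

section
variable (hΨ : ContinuousOn Ψ (Icc a b)) (hH : IntervalIntegrable H volume a b)
  (hΦ : ∀ τ ∈ Icc a b, ∀ s ∈ Icc τ b, Φ s τ = Ψ s ∘L Ξ τ) (hs : s ∈ Icc a b) (hr : r ∈ Icc a b)
include hΨ hH hΦ hs hr

theorem fredholmKernel_of_lt (hrs : r < s) (w : U) :
    fredholmKernel a b B H C G Φ s r w =
      (B s†) ((Ξ s†) (gramian b Ψ H G s (Ξ r (B r w)))) + C s (Ψ s (Ξ r (B r w))) := by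
  rw [fredholmKernel, fredholmKernel_smooth_part hΨ hH hΦ hs hr, max_eq_left hrs.le,
    indicator_of_mem (show r ∈ Icc a s from ⟨hr.1, hrs.le⟩),
    indicator_of_notMem fun h => h.1.not_gt hrs, add_zero, hΦ r hr s ⟨hrs.le, hs.2⟩]
  rfl

theorem fredholmKernel_of_gt (hsr : s < r) (w : U) :
    fredholmKernel a b B H C G Φ s r w =
      (B s†) ((Ξ s†) (gramian b Ψ H G r (Ξ r (B r w)) + (Ψ r†) ((C r†) w))) := by
  rw [fredholmKernel, fredholmKernel_smooth_part hΨ hH hΦ hs hr, max_eq_right hsr.le,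
    indicator_of_notMem fun h => h.2.not_gt hsr, add_zero,
    indicator_of_mem (show r ∈ Icc s b from ⟨hsr.le, hr.2⟩), hΦ s hs r ⟨hsr.le, hr.2⟩,
    ContinuousLinearMap.adjoint_comp, map_add, map_add]
  rfl
end

namespace FundamentalPair

variable (h : FundamentalPair A a b Ψ Ξ) (hH : IntervalIntegrable H volume a b)
  (hΦ : ∀ τ ∈ Icc a b, ∀ s ∈ Icc τ b, Φ s τ = Ψ s ∘L Ξ τ)
  (hζ : IsPrimitive a b ζ (fun r => A r (ζ r) + B r (v r))) (hs : s ∈ Icc a b)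
include h hH hΦ hζ hs

theorem isPrimitive_fredholmKernel_left :
    IsPrimitive a s
      (fun r => (B s†) ((Ξ s†) (gramian b Ψ H G s (Ξ r (ζ r)))) + C s (Ψ s (Ξ r (ζ r))))
      (fun r => fredholmKernel a b B H C G Φ s r (v r)) := by
  have hab : a ≤ b := hs.1.trans hs.2
  refine (((h.isPrimitive_inv_apply hab hζ).mono (left_mem_Icc.2 hab) hs).clm
    ((B s)† ∘L (Ξ s)† ∘L gramian b Ψ H G s + C s ∘L Ψ s)).congr hs.1 (fun _ _ => rfl) ?_
  filter_upwards [ae_restrict_mem measurableSet_Icc, Measure.ae_ne _ s] with r hr hne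
  rw [fredholmKernel_of_lt h.isPrimitive.continuousOn hH hΦ hs ⟨hr.1, hr.2.trans hs.2⟩
    (hr.2.lt_of_ne hne)]
  rfl

theorem isPrimitive_fredholmKernel_right
    (hC : IntervalIntegrable (fun r => (C r†) (v r)) volume a b) :
    IsPrimitive s b (fun r => (B s†) ((Ξ s†) (gramian b Ψ H G r (Ξ r (ζ r))
        + ∫ q in s..r, (Ψ q†) (H q (ζ q) + (C q†) (v q)))))
      (fun r => fredholmKernel a b B H C G Φ s r (v r)) := by
  have hab : a ≤ b := hs.1.trans hs.2
  have hforcing : IntervalIntegrable (fun q => (Ψ q†) (H q (ζ q) + (C q†) (v q))) volume s b :=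
    intervalIntegrable_of_mem_Icc (h.intervalIntegrable_adjoint_apply hab
      ((intervalIntegrable_bilin_left (ContinuousLinearMap.id ℝ (E →L[ℝ] E)) hab hH
        hζ.continuousOn).add hC)) hs (right_mem_Icc.2 hab)
  have hgramian := ((isPrimitive_gramian (G := G) hab h.isPrimitive.continuousOn hH).bilin
    (ContinuousLinearMap.id ℝ (E →L[ℝ] E)) (h.isPrimitive_inv_apply hab hζ) hab).mono hs
      (right_mem_Icc.2 hab)
  refine ((hgramian.add (IsPrimitive.intervalIntegral hforcing (left_mem_Icc.2 hs.2))).clm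
    ((B s)† ∘L (Ξ s)†)).congr hs.2 (fun _ _ => rfl) ?_
  filter_upwards [ae_restrict_mem measurableSet_Icc, Measure.ae_ne _ s] with r hr hne
  have hr' : r ∈ Icc a b := ⟨hs.1.trans hr.1, hr.2⟩
  have hcancel : Ψ r (Ξ r (ζ r)) = ζ r := DFunLike.congr_fun (h.comp_inv r hr') (ζ r)
  rw [fredholmKernel_of_gt h.isPrimitive.continuousOn hH hΦ hs hr' (hr.1.lt_of_ne' hne)]
  simp only [ContinuousLinearMap.comp_apply, ContinuousLinearMap.id_apply, neg_apply, hcancel,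
    map_add, map_neg]
  abel

theorem fredholmKernel_integral (hC : IntervalIntegrable (fun r => (C r†) (v r)) volume a b)
    (hζa : ζ a = 0) :
    IntervalIntegrable (fun r => fredholmKernel a b B H C G Φ s r (v r)) volume a b ∧
    ∫ r in a..b, fredholmKernel a b B H C G Φ s r (v r) = C s (ζ s) +
      (B s†) (adjointSolution b Ψ Ξ (G (ζ b)) (fun r => H r (ζ r) + (C r†) (v r)) s) := by
  have hab : a ≤ b := hs.1.trans hs.2
  have hcancel : ∀ r ∈ Icc a b, Ψ r (Ξ r (ζ r)) = ζ r := fun r hr =>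
    DFunLike.congr_fun (h.comp_inv r hr) (ζ r)
  have hleft := h.isPrimitive_fredholmKernel_left (C := C) (G := G) hH hΦ hζ hs
  have hright := h.isPrimitive_fredholmKernel_right (G := G) hH hΦ hζ hs hC
  refine ⟨hleft.integrable.trans hright.integrable, ?_⟩
  rw [← intervalIntegral.integral_add_adjacent_intervals hleft.integrable hright.integrable,
    ← hleft.sub_eq (left_mem_Icc.2 hs.1) (right_mem_Icc.2 hs.1),
    ← hright.sub_eq (left_mem_Icc.2 hs.2) (right_mem_Icc.2 hs.2), hζa,
    gramian_right_apply, hcancel b (right_mem_Icc.2 hab), hcancel s hs,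
    intervalIntegral.integral_same, adjointSolution]
  simp only [map_zero, add_zero, sub_zero, map_add]
  abel

end FundamentalPair

end Kernel

/-! ### The second variation of a Bolza functional -/

section Integrability

variable {a b : ℝ} {E F G : Type*} [NormedAddCommGroup E] [NormedSpace ℝ E]
  [NormedAddCommGroup F] [NormedSpace ℝ F] [NormedAddCommGroup G] [NormedSpace ℝ G]

theorem memLp_two_bilin_left (L : BilinMap E F G) {f : ℝ → E} {g : ℝ → F}
    (hf : MemLp f 2 (volume.restrict (Icc a b))) (hg : ContinuousOn g (Icc a b)) :
    MemLp (fun r => L (f r) (g r)) 2 (volume.restrict (Icc a b)) :=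
  L.memLp_of_bilin 2 hf (memLp_Icc_of_continuousOn hg ⊤)

theorem intervalIntegrable_bilin_of_memLp_two (L : BilinMap E F G) (hab : a ≤ b) {f : ℝ → E}
    {g : ℝ → F} (hf : MemLp f 2 (volume.restrict (Icc a b)))
    (hg : MemLp g 2 (volume.restrict (Icc a b))) :
    IntervalIntegrable (fun r => L (f r) (g r)) volume a b :=
  (intervalIntegrable_iff_integrableOn_Icc_of_le hab).2
    (memLp_one_iff_integrable.1 (L.memLp_of_bilin 1 hf hg))

theorem intervalIntegrable_clm (L : E →L[ℝ] F) {f : ℝ → E} (hf : IntervalIntegrable f volume a b) :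
    IntervalIntegrable (fun r => L (f r)) volume a b :=
  ⟨L.integrable_comp hf.1, L.integrable_comp hf.2⟩

theorem intervalIntegrable_bilin_projIcc (L : BilinMap E F G) (hab : a ≤ b) {f : ℝ → E}
    (hf : IntervalIntegrable f volume a b) (X : C(Icc a b, F)) :
    IntervalIntegrable (fun r => L (f r) (X (projIcc a b hab r))) volume a b :=
  intervalIntegrable_bilin_left L hab hf (X.continuous.comp continuous_projIcc).continuousOn

theorem intervalIntegrable_clm_add_bilin_control {U W W₁ W₂ F₁ F₂ : Type*}
    [NormedAddCommGroup U] [NormedSpace ℝ U] [NormedAddCommGroup W] [NormedSpace ℝ W]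
    [NormedAddCommGroup W₁] [NormedSpace ℝ W₁] [NormedAddCommGroup W₂] [NormedSpace ℝ W₂]
    [NormedAddCommGroup F₁] [NormedSpace ℝ F₁] [NormedAddCommGroup F₂] [NormedSpace ℝ F₂]
    (M : E →L[ℝ] W) (L₁ : BilinMap W₁ F₁ E) (L₂ : BilinMap W₂ F₂ E) (N₁ : U →L[ℝ] W₁)
    (N₂ : BilinMap U U W₂) (c : ℝ) (hab : a ≤ b) (X₀ : C(Icc a b, E)) (X₁ : C(Icc a b, F₁))
    (X₂ : C(Icc a b, F₂)) (u : L2Icc a b U) :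
    IntervalIntegrable (fun r => M (X₀ (projIcc a b hab r) + L₁ (N₁ (u r)) (X₁ (projIcc a b hab r))
      + L₂ (c • N₂ (u r) (u r)) (X₂ (projIcc a b hab r)))) volume a b :=
  intervalIntegrable_clm M
    ((((X₀.continuous.comp continuous_projIcc).intervalIntegrable a b).add
      (intervalIntegrable_bilin_projIcc L₁ hab
        (intervalIntegrable_clm N₁ (intervalIntegrable_coeFn_Lp hab u)) X₁)).add
      (intervalIntegrable_bilin_projIcc L₂ hab
        ((intervalIntegrable_bilin_of_memLp_two N₂ hab (Lp.memLp u) (Lp.memLp u)).smul c) X₂))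

end Integrability

namespace RunningCost

variable {a b : ℝ} {E U : Type*} [NormedAddCommGroup E] [InnerProductSpace ℝ E] [CompleteSpace E]
  [NormedAddCommGroup U] [InnerProductSpace ℝ U] (hab : a ≤ b) (f : RunningCost (Icc a b) E U)
  (p : L2Icc a b U × C(Icc a b, E))

theorem intervalIntegrable_rieszL_stateDeriv :
    IntervalIntegrable (fun r => rieszL E (f.stateDeriv hab p r)) volume a b := by
  have h := intervalIntegrable_clm_add_bilin_control (rieszL E) (ContinuousLinearMap.compL ℝ E U ℝ)
    (ContinuousLinearMap.compL ℝ E (U →L[ℝ] U) ℝ) (innerSL ℝ) (innerApplyL U) (1 / 2) hab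
    (superpose f.base.deriv p.2) (superpose f.grad.base.deriv p.2)
    (superpose f.grad.slope.deriv p.2) p.1
  unfold stateDeriv
  exact h

theorem intervalIntegrable_rieszL_comp_stateHess :
    IntervalIntegrable (fun r => rieszL E ∘L f.stateHess hab p r) volume a b := by
  have h := intervalIntegrable_clm_add_bilin_control
    (ContinuousLinearMap.compL ℝ E (E →L[ℝ] ℝ) E (rieszL E)) (postL E U) (postL E (U →L[ℝ] U))
    (innerSL ℝ) (innerApplyL U) (1 / 2) hab (superpose f.base.deriv₂ p.2)
    (superpose f.grad.base.deriv₂ p.2) (superpose f.grad.slope.deriv₂ p.2) p.1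
  unfold stateHess
  exact h

end RunningCost

theorem ae_eq_of_hasIntervalIntegral_inner {a b : ℝ} {U : Type*} [NormedAddCommGroup U]
    [InnerProductSpace ℝ U] (hab : a ≤ b) {x : L2Icc a b U} {D : ℝ → U}
    (hD : MemLp D 2 (volume.restrict (Icc a b)))
    (h : ∀ w : L2Icc a b U, HasIntervalIntegral a b (fun r => inner ℝ (D r) (w r)) (inner ℝ x w)) :
    x =ᵐ[volume.restrict (Icc a b)] D := by
  suffices x = hD.toLp D from this ▸ hD.coeFn_toLp
  refine ext_inner_right ℝ fun w => (h w).unique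
    ((hasIntervalIntegral_inner hab (hD.toLp D) w).congr hab ?_)
  filter_upwards [hD.coeFn_toLp] with r hr
  rw [hr]

theorem RunningCost.hess_bolza_ae_eq {a b : ℝ} {E U : Type*} [NormedAddCommGroup E]
    [InnerProductSpace ℝ E] [CompleteSpace E] [NormedAddCommGroup U] [InnerProductSpace ℝ U]
    [CompleteSpace U] {hab : a ≤ b} {f : RunningCost (Icc a b) E U}
    {σ : ControlAffine (Icc a b) E U E} {g : E → ℝ} {x : E} {Z : L2Icc a b U → C(Icc a b, E)}
    {u : L2Icc a b U} {Y : C(Icc a b, E)} {Y' : ℝ → E} (hZ : σ.IsSolutionMap hab x Z)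
    (hg : ContDiff ℝ 2 g) (hY : f.IsCostate hab σ g (u, Z u) Y Y') {v : L2Icc a b U} {l l' : ℝ → E}
    (hl : (f.hamiltonian σ Y).IsCostateVariation hab σ g (u, Z u) (v, fderiv ℝ Z u v) l l') :
    hess (fun u => f.bolza hab (u, Z u) g) u v =ᵐ[volume.restrict (Icc a b)] fun r =>
      f.grad.slope.fn (graphPt hab (Z u) r) (v r)
        + ((f.hamiltonian σ Y).grad.jacobian hab (u, Z u) r (fderiv ℝ Z u v (projIcc a b hab r))
          + (σ.slope.fn (graphPt hab (Z u) r)†) (l r)) := by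
  refine ae_eq_of_hasIntervalIntegral_inner hab ?_
    (inner_hess_bolza_of_costateVariation hZ hg hY hl)
  have hslope : MemLp (fun r => f.grad.slope.fn (graphPt hab (Z u) r) (v r)) 2
      (volume.restrict (Icc a b)) :=
    (memLp_congr_ae (coeFn_mulLp hab (superpose f.grad.slope.fn (Z u)) v)).1 (Lp.memLp _)
  have hjac := memLp_two_bilin_left (ContinuousLinearMap.id ℝ (E →L[ℝ] U))
    ((f.hamiltonian σ Y).grad.memLp_jacobian hab (u, Z u))
    ((fderiv ℝ Z u v).continuous.comp (continuous_projIcc (h := hab))).continuousOn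
  have hadj := memLp_two_bilin_left (F := U →L[ℝ] E) (adjointApplyL U E)
    (memLp_Icc_of_continuousOn hl.isPrimitive.continuousOn 2)
    ((superpose σ.slope.fn (Z u)).continuous.comp (continuous_projIcc (h := hab))).continuousOn
  simp only [Function.comp_apply, adjointApplyL_apply] at hadj
  exact hslope.add (hjac.add hadj)

namespace SmoothCoeff

variable {K : Type*} [TopologicalSpace K] {H F : Type*} [NormedAddCommGroup H]
  [InnerProductSpace ℝ H] [CompleteSpace H] [NormedAddCommGroup F] [NormedSpace ℝ F]
  (c : SmoothCoeff K H F) (φ : F →L[ℝ] ℝ) (s : K) (y : H)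

theorem gradient_clm_fn :
    gradient (fun y => φ (c.fn (s, y))) y = rieszL H (φ ∘L c.deriv (s, y)) := by
  have h : HasFDerivAt (fun y => φ (c.fn (s, y))) (φ ∘L c.deriv (s, y)) y :=
    φ.hasFDerivAt.comp y (c.hasFDerivAt_fn s y)
  rw [gradient_eq_rieszL_fderiv]
  exact congrArg (rieszL H) h.fderiv

theorem hess_clm_fn :
    hess (fun y => φ (c.fn (s, y))) y = rieszL H ∘L postL H F φ (c.deriv₂ (s, y)) := by
  rw [hess, funext (c.gradient_clm_fn φ s)]
  exact ((rieszL H ∘L ContinuousLinearMap.compL ℝ H F ℝ φ).hasFDerivAt.comp y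
    (c.hasFDerivAt_deriv s y)).fderiv

end SmoothCoeff

section Identification

variable {a b : ℝ} {E U F : Type*} [NormedAddCommGroup E] [NormedSpace ℝ E]
  [NormedAddCommGroup U] [InnerProductSpace ℝ U] [NormedAddCommGroup F] [NormedSpace ℝ F]

theorem ControlAffine.jacobian_coe (hab : a ≤ b) (σ : ControlAffine (Icc a b) E U F)
    (p : L2Icc a b U × C(Icc a b, E)) (s : Icc a b) :
    σ.jacobian hab p s = fderiv ℝ (fun y => σ.base.fn (s, y)) (p.2 s)
      + fderiv ℝ (fun y => σ.slope.fn (s, y) (p.1 s)) (p.2 s) := by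
  have hslope : HasFDerivAt (fun y => σ.slope.fn (s, y) (p.1 s)) _ (p.2 s) :=
    (σ.slope.hasFDerivAt_fn s (p.2 s)).clm_apply (hasFDerivAt_const (p.1 s) (p.2 s))
  ext e
  rw [hslope.fderiv, (σ.base.hasFDerivAt_fn s (p.2 s)).fderiv, jacobian_apply]
  simp [graphPt]

end Identification

namespace RunningCost

variable {a b : ℝ} {E U : Type*} [NormedAddCommGroup E] [InnerProductSpace ℝ E] [CompleteSpace E]
  [NormedAddCommGroup U] [InnerProductSpace ℝ U] [CompleteSpace U] {hab : a ≤ b}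
  (f : RunningCost (Icc a b) E U) (σ : ControlAffine (Icc a b) E U E) (Y : C(Icc a b, E))
  (p : L2Icc a b U × C(Icc a b, E)) (s : Icc a b)

theorem rieszL_stateDeriv_coe : rieszL E (f.stateDeriv hab p s) =
    gradient (fun y => f.base.fn (s, y)) (p.2 s)
      + (fderiv ℝ (fun y => f.grad.base.fn (s, y)) (p.2 s)†) (p.1 s)
      + (1 / 2 : ℝ) • gradient (fun y => inner ℝ (f.grad.slope.fn (s, y) (p.1 s)) (p.1 s))
        (p.2 s) := by
  have hbase := f.base.gradient_clm_fn (.id ℝ ℝ) s (p.2 s)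
  have hslope := f.grad.slope.gradient_clm_fn (innerApplyL U (p.1 s) (p.1 s)) s (p.2 s)
  simp only [innerApplyL_apply, ContinuousLinearMap.id_apply] at hbase hslope
  simp only [real_inner_comm (p.1 s)]
  rw [hbase, hslope, (f.grad.base.hasFDerivAt_fn s (p.2 s)).fderiv, ← adjointApplyL_apply,
    stateDeriv, graphPt, projIcc_val, map_add, map_add, ContinuousLinearMap.smul_comp, map_smul]
  rfl

theorem rieszL_hamiltonian_stateDeriv (r : ℝ) :
    rieszL E ((f.hamiltonian σ Y).stateDeriv hab p r) =
      rieszL E (f.stateDeriv hab p r) + (σ.jacobian hab p r†) (Y (projIcc a b hab r)) := by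
  refine ext_inner_right ℝ fun e => ?_
  simp only [inner_rieszL, inner_add_left, ContinuousLinearMap.adjoint_inner_left,
    ControlAffine.jacobian_apply, inner_add_right, stateDeriv, hamiltonian, SmoothCoeff.add,
    SmoothCoeff.timeComp, ContinuousMap.add_apply, ContinuousMap.coe_mk, add_apply,
    ContinuousLinearMap.comp_apply, innerSL_apply_apply, adjointApplyL_apply,
    ContinuousLinearMap.adjoint_inner_right]
  rw [real_inner_comm (Y (projIcc a b hab r)) (σ.slope.deriv (graphPt hab p.2 r) e (p.1 r))]
  ring

theorem hamiltonian_grad_jacobian_coe : (f.hamiltonian σ Y).grad.jacobian hab p s =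
    fderiv ℝ (fun y => f.grad.slope.fn (s, y) (p.1 s)) (p.2 s)
      + fderiv ℝ (fun y => f.grad.base.fn (s, y)) (p.2 s)
      + fderiv ℝ (fun y => (σ.slope.fn (s, y)†) (Y s)) (p.2 s) := by
  have hadjoint := (adjointApplyL U E (Y s)).hasFDerivAt.comp (p.2 s)
    (σ.slope.hasFDerivAt_fn s (p.2 s))
  have hbase : HasFDerivAt (fun y => (f.hamiltonian σ Y).grad.base.fn (s, y)) _ (p.2 s) :=
    (f.grad.base.hasFDerivAt_fn s (p.2 s)).add hadjoint
  simp only [← adjointApplyL_apply]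
  rw [ControlAffine.jacobian_coe, hbase.fderiv, (f.grad.base.hasFDerivAt_fn s (p.2 s)).fderiv,
    add_comm, ← add_assoc]
  exact congrArg _ hadjoint.fderiv.symm

theorem rieszL_comp_hamiltonian_stateHess_coe :
    rieszL E ∘L (f.hamiltonian σ Y).stateHess hab p s =
      hess (fun y => inner ℝ (Y s) (σ.base.fn (s, y))) (p.2 s)
        + hess (fun y => f.base.fn (s, y)) (p.2 s)
        + (1 / 2 : ℝ) • hess (fun y => inner ℝ (f.grad.slope.fn (s, y) (p.1 s)) (p.1 s)) (p.2 s)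
        + hess (fun y => inner ℝ (Y s) (σ.slope.fn (s, y) (p.1 s))) (p.2 s)
        + hess (fun y => inner ℝ (f.grad.base.fn (s, y)) (p.1 s)) (p.2 s) := by
  have hdynBase := σ.base.hess_clm_fn (innerSL ℝ (Y s)) s (p.2 s)
  have hbase := f.base.hess_clm_fn (.id ℝ ℝ) s (p.2 s)
  have hslope := f.grad.slope.hess_clm_fn (innerApplyL U (p.1 s) (p.1 s)) s (p.2 s)
  have hdynSlope := σ.slope.hess_clm_fn (innerSL ℝ (p.1 s) ∘L adjointApplyL U E (Y s)) s (p.2 s)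
  have hgrad := f.grad.base.hess_clm_fn (innerSL ℝ (p.1 s)) s (p.2 s)
  simp only [innerApplyL_apply, ContinuousLinearMap.id_apply, innerSL_apply_apply,
    ContinuousLinearMap.comp_apply, adjointApplyL_apply, ContinuousLinearMap.adjoint_inner_right]
    at hdynBase hbase hslope hdynSlope hgrad
  simp only [real_inner_comm (Y s)] at hdynSlope
  simp only [real_inner_comm (p.1 s)]
  rw [hdynBase, hbase, hslope, hdynSlope, hgrad]
  refine ContinuousLinearMap.ext fun e => ext_inner_right ℝ fun e' => ?_
  simp only [add_apply, smul_apply, ContinuousLinearMap.comp_apply, inner_add_left,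
    real_inner_smul_left, inner_rieszL, stateHess, hamiltonian, SmoothCoeff.add,
    SmoothCoeff.timeComp, ContinuousMap.add_apply, ContinuousMap.coe_mk, graphPt, projIcc_val,
    map_add, map_smul, postL_apply, ContinuousLinearMap.compL_apply,
    ContinuousLinearMap.id_apply]
  ring

end RunningCost

namespace RunningCost

variable {a b : ℝ} {E U : Type*} [NormedAddCommGroup E] [InnerProductSpace ℝ E] [CompleteSpace E]
  [NormedAddCommGroup U] [InnerProductSpace ℝ U] {hab : a ≤ b}
  {f : RunningCost (Icc a b) E U} {σ : ControlAffine (Icc a b) E U E} {g : E → ℝ}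

variable (hab f σ) in
/-- The right-hand side of the adjoint equation `y' = -𝐀(r)† y - f_x(r)`. -/
noncomputable def adjointField (p : L2Icc a b U × C(Icc a b, E)) (r : ℝ) (y : E) : E :=
  -((σ.jacobian hab p r†) y) - rieszL E (f.stateDeriv hab p r)

theorem exists_solvesODE_adjointField [FiniteDimensional ℝ E] (p : L2Icc a b U × C(Icc a b, E))
    (e : E) : ∃ Y, SolvesODE (f.adjointField hab σ p) a b b e Y := by
  obtain ⟨Ψ, Ξ, h⟩ := exists_fundamentalPair hab (σ.memLp_jacobian hab p)
  have hY := (h.isPrimitive_adjointSolution (e := e) hab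
    (f.intervalIntegrable_rieszL_stateDeriv hab p)).solvesODE (f := f.adjointField hab σ p)
    (right_mem_Icc.2 hab) (.of_forall fun r => rfl)
  exact ⟨_, h.adjointSolution_right hab (e := e) ▸ hY⟩

variable [CompleteSpace U]

theorem IsCostate.of_solvesODE {p : L2Icc a b U × C(Icc a b, E)} {Y : C(Icc a b, E)}
    (hY : SolvesODE (f.adjointField hab σ p) a b b (gradient g (p.2 ⟨b, right_mem_Icc.2 hab⟩))
      (fun r => Y (projIcc a b hab r))) :
    f.IsCostate hab σ g p Y (fun r => f.adjointField hab σ p r (Y (projIcc a b hab r))) where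
  isPrimitive := hY.isPrimitive (right_mem_Icc.2 hab)
  inner_deriv := .of_forall fun r e => by
    rw [← inner_rieszL ((f.hamiltonian σ Y).stateDeriv hab p r), rieszL_hamiltonian_stateDeriv,
      ← inner_neg_left, adjointField, neg_add', sub_eq_add_neg, sub_eq_add_neg, add_comm]
  inner_right e := by
    have hb := hY.initial (right_mem_Icc.2 hab)
    rw [projIcc_of_mem hab (right_mem_Icc.2 hab)] at hb
    rw [hb, inner_gradient]

theorem exists_isCostateVariation_adjointSolution {p : L2Icc a b U × C(Icc a b, E)}
    (q : L2Icc a b U × C(Icc a b, E)) (hg : ContDiff ℝ 2 g) {Ψ Ξ : ℝ → E →L[ℝ] E}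
    (h : FundamentalPair (σ.jacobian hab p) a b Ψ Ξ) :
    ∃ l', f.IsCostateVariation hab σ g p q (adjointSolution b Ψ Ξ
      (hess g (p.2 ⟨b, right_mem_Icc.2 hab⟩) (q.2 ⟨b, right_mem_Icc.2 hab⟩))
      (fun r => (rieszL E ∘L f.stateHess hab p r) (q.2 (projIcc a b hab r))
        + (f.grad.jacobian hab p r†) (q.1 r))) l' := by
  have hstate := intervalIntegrable_bilin_projIcc (ContinuousLinearMap.id ℝ (E →L[ℝ] E)) hab
    (f.intervalIntegrable_rieszL_comp_stateHess hab p) q.2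
  have hcontrol := intervalIntegrable_bilin_of_memLp_two (adjointApplyL E U) hab (Lp.memLp q.1)
    (f.grad.memLp_jacobian hab p)
  simp only [adjointApplyL_apply] at hcontrol
  refine ⟨_, h.isPrimitive_adjointSolution hab (hstate.add hcontrol), .of_forall fun r e => ?_,
    fun e => ?_⟩
  · simp only [inner_sub_left, inner_neg_left, inner_add_left, ContinuousLinearMap.comp_apply,
      ContinuousLinearMap.adjoint_inner_left, inner_rieszL]
    ring
  · rw [h.adjointSolution_right hab, inner_hess (differentiable_fderiv_of_contDiff_two hg _)]

variable (hab f σ g) in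
/-- The kernel of the second variation along the pair `p` of a control and a trajectory, with
fundamental matrix `Φ`. Here `f` stands for the Hamiltonian. -/
noncomputable def variationKernel (p : L2Icc a b U × C(Icc a b, E)) (Φ : ℝ → ℝ → (E →L[ℝ] E)) :
    ℝ → ℝ → (U →L[ℝ] U) :=
  fredholmKernel a b (fun s => σ.slope.fn (graphPt hab p.2 s))
    (fun s => rieszL E ∘L f.stateHess hab p s) (f.grad.jacobian hab p)
    (hess g (p.2 ⟨b, right_mem_Icc.2 hab⟩)) Φ

theorem hess_bolza_ae_eq_fredholm [FiniteDimensional ℝ E] {x : E}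
    {Z : L2Icc a b U → C(Icc a b, E)} {u : L2Icc a b U} {Y : C(Icc a b, E)} {Y' : ℝ → E}
    (hZ : σ.IsSolutionMap hab x Z) (hg : ContDiff ℝ 2 g)
    (hY : f.IsCostate hab σ g (u, Z u) Y Y') {Φ : ℝ → ℝ → (E →L[ℝ] E)}
    (hΦ : ∀ τ ∈ Icc a b, SolvesODE (fun s M => σ.jacobian hab (u, Z u) s ∘L M) τ b τ
      (ContinuousLinearMap.id ℝ E) (fun s => Φ s τ)) (v : L2Icc a b U) :
    ∀ᵐ s ∂volume.restrict (Icc a b),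
      IntervalIntegrable
        (fun r => (f.hamiltonian σ Y).variationKernel hab σ g (u, Z u) Φ s r (v r)) volume a b ∧
      hess (fun u => f.bolza hab (u, Z u) g) u v s =
        f.grad.slope.fn (graphPt hab (Z u) s) (v s)
          + ∫ r in a..b, (f.hamiltonian σ Y).variationKernel hab σ g (u, Z u) Φ s r (v r) := by
  have hjac := σ.memLp_jacobian hab (u, Z u)
  obtain ⟨Ψ, Ξ, hΨ⟩ := exists_fundamentalPair hab hjac
  obtain ⟨_, hl⟩ := exists_isCostateVariation_adjointSolution (f := f.hamiltonian σ Y)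
    (v, fderiv ℝ Z u v) hg hΨ
  have hC : IntervalIntegrable
      (fun r => ((f.hamiltonian σ Y).grad.jacobian hab (u, Z u) r†) (v r)) volume a b := by
    simpa only [adjointApplyL_apply] using intervalIntegrable_bilin_of_memLp_two
      (adjointApplyL E U) hab (Lp.memLp v) ((f.hamiltonian σ Y).grad.memLp_jacobian hab (u, Z u))
  have hζa : fderiv ℝ Z u v (projIcc a b hab a) = 0 := by
    rw [projIcc_of_mem hab (left_mem_Icc.2 hab), hZ.fderiv_left]
  filter_upwards [hess_bolza_ae_eq hZ hg hY hl, ae_restrict_mem measurableSet_Icc] with s hs hmem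
  obtain ⟨hint, heq⟩ := hΨ.fredholmKernel_integral
    (G := hess g (Z u ⟨b, right_mem_Icc.2 hab⟩))
    ((f.hamiltonian σ Y).intervalIntegrable_rieszL_comp_stateHess hab (u, Z u))
    (fun τ hτ s hs => hΨ.eq_of_solvesODE hjac hτ (hΦ τ hτ) hs)
    (hZ.isPrimitive_fderiv u v) hmem hC hζa
  refine ⟨hint, ?_⟩
  rw [hs, variationKernel, heq, projIcc_of_mem hab (right_mem_Icc.2 hab)]

end RunningCost

/-! ### Affine-quadratic control problems -/

section PartialDerivative

theorem continuous_section {E F : Type*} [TopologicalSpace E] [TopologicalSpace F] {I J : Set ℝ}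
    {f : ℝ → E → F} (hJI : J ⊆ I)
    (hf : ContinuousOn (Function.uncurry f) (I ×ˢ univ)) :
    Continuous fun p : J × E => f p.1 p.2 :=
  hf.comp_continuous (f := fun p : J × E => ((p.1 : ℝ), p.2)) (by fun_prop)
    fun p => ⟨hJI p.1.2, mem_univ _⟩

variable {E F : Type*} [NormedAddCommGroup E] [NormedSpace ℝ E] [NormedAddCommGroup F]
  [NormedSpace ℝ F] {I J : Set ℝ} {f : ℝ → E → F}

theorem hasFDerivAt_section (hf : DifferentiableOn ℝ (Function.uncurry f) (I ×ˢ univ)) {s : ℝ}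
    (hs : s ∈ I) (y : E) :
    HasFDerivAt (f s)
      (fderivWithin ℝ (Function.uncurry f) (I ×ˢ univ) (s, y) ∘L .inr ℝ ℝ E) y := by
  have hslice : HasFDerivWithinAt (fun y : E => (s, y)) (.inr ℝ ℝ E) univ y :=
    (hasFDerivAt_prodMk_right s y).hasFDerivWithinAt
  exact hasFDerivWithinAt_univ.1 ((hf (s, y) ⟨hs, mem_univ y⟩).hasFDerivWithinAt.comp y hslice
    fun z _ => ⟨hs, mem_univ z⟩)

theorem contDiffOn_fderiv_section (hI : UniqueDiffOn ℝ I) {k l : WithTop ℕ∞} (hkl : l + 1 ≤ k)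
    (hf : ContDiffOn ℝ k (Function.uncurry f) (I ×ˢ univ)) :
    ContDiffOn ℝ l (Function.uncurry fun s y => fderiv ℝ (f s) y) (I ×ˢ univ) := by
  have hk : k ≠ 0 := fun h => by simp [h] at hkl
  have hf' := hf.fderivWithin (hI.prod uniqueDiffOn_univ) hkl
  exact (hf'.clm_comp contDiffOn_const).congr fun p hp =>
    (hasFDerivAt_section (hf.differentiableOn hk) hp.1 p.2).fderiv

/-- The restriction to times in `J` of a function which is jointly twice continuously differentiable
up to the boundary of `I ⊇ J`, together with its derivatives in the state. -/
noncomputable def SmoothCoeff.ofContDiffOn (hI : UniqueDiffOn ℝ I) (hJI : J ⊆ I)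
    (hf : ContDiffOn ℝ 2 (Function.uncurry f) (I ×ˢ univ)) : SmoothCoeff J E F :=
  have hf' := contDiffOn_fderiv_section (l := 1) hI one_add_one_eq_two.le hf
  have hf'' := contDiffOn_fderiv_section (l := 0) hI (zero_add 1).le hf'
  { fn := ⟨fun p => f p.1 p.2, continuous_section hJI hf.continuousOn⟩
    deriv := ⟨fun p => fderiv ℝ (f p.1) p.2, continuous_section hJI hf'.continuousOn⟩
    deriv₂ := ⟨fun p => fderiv ℝ (fderiv ℝ (f p.1)) p.2,
      continuous_section hJI hf''.continuousOn⟩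
    hasFDerivAt_fn := fun s y => (hasFDerivAt_section (hf.differentiableOn two_ne_zero)
      (hJI s.2) y).differentiableAt.hasFDerivAt
    hasFDerivAt_deriv := fun s y => (hasFDerivAt_section (f := fun s y => fderiv ℝ (f s) y)
      (hf'.differentiableOn one_ne_zero) (hJI s.2) y).differentiableAt.hasFDerivAt }

end PartialDerivative

namespace AQProblem

variable {n m : ℕ} {P : AQProblem n m} {t : ℝ}

/-- The dynamics `A + B u` of the problem on `[t, T]`. -/
noncomputable def dynamics (hT : 0 < P.T) (ht : t ∈ Icc 0 P.T) (h3 : P.H3) :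
    ControlAffine (Icc t P.T) (Euc n) (Euc m) (Euc n) where
  base := .ofContDiffOn (uniqueDiffOn_Icc hT) (Icc_subset_Icc_left ht.1) h3.smoothA
  slope := .ofContDiffOn (uniqueDiffOn_Icc hT) (Icc_subset_Icc_left ht.1) h3.smoothB

/-- The running cost `Q + ⟨S, u⟩ + ½⟨R u, u⟩` of the problem on `[t, T]`. -/
noncomputable def runningCost (hT : 0 < P.T) (ht : t ∈ Icc 0 P.T) (h3 : P.H3)
    (hR : ∀ s ∈ Icc 0 P.T, ∀ x, IsSelfAdjoint (P.R s x)) :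
    RunningCost (Icc t P.T) (Euc n) (Euc m) where
  base := .ofContDiffOn (uniqueDiffOn_Icc hT) (Icc_subset_Icc_left ht.1) h3.smoothQ
  grad :=
    { base := .ofContDiffOn (uniqueDiffOn_Icc hT) (Icc_subset_Icc_left ht.1) h3.smoothS
      slope := .ofContDiffOn (uniqueDiffOn_Icc hT) (Icc_subset_Icc_left ht.1) h3.smoothR }
  inner_slope_comm p := (hR p.1 (Icc_subset_Icc_left ht.1 p.1.2) p.2).isSymmetric

section Dynamics

variable (hT : 0 < P.T) (ht : t ∈ Icc 0 P.T) (h3 : P.H3) {x : Euc n} {u : Control m t P.T}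
  {Z : Control m t P.T → C(Icc t P.T, Euc n)} {X : ℝ → Euc n}

theorem stateField_dynamics {r : ℝ} (hr : r ∈ Icc t P.T) (z : Euc n) :
    (dynamics hT ht h3).stateField ht.2 u r z = P.A r z + P.B r z (u r) := by
  rw [ControlAffine.stateField, projIcc_of_mem ht.2 hr]
  rfl

theorem exists_isSolutionMap_dynamics {LA LB : ℝ}
    (hA : ∀ s ∈ Icc 0 P.T, ∀ y z, ‖P.A s y - P.A s z‖ ≤ LA * ‖y - z‖)
    (hB : ∀ s ∈ Icc 0 P.T, ∀ y z, ‖P.B s y - P.B s z‖ ≤ LB * ‖y - z‖) :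
    ∃ Z, (dynamics hT ht h3).IsSolutionMap ht.2 x Z :=
  ControlAffine.exists_isSolutionMap ht.2 _ x
    (fun s => hA s (Icc_subset_Icc_left ht.1 s.2)) (fun s => hB s (Icc_subset_Icc_left ht.1 s.2))

variable {hT ht h3}

theorem isState_of_isSolutionMap (hZ : (dynamics hT ht h3).IsSolutionMap ht.2 x Z) :
    P.IsState t x u fun r => Z u (projIcc t P.T ht.2 r) :=
  (hZ.solvesODE u).congr (left_mem_Icc.2 ht.2) (fun _ _ => rfl)
    fun _ hr => (stateField_dynamics hT ht h3 hr _).symm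

theorem IsState.eq_solutionMap (hX : P.IsState t x u X)
    (hZ : (dynamics hT ht h3).IsSolutionMap ht.2 x Z) (s : Icc t P.T) : X s = Z u s :=
  hZ.eq_of_solvesODE (hX.congr (left_mem_Icc.2 ht.2) (fun _ _ => rfl)
    fun _ hr => stateField_dynamics hT ht h3 hr _) s

theorem cost_eq_bolza (hR : ∀ s ∈ Icc 0 P.T, ∀ x, IsSelfAdjoint (P.R s x))
    (hZ : (dynamics hT ht h3).IsSolutionMap ht.2 x Z) :
    P.cost t x = fun u => (runningCost hT ht h3 hR).bolza ht.2 (u, Z u) P.G := by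
  funext u
  have hX : P.IsState t x u (P.state t x u) :=
    Classical.epsilon_spec ⟨_, isState_of_isSolutionMap hZ⟩
  have hstate : ∀ s : Icc t P.T, P.state t x u s = Z u s := hX.eq_solutionMap hZ
  have hend : P.state t x u P.T = Z u ⟨P.T, right_mem_Icc.2 ht.2⟩ := hstate ⟨P.T, _⟩
  have hint := ((runningCost hT ht h3 hR).hasIntervalIntegral_bolza
    (hab := ht.2) (g := P.G) (u, Z u)).integral_eq
  rw [cost, hend, ← eq_sub_iff_add_eq, ← hint]
  refine intervalIntegral.integral_congr fun r hr => ?_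
  rw [uIcc_of_le ht.2] at hr
  dsimp only
  rw [hstate ⟨r, hr⟩, graphPt, projIcc_of_mem ht.2 hr]
  rfl

theorem contDiff_cost (hR : ∀ s ∈ Icc 0 P.T, ∀ x, IsSelfAdjoint (P.R s x))
    (hZ : (dynamics hT ht h3).IsSolutionMap ht.2 x Z) : ContDiff ℝ 2 (P.cost t x) := by
  rw [cost_eq_bolza hR hZ]
  exact RunningCost.contDiff_bolza_comp hZ h3.smoothG

end Dynamics

section Trajectory

variable (hT : 0 < P.T) (ht : t ∈ Icc 0 P.T) (h3 : P.H3)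
  (hR : ∀ s ∈ Icc 0 P.T, ∀ x, IsSelfAdjoint (P.R s x))
  {u : Control m t P.T} {X Y : ℝ → Euc n} {W V : C(Icc t P.T, Euc n)}

theorem bA_eq_jacobian (hX : ∀ s : Icc t P.T, X s = W s) (s : Icc t P.T) :
    P.bA u X s = (dynamics hT ht h3).jacobian ht.2 (u, W) s := by
  rw [bA, hX, ControlAffine.jacobian_coe]
  rfl

theorem bC_eq_jacobian (hX : ∀ s : Icc t P.T, X s = W s) (hY : ∀ s : Icc t P.T, Y s = V s)
    (s : Icc t P.T) : P.bC u X Y s = ((runningCost hT ht h3 hR).hamiltonian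
      (dynamics hT ht h3) V).grad.jacobian ht.2 (u, W) s := by
  rw [bC, hX, hY, RunningCost.hamiltonian_grad_jacobian_coe]
  rfl

theorem bA₁_eq_stateHess (hX : ∀ s : Icc t P.T, X s = W s) (hY : ∀ s : Icc t P.T, Y s = V s)
    (s : Icc t P.T) : P.bA₁ u X Y s = rieszL (Euc n) ∘L
      ((runningCost hT ht h3 hR).hamiltonian (dynamics hT ht h3) V).stateHess ht.2 (u, W) s := by
  rw [bA₁, hX, hY, RunningCost.rieszL_comp_hamiltonian_stateHess_coe]
  rfl

theorem bF_eq_variationKernel (hX : ∀ s : Icc t P.T, X s = W s)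
    (hY : ∀ s : Icc t P.T, Y s = V s) (Φ : ℝ → ℝ → (Euc n →L[ℝ] Euc n)) (s r : Icc t P.T) :
    P.bF t u X Y Φ s r =
      ((runningCost hT ht h3 hR).hamiltonian (dynamics hT ht h3) V).variationKernel ht.2
        (dynamics hT ht h3) P.G (u, W) Φ s r := by
  have hB : EqOn (fun s => P.B s (X s))
      (fun s => (dynamics hT ht h3).slope.fn (graphPt ht.2 W s)) (Icc t P.T) := fun s hs => by
    dsimp only
    rw [graphPt, projIcc_of_mem ht.2 hs, hX ⟨s, hs⟩]
    rfl
  rw [RunningCost.variationKernel, ← hX ⟨P.T, right_mem_Icc.2 ht.2⟩]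
  change fredholmKernel t P.T (fun s => P.B s (X s)) (P.bA₁ u X Y) (P.bC u X Y)
    (hess P.G (X P.T)) Φ s r = _
  exact fredholmKernel_congr hB (fun s hs => bA₁_eq_stateHess hT ht h3 hR hX hY ⟨s, hs⟩)
    (fun s hs => bC_eq_jacobian hT ht h3 hR hX hY ⟨s, hs⟩) s.2 r.2

theorem adjointField_runningCost (hX : ∀ s : Icc t P.T, X s = W s) (s : Icc t P.T) (p : Euc n) :
    (runningCost hT ht h3 hR).adjointField ht.2 (dynamics hT ht h3) (u, W) s p =
      -(((P.bA u X s)†) p) - gradient (P.Q s) (X s) - ((fderiv ℝ (P.S s) (X s))†) (u s)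
        - (1 / 2 : ℝ) • gradient (fun y => inner ℝ (P.R s y (u s)) (u s)) (X s) := by
  rw [RunningCost.adjointField, ← bA_eq_jacobian hT ht h3 hX, RunningCost.rieszL_stateDeriv_coe,
    hX, sub_sub, sub_sub, ← add_assoc]
  rfl

include hT ht h3 hR in
theorem exists_isAdjointState (hX : ∀ s : Icc t P.T, X s = W s) :
    ∃ Y, P.IsAdjointState t u X Y := by
  obtain ⟨Y, hY⟩ := (runningCost hT ht h3 hR).exists_solvesODE_adjointField
    (hab := ht.2) (σ := dynamics hT ht h3) (u, W) (gradient P.G (X P.T))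
  exact ⟨Y, hY.congr (right_mem_Icc.2 ht.2) (fun _ _ => rfl)
    fun r hr => (adjointField_runningCost hT ht h3 hR hX ⟨r, hr⟩ (Y r)).symm⟩

include hT ht h3 in
theorem exists_isFundamental (hX : ∀ s : Icc t P.T, X s = W s) : ∃ Φ, P.IsFundamental t u X Φ := by
  have hsol : ∀ τ, ∃ M, τ ∈ Icc t P.T → SolvesODE (fun s M => P.bA u X s ∘L M) τ P.T τ
      (ContinuousLinearMap.id ℝ (Euc n)) M := by
    intro τ
    by_cases hτ : τ ∈ Icc t P.T
    · have hjac := ((dynamics hT ht h3).memLp_jacobian ht.2 (u, W)).mono_measure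
        (Measure.restrict_mono (Icc_subset_Icc_left hτ.1) le_rfl)
      obtain ⟨M, hM⟩ := (lipschitzField_comp hτ.2 hjac).exists_solvesODE (left_mem_Icc.2 hτ.2)
        (ContinuousLinearMap.id ℝ (Euc n))
      exact ⟨M, fun _ => hM.congr (left_mem_Icc.2 hτ.2) (fun _ _ => rfl) fun r hr => by
        rw [bA_eq_jacobian hT ht h3 hX ⟨r, hτ.1.trans hr.1, hr.2⟩]⟩
    · exact ⟨0, fun h => absurd h hτ⟩
  choose M hM using hsol
  exact ⟨fun s τ => M τ s, hM⟩

theorem IsAdjointState.isCostate (hY : P.IsAdjointState t u X Y)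
    (hX : ∀ s : Icc t P.T, X s = W s) :
    ∃ V : C(Icc t P.T, Euc n), (∀ s : Icc t P.T, Y s = V s) ∧
      ∃ V', (runningCost hT ht h3 hR).IsCostate ht.2 (dynamics hT ht h3) P.G (u, W) V V' := by
  have hTT := right_mem_Icc.2 ht.2
  have hsol := (hY.congr hTT (fun _ _ => rfl) fun r hr =>
    adjointField_runningCost hT ht h3 hR hX ⟨r, hr⟩ (Y r)).comp_projIcc hTT ht.2
  rw [hX ⟨P.T, hTT⟩] at hsol
  exact ⟨⟨_, hY.continuousOn.domRestrict⟩, fun _ => rfl, _,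
    RunningCost.IsCostate.of_solvesODE hsol⟩

end Trajectory

theorem hess_cost_ae_eq (hT : 0 < P.T) (ht : t ∈ Icc 0 P.T) (h3 : P.H3)
    (hR : ∀ s ∈ Icc 0 P.T, ∀ x, IsSelfAdjoint (P.R s x)) {x : Euc n}
    {Z : Control m t P.T → C(Icc t P.T, Euc n)}
    (hZ : (dynamics hT ht h3).IsSolutionMap ht.2 x Z) {u : Control m t P.T} {X Y : ℝ → Euc n}
    {Φ : ℝ → ℝ → (Euc n →L[ℝ] Euc n)} (hX : P.IsState t x u X) (hY : P.IsAdjointState t u X Y)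
    (hΦ : P.IsFundamental t u X Φ) (v : Control m t P.T) :
    ∀ᵐ s ∂volume.restrict (Icc t P.T),
      IntervalIntegrable (fun r => P.bF t u X Y Φ s r (v r)) volume t P.T ∧
      hess (P.cost t x) u v s =
        P.R s (X s) (v s) + ∫ r in t..P.T, P.bF t u X Y Φ s r (v r) := by
  have hXZ := hX.eq_solutionMap hZ
  obtain ⟨V, hYV, _, hV⟩ := hY.isCostate hT ht h3 hR hXZ
  have hjac : ∀ τ ∈ Icc t P.T, SolvesODE
      (fun s M => (dynamics hT ht h3).jacobian ht.2 (u, Z u) s ∘L M) τ P.T τ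
      (ContinuousLinearMap.id ℝ (Euc n)) (fun s => Φ s τ) := fun τ hτ =>
    (hΦ τ hτ).congr (left_mem_Icc.2 hτ.2) (fun _ _ => rfl) fun s hs => by
      rw [bA_eq_jacobian hT ht h3 hXZ ⟨s, hτ.1.trans hs.1, hs.2⟩]
  have hkernel (s : Icc t P.T) : EqOn (fun r => P.bF t u X Y Φ s r (v r))
      (fun r => ((runningCost hT ht h3 hR).hamiltonian (dynamics hT ht h3) V).variationKernel ht.2
        (dynamics hT ht h3) P.G (u, Z u) Φ s r (v r)) (uIcc t P.T) := fun r hr => by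
    rw [uIcc_of_le ht.2] at hr
    dsimp only
    rw [bF_eq_variationKernel hT ht h3 hR hXZ hYV Φ s ⟨r, hr⟩]
  rw [cost_eq_bolza hR hZ]
  filter_upwards [RunningCost.hess_bolza_ae_eq_fredholm hZ h3.smoothG hV hjac v,
    ae_restrict_mem measurableSet_Icc] with s hs hmem
  refine ⟨hs.1.congr ((hkernel ⟨s, hmem⟩).symm.mono uIoc_subset_uIcc), ?_⟩
  rw [hs.2, intervalIntegral.integral_congr (hkernel ⟨s, hmem⟩), hXZ ⟨s, hmem⟩, graphPt,
    projIcc_of_mem ht.2 hmem]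
  rfl

end AQProblem

/-! ### Invertibility -/

section Invertible

section Banach

variable {V W : Type*} [NormedAddCommGroup V] [NormedSpace ℝ V] [CompleteSpace V]
  [NormedAddCommGroup W] [NormedSpace ℝ W]

theorem isInvertible_iff_bijective [CompleteSpace W] {D : V →L[ℝ] W} :
    D.IsInvertible ↔ Function.Bijective D :=
  ⟨fun h => h.bijective, fun h => ⟨.ofBijective D (LinearMap.ker_eq_bot.2 h.1)
    (LinearMap.range_eq_top.2 h.2), ContinuousLinearMap.ext fun _ => rfl⟩⟩

theorem continuous_inverse_comp {K : Type*} [TopologicalSpace K] {f : K → V →L[ℝ] W}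
    (hf : Continuous f) (hi : ∀ s, (f s).IsInvertible) : Continuous fun s => (f s).inverse :=
  continuous_iff_continuousAt.2 fun s =>
    ((hi s).contDiffAt_map_inverse (n := 0)).continuousAt.comp hf.continuousAt

theorem isInvertible_of_norm_inverse_comp_sub_id_lt_one {S D : V →L[ℝ] W} (hS : S.IsInvertible)
    (h : ‖S.inverse ∘L D - .id ℝ V‖ < 1) : D.IsInvertible := by
  have hunit : IsUnit (S.inverse ∘L D) := by
    have := isUnit_one_sub_of_norm_lt_one ((norm_sub_rev _ _).trans_lt h)
    rwa [ContinuousLinearMap.one_def, sub_sub_cancel] at this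
  have hfactor : S ∘L S.inverse ∘L D = D := by
    rw [← ContinuousLinearMap.comp_assoc, hS.self_comp_inverse, ContinuousLinearMap.id_comp]
  rw [← hfactor]
  exact hS.comp (isInvertible_iff_bijective.2 (ContinuousLinearMap.isUnit_iff_bijective.1 hunit))

theorem isInvertible_of_coercive {U : Type*} [NormedAddCommGroup U] [InnerProductSpace ℝ U]
    [CompleteSpace U] {R : U →L[ℝ] U} {ρ : ℝ} (hρ : 0 < ρ)
    (h : ∀ u, ρ * ‖u‖ ^ 2 ≤ inner ℝ (R u) u) : R.IsInvertible :=
  isInvertible_iff_bijective.2 <| ContinuousLinearMap.isUnit_iff_bijective.1 <|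
    R.isUnit_of_forall_le_norm_inner_map (c := ⟨ρ, hρ.le⟩) hρ fun u => by
      rw [mul_comm]
      exact (h u).trans (le_abs_self _)

end Banach

section SecondKind

variable {a b : ℝ} (hab : a ≤ b) {E F : Type*} [NormedAddCommGroup F]

include hab in
theorem norm_Lp_two_le_of_ae_bound {C : ℝ} (hC : 0 ≤ C) {v : L2Icc a b F}
    (hv : ∀ᵐ s ∂volume.restrict (Icc a b), ‖v s‖ ≤ C) : ‖v‖ ≤ √(b - a) * C := by
  refine (Lp.norm_le_of_ae_bound hC hv).trans_eq ?_
  have hvol : (measureUnivNNReal (volume.restrict (Icc a b)) : ℝ) = b - a := by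
    change ((volume : Measure ℝ).restrict (Icc a b) univ).toReal = _
    rw [Measure.restrict_apply_univ, Real.volume_Icc, ENNReal.toReal_ofReal (sub_nonneg.2 hab)]
  rw [hvol, ENNReal.toReal_ofNat, ← one_div, ← Real.sqrt_eq_rpow]

variable [NormedAddCommGroup E] [NormedSpace ℝ E] [NormedSpace ℝ F]

include hab in
theorem norm_intervalIntegral_kernel_le {k : ℝ → E →L[ℝ] F} {c : ℝ} (hc : 0 ≤ c)
    (hk : ∀ᵐ r ∂volume.restrict (Icc a b), ‖k r‖ ≤ c) (v : L2Icc a b E) :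
    ‖∫ r in a..b, k r (v r)‖ ≤ c * (√(b - a) * ‖v‖) := by
  have hbound : ∀ᵐ r, r ∈ Ioc a b → ‖k r (v r)‖ ≤ c * ‖v r‖ := by
    filter_upwards [(ae_restrict_iff' measurableSet_Icc).1 hk] with r hr hmem
    exact (k r).le_of_opNorm_le (hr (Ioc_subset_Icc_self hmem)) _
  calc ‖∫ r in a..b, k r (v r)‖
      ≤ ∫ r in a..b, c * ‖v r‖ := intervalIntegral.norm_integral_le_of_norm_le hab hbound
        ((intervalIntegrable_coeFn_Lp hab v).norm.const_mul c)
    _ = c * ∫ r in Icc a b, ‖v r‖ := by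
        rw [intervalIntegral.integral_const_mul, intervalIntegral.integral_of_le hab,
          integral_Icc_eq_integral_Ioc]
    _ ≤ c * (√(b - a) * ‖v‖) := by gcongr; exact integral_norm_Lp_two_le hab v

variable [CompleteSpace E] {M : CMap (Icc a b) (E →L[ℝ] F)}

theorem isInvertible_mulLp (hM : ∀ s, (M s).IsInvertible) : (mulLp hab M).IsInvertible := by
  let N : CMap (Icc a b) (F →L[ℝ] E) := ⟨_, continuous_inverse_comp M.continuous hM⟩
  refine .of_inverse (g := mulLp hab N) ?_ ?_
  · ext1 w
    apply Lp.ext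
    filter_upwards [coeFn_mulLp hab M (mulLp hab N w), coeFn_mulLp hab N w] with s hMs hNs
    exact hMs.trans (by rw [hNs]; exact (hM _).self_apply_inverse _)
  · ext1 v
    apply Lp.ext
    filter_upwards [coeFn_mulLp hab N (mulLp hab M v), coeFn_mulLp hab M v] with s hNs hMs
    exact hNs.trans (by rw [hMs]; exact (hM _).inverse_apply_self _)

theorem coeFn_inverse_mulLp (hM : ∀ s, (M s).IsInvertible) (w : L2Icc a b F) :
    (mulLp hab M).inverse w =ᵐ[volume.restrict (Icc a b)]
      fun r => (M (projIcc a b hab r)).inverse (w r) := by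
  filter_upwards [coeFn_mulLp hab M ((mulLp hab M).inverse w)] with r hr
  rw [(isInvertible_mulLp hab hM).self_apply_inverse] at hr
  rw [hr, (hM _).inverse_apply_self]

theorem isInvertible_of_ae_eq_mul_add_integral [CompleteSpace F]
    {D : L2Icc a b E →L[ℝ] L2Icc a b F} {K : ℝ → ℝ → E →L[ℝ] F} {c : ℝ}
    (hM : ∀ s, (M s).IsInvertible)
    (hD : ∀ v, ∀ᵐ s ∂volume.restrict (Icc a b),
      IntervalIntegrable (fun r => K s r (v r)) volume a b ∧
      D v s = M (projIcc a b hab s) (v s) + ∫ r in a..b, K s r (v r))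
    (hc : 0 ≤ c) (hcab : c * (b - a) < 1)
    (hK : ∀ᵐ s ∂volume.restrict (Icc a b), ∀ᵐ r ∂volume.restrict (Icc a b),
      ‖(M (projIcc a b hab s)).inverse ∘L K s r‖ ≤ c) : D.IsInvertible := by
  have hlen : 0 ≤ b - a := sub_nonneg.2 hab
  refine isInvertible_of_norm_inverse_comp_sub_id_lt_one (isInvertible_mulLp hab hM)
    ((ContinuousLinearMap.opNorm_le_bound _ (by positivity) fun v => ?_).trans_lt hcab)
  have hpointwise : ∀ᵐ s ∂volume.restrict (Icc a b),
      ‖((mulLp hab M).inverse (D v) - v) s‖ ≤ c * (√(b - a) * ‖v‖) := by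
    filter_upwards [hD v, hK, Lp.coeFn_sub ((mulLp hab M).inverse (D v)) v,
      coeFn_inverse_mulLp hab hM (D v)] with s hDs hKs hsub hinv
    rw [hsub, Pi.sub_apply, hinv, hDs.2, map_add, (hM _).inverse_apply_self, add_sub_cancel_left,
      ← ContinuousLinearMap.intervalIntegral_comp_comm _ hDs.1]
    exact norm_intervalIntegral_kernel_le hab hc hKs v
  refine (norm_Lp_two_le_of_ae_bound hab (by positivity) hpointwise).trans_eq ?_
  linear_combination c * ‖v‖ * Real.mul_self_sqrt hlen

end SecondKind

end Invertible

namespace AQProblem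

variable {n m : ℕ} {P : AQProblem n m} {t : ℝ}

theorem fredholmWellPosed_iff_isInvertible {u : Control m t P.T} {X Y : ℝ → Euc n}
    {Φ : ℝ → ℝ → (Euc n →L[ℝ] Euc n)} {D : Control m t P.T →L[ℝ] Control m t P.T}
    (h : ∀ w v, P.SolvesFredholm t u X Y Φ w v ↔ D v = w) :
    P.FredholmWellPosed t u X Y Φ ↔ D.IsInvertible := by
  constructor
  · rintro ⟨sol, -, hsol⟩
    have hsol' (w v) : D v = w ↔ v = sol w := (h w v).symm.trans (hsol w v)
    exact isInvertible_iff_bijective.2 <| Function.bijective_iff_has_inverse.2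
      ⟨sol, fun v => ((hsol' _ _).1 rfl).symm, fun w => (hsol' _ _).2 rfl⟩
  · rintro ⟨e, rfl⟩
    exact ⟨e.symm, e.symm.continuous, fun w v => (h w v).trans e.eq_symm_apply.symm⟩

theorem isInvertible_R (h2 : P.H2) {s : ℝ} (hs : s ∈ Icc 0 P.T) (y : Euc n) :
    (P.R s y).IsInvertible := by
  obtain ⟨_, -, _, -, _, -, _, -, _, -, ρ₀, hρ₀, ρ, -, hρ, hbounds⟩ := h2.bounds
  exact isInvertible_of_coercive (hρ₀.trans_le (hρ y)) (hbounds s hs y).1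

section SecondVariation

variable {hT : 0 < P.T} {ht : t ∈ Icc 0 P.T} {h3 : P.H3}
  (hR : ∀ s ∈ Icc 0 P.T, ∀ x, IsSelfAdjoint (P.R s x)) {x : Euc n} {u : Control m t P.T}
  {Z : Control m t P.T → C(Icc t P.T, Euc n)} (hZ : (dynamics hT ht h3).IsSolutionMap ht.2 x Z)
  {X Y : ℝ → Euc n} {Φ : ℝ → ℝ → (Euc n →L[ℝ] Euc n)} (hX : P.IsState t x u X)
  (hY : P.IsAdjointState t u X Y) (hΦ : P.IsFundamental t u X Φ)
include hR hZ hX hY hΦ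

theorem solvesFredholm_iff (w v : Control m t P.T) :
    P.SolvesFredholm t u X Y Φ w v ↔ hess (P.cost t x) u v = w := by
  have hhess := hess_cost_ae_eq hT ht h3 hR hZ hX hY hΦ v
  constructor
  · intro h
    apply Lp.ext
    filter_upwards [h, hhess] with s hs hs'
    rw [hs.2, hs'.2]
  · rintro rfl
    exact hhess

theorem isInvertible_hess_cost (hinv : ∀ s ∈ Icc t P.T, (P.R s (X s)).IsInvertible) {α : ℝ}
    (hα : α * (P.T - t) < 1)
    (hF : ∀ᵐ s ∂volume.restrict (Icc t P.T), ∀ᵐ r ∂volume.restrict (Icc t P.T),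
      ‖(P.R s (X s)).inverse ∘L P.bF t u X Y Φ s r‖ ≤ α) :
    (hess (P.cost t x) u).IsInvertible := by
  let M : CMap (Icc t P.T) (Euc m →L[ℝ] Euc m) :=
    superpose (runningCost hT ht h3 hR).grad.slope.fn (Z u)
  have hM (s : Icc t P.T) : M s = P.R s (X s) := by rw [hX.eq_solutionMap hZ]; rfl
  have hMproj {s : ℝ} (hs : s ∈ Icc t P.T) : M (projIcc t P.T ht.2 s) = P.R s (X s) := by
    rw [projIcc_of_mem ht.2 hs, hM]
  refine isInvertible_of_ae_eq_mul_add_integral ht.2 (M := M) (K := P.bF t u X Y Φ)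
    (c := max α 0) (fun s => ?_) (fun v => ?_) (le_max_right _ _) ?_ ?_
  · rw [hM]
    exact hinv s s.2
  · filter_upwards [hess_cost_ae_eq hT ht h3 hR hZ hX hY hΦ v,
      ae_restrict_mem measurableSet_Icc] with s hs hmem
    rwa [hMproj hmem]
  · rw [max_mul_of_nonneg _ _ (sub_nonneg.2 ht.2), zero_mul]
    exact max_lt hα one_pos
  · filter_upwards [hF, ae_restrict_mem measurableSet_Icc] with s hs hmem
    filter_upwards [hs] with r hr
    rw [hMproj hmem]
    exact hr.trans (le_max_left _ _)

end SecondVariation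

end AQProblem

theorem mul_sub_lt_one_of_lt_one_div {α T t : ℝ} (hT : 0 < T) (ht : t ∈ Icc 0 T)
    (hα : α < 1 / T) : α * (T - t) < 1 := by
  rw [lt_div_iff₀ hT] at hα
  rcases le_total α 0 with h | h
  · exact (mul_nonpos_of_nonpos_of_nonneg h (sub_nonneg.2 ht.2)).trans_lt one_pos
  · exact (mul_le_mul_of_nonneg_left (sub_le_self T ht.1) h).trans_lt hα

theorem proposition5p1_general {n m : ℕ} (P : AQProblem n m) (hT : 0 < P.T) {LA LB : ℝ}
    (hA : ∀ s ∈ Icc 0 P.T, ∀ y z, ‖P.A s y - P.A s z‖ ≤ LA * ‖y - z‖)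
    (hB : ∀ s ∈ Icc 0 P.T, ∀ y z, ‖P.B s y - P.B s z‖ ≤ LB * ‖y - z‖)
    (hR : ∀ s ∈ Icc 0 P.T, ∀ y, IsSelfAdjoint (P.R s y)) (h3 : P.H3)
    (t : ℝ) (ht : t ∈ Icc 0 P.T) (x : Euc n) (u : Control m t P.T) :
    (Differentiable ℝ (P.cost t x) ∧ DifferentiableAt ℝ (gradient (P.cost t x)) u ∧
      ∃ X Y Φ, P.IsState t x u X ∧ P.IsAdjointState t u X Y ∧ P.IsFundamental t u X Φ) ∧
    ∀ X Y Φ, P.IsState t x u X → P.IsAdjointState t u X Y → P.IsFundamental t u X Φ →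
      ((hess (P.cost t x) u).IsInvertible ↔ P.FredholmWellPosed t u X Y Φ) ∧
      ∀ α : ℝ, α * (P.T - t) < 1 → (∀ s ∈ Icc t P.T, (P.R s (X s)).IsInvertible) →
        (∀ᵐ s ∂volume.restrict (Icc t P.T), ∀ᵐ r ∂volume.restrict (Icc t P.T),
          ‖(P.R s (X s)).inverse ∘L P.bF t u X Y Φ s r‖ ≤ α) →
        P.FredholmWellPosed t u X Y Φ ∧ (hess (P.cost t x) u).IsInvertible := by
  obtain ⟨Z, hZ⟩ := AQProblem.exists_isSolutionMap_dynamics hT ht h3 hA hB (x := x)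
  have hcost : ContDiff ℝ 2 (P.cost t x) := AQProblem.contDiff_cost hR hZ
  refine ⟨⟨hcost.differentiable two_ne_zero, ?_, ?_⟩, fun X Y Φ hX hY hΦ => ?_⟩
  · exact (hasFDerivAt_gradient ((hcost.fderiv_right (m := 1) (by norm_num)).differentiable
      one_ne_zero u)).differentiableAt
  · obtain ⟨X, hX⟩ : ∃ X, P.IsState t x u X := ⟨_, AQProblem.isState_of_isSolutionMap hZ⟩
    have hXZ := hX.eq_solutionMap hZ
    obtain ⟨Y, hY⟩ := AQProblem.exists_isAdjointState hT ht h3 hR hXZ (u := u)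
    obtain ⟨Φ, hΦ⟩ := AQProblem.exists_isFundamental hT ht h3 hXZ (u := u)
    exact ⟨X, Y, Φ, hX, hY, hΦ⟩
  · have hiff := AQProblem.fredholmWellPosed_iff_isInvertible
      (AQProblem.solvesFredholm_iff hR hZ hX hY hΦ)
    refine ⟨hiff.symm, fun α hα hinv hF => ?_⟩
    have hinvertible := AQProblem.isInvertible_hess_cost hR hZ hX hY hΦ hinv hα hF
    exact ⟨hiff.2 hinvertible, hinvertible⟩

theorem proposition5p1 {n m : ℕ} (P : AQProblem n m) (hT : 0 < P.T)
    (h1 : P.H1) (h2 : P.H2) (h3 : P.H3)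
    (t : ℝ) (ht : t ∈ Set.Icc 0 P.T) (x : Euc n) (u : Control m t P.T) :
    -- the objects in the claim exist
    (Differentiable ℝ (P.cost t x) ∧ DifferentiableAt ℝ (gradient (P.cost t x)) u ∧
      ∃ X Y Φ, P.IsState t x u X ∧ P.IsAdjointState t u X Y ∧ P.IsFundamental t u X Φ) ∧
    ∀ X Y Φ, P.IsState t x u X → P.IsAdjointState t u X Y → P.IsFundamental t u X Φ →
      ((hess (P.cost t x) u).IsInvertible ↔ P.FredholmWellPosed t u X Y Φ) ∧
      ∀ α : ℝ, α < 1 / P.T →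
        (∀ᵐ s ∂((MeasureTheory.volume : MeasureTheory.Measure ℝ).restrict (Set.Icc t P.T)),
          ∀ᵐ r ∂((MeasureTheory.volume : MeasureTheory.Measure ℝ).restrict (Set.Icc t P.T)),
            ‖(P.R s (X s)).inverse ∘L P.bF t u X Y Φ s r‖ ≤ α) →
        P.FredholmWellPosed t u X Y Φ ∧ (hess (P.cost t x) u).IsInvertible := by
  obtain ⟨_, -, hA⟩ := h1.lipA
  obtain ⟨_, -, hB⟩ := h1.lipB
  obtain ⟨hex, hiff⟩ := proposition5p1_general P hT hA hB h2.symmR h3 t ht x u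
  exact ⟨hex, fun X Y Φ hX hY hΦ => (hiff X Y Φ hX hY hΦ).imp_right fun hsuff α hα =>
    hsuff α (mul_sub_lt_one_of_lt_one_div hT ht hα) fun s hs =>
      AQProblem.isInvertible_R h2 (Icc_subset_Icc_left ht.1 hs) _⟩
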